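/- **Setting.** All congruences are modulo $2$. Let $[n]_0=\{0,\dots,n\}$, $[n]=\{1,\dots,n\}$, $[\pm n]_0=\{-n,\dots,n\}$. $B_n$ is the group of permutations $w$ of $[\pm n]_0$ with $w(-x)=-w(x)$; it is the Coxeter group with generators $s_0,\dots,s_{n-1}$, where $s_0$ changes the sign of $1$ and $s_i$ ($i>0$) exchanges $i$ and $i+1$ (and $-i$, $-(i+1)$). $B_{n-1}\subset B_n$ is the subgroup fixing $n$. Let $l$ be the Coxeter length, $\operatorname{sgn}(w)=(-1)^{l(w)}$, $D(w)=\{i\in[n-1]_0: l(ws_i)<l(w)\}$, and $$L(w)=\tfrac12\bigl|\{(a,b)\in[\pm n]_0^2: a<b,\ w(a)>w(b),\ a\not\equiv b\}\bigr|.$$ The signed permutation matrix of $w$ has entry $1$ at $(i,k)$ if $w(k)=i$, $-1$ if $w(k)=-i$, and $0$ otherwise ($i,k\in[n]$). "The entry" of a row or column is its nonzero entry; $i(t)$ is the row of the entry of column $t$. A row is right (weakly left) of column $k$ if its entry lies in a column $>k$ ($\le k$). For $I\subseteq[n-1]_0$, $C_n^{I^c}$ is the set of $w\in B_n$ with $D(w)\subseteq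 I$ all of whose entries lie at positions $(i,k)$ with $i\equiv k$, and $(C_n^{I^c})_k=\{w\in C_n^{I^c}: w(k)=n \text{ or } w(k+1)=-n\}$. Fix a column $k$. A *block* $B_{r,s}$ is a maximal set $\{r,\dots,s\}$, $r\le s$, of consecutive rows right of $k$. A *block of ones* $P_{r,s}$ (*of minus ones* $N_{r,s}$) is a maximal set $\{r,\dots,s\}$, $r\le s$, of consecutive rows right of $k$ with entry $1$ ($-1$). Any of these is even or odd according to its number of rows. Columns $t,t+1\le n$ form an $(\varepsilon,\delta)_t$ *pair* if $t>k$, $t\not\equiv n$, and their entries are $\varepsilon,\delta$. **Initially uncanceled.** $(U_n^{I^c})_j$ is the set of $w\in(C_n^{I^c})_j$ such that, with respect to column $j$: 1. row $n-1$ is weakly left of $j$ or has entry $-1$ (no condition if $n=1$); 2. there are no odd blocks; 3. every row $t$ right of $j$ with entry $1$ lies in an even block of ones, unless all rows above $t$ are right of $j$ with entry $1$; 4. if $n$ is even there is no $(-1,1)_t$ pair; if $n$ is odd there is at most one, and then $i(t+1)=1$ and all rows above $i(t)$ are right of $j$ with entry $1$; 5. for every $(-1,-1)_t$ pair, all rows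 strictly between $i(t)$ and $i(t+1)$ are right of $j$ with entry $1$; 6. if $N_{p,q}\subsetneq B_{r,s}$, then $N_{p,q}$ is odd if and only if $p=r$ or $q=s$; 7. if $B_{r,s}$ is an even block and $P_{r,q}$ (respectively $P_{p,s}$) is an even block of ones, then $q=s$ (respectively $p=r$). **Finally uncanceled.** $(V_n^{I^c})_k$ is the set of $w\in C_n^{I^c}$ such that, with respect to column $k$: 1. row $n$ is weakly left of $k$ or has entry $1$ (no condition if $n=0$); 2. there are no odd blocks; 3. every row $t$ right of $k$ with entry $-1$ lies in an even block of minus ones, unless all rows above $t$ are right of $k$ with entry $-1$; 4. if $n$ is odd there is no $(-1,1)_t$ pair; if $n$ is even there is at most one, and then $i(t)=1$ and all rows above $i(t+1)$ are right of $k$ with entry $-1$; 5. for every $(1,1)_t$ pair, all rows strictly between $i(t)$ and $i(t+1)$ are right of $k$ with entry $-1$; 6. if $P_{p,q}\subsetneq B_{r,s}$, then $P_{p,q}$ is odd if and only if $p=r$ or $q=s$; 7. if $B_{r,s}$ is an even block and $N_{r,q}$ (respectively $N_{p,s}$) is an even block of minus ones, then $q=s$ (respectively $p=r$). **The maps.**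 Let $1\le j\le n$. Below, blocks in $B_{n-1}$ are taken with respect to column $j-1$; products over different blocks commute. *Lowering map* $H$, on $w\in (U_n^{I^c})_j$: put $w_1=ws_js_{j+1}\cdots s_{n-1}\in B_{n-1}$; obtain $w_2$ from $w_1$ by multiplying on the left by $s_rs_{r+1}\cdots s_t$ for every block of ones $P_{r,t}$ of $w_1$; let $w_3=s_0w_2$ if $N_{1,1}$ is a block of minus ones of $w_2$, and $w_3=w_2$ otherwise; obtain $H(w)$ from $w_3$ by multiplying on the left by $s_{t-1}\cdots s_{r-1}$ for every block of minus ones $N_{r,t}$ of $w_3$. *Raising map* $R$, on $v\in B_{n-1}$: obtain $v_1$ from $v$ by multiplying on the left by $s_rs_{r+1}\cdots s_t$ for every block of minus ones $N_{r,t}$ of $v$; let $v_2=s_0v_1$ if $P_{1,1}$ is a block of ones of $v_1$, and $v_2=v_1$ otherwise; obtain $v_3$ from $v_2$ by multiplying on the left by $s_{t-1}\cdots s_{r-1}$ for every block of ones $P_{r,t}$ of $v_2$; put $R(v)=v_3s_{n-1}\cdots s_{j+1}s_j\in B_n$. **Statement.** Let $I\subseteq[n-1]_0$, let $j\ge 1$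 be an element of $I\cup\{n\}$ such that every $i\in I\cup\{n\}$ with $i\ge j$ satisfies $i\equiv n$, and let $J=\{i\in I: i<j\}\cup\{i-1: i\in I,\ i\ge j\}$. Then $H$ maps $(U_n^{I^c})_j$ into $(V_{n-1}^{J^c})_{j-1}$, $R$ maps $(V_{n-1}^{J^c})_{j-1}$ into $(U_n^{I^c})_j$, and these maps are mutually inverse bijections. Moreover, for every $w\in(U_n^{I^c})_j$, $\operatorname{sgn}(H(w))=\operatorname{sgn}(w)$ and $L(H(w))=L(w)-(n-j)$. -/

import Mathlib

/-!
Signed permutations of `{-n, …, n}` are realised as permutations of `ℤ` that commute with negation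
and fix every integer of absolute value larger than `n`. In this way the natural embedding of
`B_{n-1}` in `B_n` (as the elements fixing `n`) is the inclusion. A signed permutation `w` is also
read as a signed permutation matrix; rows and columns are numbered `1, …, n`.
-/

namespace SignedPerm

/-- The hyperoctahedral group `B_n`. -/
def B (n : ℕ) : Subgroup (Equiv.Perm ℤ) where
  carrier := {w | (∀ x, w (-x) = -w x) ∧ ∀ x, (n : ℤ) < |x| → w x = x}
  mul_mem' := by
    rintro a b ⟨ha, ha'⟩ ⟨hb, hb'⟩
    refine ⟨fun x => ?_, fun x hx => ?_⟩
    · simp [hb, ha]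
    · simp [hb' x hx, ha' x hx]
  one_mem' := by simp
  inv_mem' := by
    rintro a ⟨ha, ha'⟩
    refine ⟨fun x => ?_, fun x hx => ?_⟩
    · rw [Equiv.Perm.inv_eq_iff_eq, ha]
      simp
    · rw [Equiv.Perm.inv_eq_iff_eq, ha' x hx]

/-- The Coxeter generators: `s 0` changes the sign of `1`, and `s i` (`i > 0`) exchanges `i` and
`i + 1` (and `-i` and `-(i+1)`). -/
def s (i : ℕ) : Equiv.Perm ℤ :=
  if i = 0 then Equiv.swap 1 (-1)
  else Equiv.swap (i : ℤ) (i + 1) * Equiv.swap (-(i : ℤ)) (-(i + 1))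

/-- The Coxeter length on `B_n`: the least length of a word in `s 0, …, s (n-1)` with product
`w`. -/
noncomputable def len (n : ℕ) (w : Equiv.Perm ℤ) : ℕ :=
  sInf {l | ∃ word : List ℕ, (∀ i ∈ word, i < n) ∧ (word.map s).prod = w ∧ word.length = l}

/-- `sgn w = (-1) ^ l(w)`. -/
noncomputable def sgn (n : ℕ) (w : Equiv.Perm ℤ) : ℤ := (-1) ^ len n w

/-- The right descent set `D(w) = {i ∈ {0, …, n-1} | l(w s_i) < l(w)}`. -/
def descents (n : ℕ) (w : Equiv.Perm ℤ) : Set ℕ :=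
  {i | i < n ∧ len n (w * s i) < len n w}

/-- The statistic
`L(w) = (1/2) |{(i, j) ∈ {-n, …, n}² | i < j, w(i) > w(j), i ≢ j mod 2}|`. -/
noncomputable def L (n : ℕ) (w : Equiv.Perm ℤ) : ℚ :=
  1 / 2 * (((Finset.Icc (-n : ℤ) n ×ˢ Finset.Icc (-n : ℤ) n).filter
    (fun p => p.1 < p.2 ∧ w p.2 < w p.1 ∧ ¬ p.1 ≡ p.2 [ZMOD 2])).card : ℚ)

/-- The entry in row `i` and column `j` of the signed permutation matrix of `w`. -/
def entry (w : Equiv.Perm ℤ) (i j : ℕ) : ℤ :=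
  if w j = i then 1 else if w j = -(i : ℤ) then -1 else 0

/-- The row of the nonzero entry of column `k`. -/
def row (w : Equiv.Perm ℤ) (k : ℕ) : ℕ := (w k).natAbs

/-- The column of the nonzero entry of row `t`. -/
def col (w : Equiv.Perm ℤ) (t : ℕ) : ℕ := (w⁻¹ (t : ℤ)).natAbs

/-- The nonzero entry of column `k`. -/
def colSign (w : Equiv.Perm ℤ) (k : ℕ) : ℤ := entry w (row w k) k

/-- The nonzero entry of row `t`. -/
def rowSign (w : Equiv.Perm ℤ) (t : ℕ) : ℤ := entry w t (col w t)

/-- The quotient `B_n^K = {w ∈ B_n | D(w) ⊆ {0, …, n-1} \ K}`. -/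
def quotient (n : ℕ) (K : Finset ℕ) : Set (Equiv.Perm ℤ) :=
  {w | w ∈ B n ∧ descents n w ⊆ ↑(Finset.range n \ K)}

/-- The chessboard elements `C_n`: all nonzero entries lie on squares `(i, j)` with `i + j` even. -/
def chessboard (n : ℕ) : Set (Equiv.Perm ℤ) :=
  {w | w ∈ B n ∧ ∀ i ∈ Finset.Icc 1 n, ∀ j ∈ Finset.Icc 1 n, entry w i j ≠ 0 → Even (i + j)}

/-- `C_n^K`. -/
def chessQuotient (n : ℕ) (K : Finset ℕ) : Set (Equiv.Perm ℤ) := chessboard n ∩ quotient n K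

/-- `(C_n^K)_k`: the `w ∈ C_n^K` with `w(k) = n` or `w(k+1) = -n`. -/
def chessQuotientAt (n : ℕ) (K : Finset ℕ) (k : ℕ) : Set (Equiv.Perm ℤ) :=
  {w | w ∈ chessQuotient n K ∧ (w k = n ∨ w (k + 1) = -(n : ℤ))}

/-- `{r, …, t}` is a block with respect to column `k`: a maximal set of consecutive rows whose
nonzero entries are right of column `k`. -/
def IsBlock (n k : ℕ) (w : Equiv.Perm ℤ) (r t : ℕ) : Prop :=
  1 ≤ r ∧ r ≤ t ∧ t ≤ n ∧ (∀ x ∈ Finset.Icc r t, k < col w x) ∧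
    (t ≠ n → col w (t + 1) ≤ k) ∧ (r ≠ 1 → col w (r - 1) ≤ k)

/-- For `ε = 1`, `{r, …, t}` is a block of ones with respect to column `k`; for `ε = -1`, it is a
block of minus ones: a maximal set of consecutive rows whose nonzero entries are right of column
`k` and equal to `ε`. -/
def IsSignBlock (n k : ℕ) (ε : ℤ) (w : Equiv.Perm ℤ) (r t : ℕ) : Prop :=
  1 ≤ r ∧ r ≤ t ∧ t ≤ n ∧ (∀ x ∈ Finset.Icc r t, k < col w x ∧ rowSign w x = ε) ∧
    (t ≠ n → col w (t + 1) ≤ k ∨ rowSign w (t + 1) = -ε) ∧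
    (r ≠ 1 → col w (r - 1) ≤ k ∨ rowSign w (r - 1) = -ε)

instance (n k : ℕ) (ε : ℤ) (w : Equiv.Perm ℤ) (r t : ℕ) : Decidable (IsSignBlock n k ε w r t) := by
  unfold IsSignBlock
  infer_instance

/-- The set of rows `{r, …, t}` has an even number of elements. -/
def EvenRows (r t : ℕ) : Prop := ¬ r ≡ t [MOD 2]

/-- The set of rows `{r, …, t}` has an odd number of elements. -/
def OddRows (r t : ℕ) : Prop := r ≡ t [MOD 2]

/-- Columns `t, t + 1` form an `(ε, δ)_t` pair with respect to column `k`. -/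
def IsPair (n k : ℕ) (ε δ : ℤ) (w : Equiv.Perm ℤ) (t : ℕ) : Prop :=
  k < t ∧ t + 1 ≤ n ∧ ¬ t ≡ n [MOD 2] ∧ colSign w t = ε ∧ colSign w (t + 1) = δ

/-- Row `x` lies strictly between rows `a` and `b`. -/
def RowBetween (x a b : ℕ) : Prop := min a b < x ∧ x < max a b

/-- The seven properties of an initially uncanceled matrix with respect to column `j`. -/
structure InitiallyUncanceled (n j : ℕ) (w : Equiv.Perm ℤ) : Prop where
  prop1 : col w (n - 1) ≤ j ∨ rowSign w (n - 1) = -1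
  prop2 : ∀ r t, IsBlock n j w r t → ¬ OddRows r t
  prop3 : ∀ t ∈ Finset.Icc 1 n, rowSign w t = 1 → j < col w t →
    (∃ r q, IsSignBlock n j 1 w r q ∧ EvenRows r q ∧ r ≤ t ∧ t ≤ q) ∨
      ∀ p, 1 ≤ p → p < t → j < col w p ∧ rowSign w p = 1
  prop4_even : Even n → ∀ t, ¬ IsPair n j (-1) 1 w t
  prop4_odd : Odd n →
    (∀ t t', IsPair n j (-1) 1 w t → IsPair n j (-1) 1 w t' → t = t') ∧
      ∀ t, IsPair n j (-1) 1 w t → row w (t + 1) = 1 ∧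
        ∀ p, 1 ≤ p → p < row w t → rowSign w p = 1 ∧ j < col w p
  prop5 : ∀ t, IsPair n j (-1) (-1) w t → ∀ x, RowBetween x (row w t) (row w (t + 1)) →
    rowSign w x = 1 ∧ j < col w x
  prop6 : ∀ r t p q, IsBlock n j w r t → IsSignBlock n j (-1) w p q → r ≤ p → q ≤ t →
    (p, q) ≠ (r, t) → (OddRows p q ↔ p = r ∨ q = t)
  prop7 : ∀ r t, IsBlock n j w r t → EvenRows r t →
    (∀ q, IsSignBlock n j 1 w r q → EvenRows r q → q = t) ∧
      ∀ p, IsSignBlock n j 1 w p t → EvenRows p t → p = r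

/-- The seven properties of a finally uncanceled matrix with respect to column `k`. -/
structure FinallyUncanceled (n k : ℕ) (w : Equiv.Perm ℤ) : Prop where
  prop1 : col w n ≤ k ∨ rowSign w n = 1
  prop2 : ∀ r t, IsBlock n k w r t → ¬ OddRows r t
  prop3 : ∀ t ∈ Finset.Icc 1 n, rowSign w t = -1 → k < col w t →
    (∃ r q, IsSignBlock n k (-1) w r q ∧ EvenRows r q ∧ r ≤ t ∧ t ≤ q) ∨
      ∀ p, 1 ≤ p → p < t → k < col w p ∧ rowSign w p = -1
  prop4_even : Even n →
    (∀ t t', IsPair n k (-1) 1 w t → IsPair n k (-1) 1 w t' → t = t') ∧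
      ∀ t, IsPair n k (-1) 1 w t → row w t = 1 ∧
        ∀ p, 1 ≤ p → p < row w (t + 1) → rowSign w p = -1 ∧ k < col w p
  prop4_odd : Odd n → ∀ t, ¬ IsPair n k (-1) 1 w t
  prop5 : ∀ t, IsPair n k 1 1 w t → ∀ x, RowBetween x (row w t) (row w (t + 1)) →
    rowSign w x = -1 ∧ k < col w x
  prop6 : ∀ r t p q, IsBlock n k w r t → IsSignBlock n k 1 w p q → r ≤ p → q ≤ t →
    (p, q) ≠ (r, t) → (OddRows p q ↔ p = r ∨ q = t)
  prop7 : ∀ r t, IsBlock n k w r t → EvenRows r t →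
    (∀ q, IsSignBlock n k (-1) w r q → EvenRows r q → q = t) ∧
      ∀ p, IsSignBlock n k (-1) w p t → EvenRows p t → p = r

/-- `(U_n^K)_j`, the initially uncanceled elements. -/
def U (n : ℕ) (K : Finset ℕ) (j : ℕ) : Set (Equiv.Perm ℤ) :=
  {w | w ∈ chessQuotientAt n K j ∧ InitiallyUncanceled n j w}

/-- `(V_n^K)_k`, the finally uncanceled elements. -/
def V (n : ℕ) (K : Finset ℕ) (k : ℕ) : Set (Equiv.Perm ℤ) :=
  {w | w ∈ chessQuotient n K ∧ FinallyUncanceled n k w}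

/-- For `j` the `r`-th element of `I ∪ {n}`, the set `I^{(r)}`: all elements of `I` that are at
least `j` are decreased by one. -/
def shiftDown (I : Finset ℕ) (j : ℕ) : Finset ℕ :=
  I.filter (fun i => i < j) ∪ (I.filter (fun i => j ≤ i)).image (fun i => i - 1)

/-- `s_a s_{a+1} ⋯ s_b`. -/
def ascProd (a b : ℕ) : Equiv.Perm ℤ := ((List.range' a (b + 1 - a)).map s).prod

/-- `s_b s_{b-1} ⋯ s_a`. -/
def descProd (a b : ℕ) : Equiv.Perm ℤ := ((List.range' a (b + 1 - a)).reverse.map s).prod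

/-- The list of all `(r, t)` such that `{r, …, t}` is a block of ones (`ε = 1`) or of minus ones
(`ε = -1`) of `w` with respect to column `k`, from top to bottom. -/
def signBlocks (n k : ℕ) (ε : ℤ) (w : Equiv.Perm ℤ) : List (ℕ × ℕ) :=
  ((List.range' 1 n).product (List.range' 1 n)).filter
    (fun b => decide (IsSignBlock n k ε w b.1 b.2))

/-- For every block `{r, …, t}` of entries `ε` of `w`, multiply on the left by `s_r ⋯ s_t`, which
moves the block one row down. The factors for different blocks commute, so that the order of the
blocks does not matter. -/
def moveDown (n k : ℕ) (ε : ℤ) (w : Equiv.Perm ℤ) : Equiv.Perm ℤ :=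
  (signBlocks n k ε w).foldl (fun x b => ascProd b.1 b.2 * x) w

/-- For every block `{r, …, t}` of entries `ε` of `w`, multiply on the left by `s_{t-1} ⋯ s_{r-1}`,
which moves the block one row up (with a change of sign of row `1`, if `r = 1`). -/
def moveUp (n k : ℕ) (ε : ℤ) (w : Equiv.Perm ℤ) : Equiv.Perm ℤ :=
  (signBlocks n k ε w).foldl (fun x b => descProd (b.1 - 1) (b.2 - 1) * x) w

/-- If `{1}` is a block of entries `ε` of `w`, change the sign of row `1`. -/
def flipTop (n k : ℕ) (ε : ℤ) (w : Equiv.Perm ℤ) : Equiv.Perm ℤ :=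
  if IsSignBlock n k ε w 1 1 then s 0 * w else w

/-- The lowering map `H`. -/
def lowering (n j : ℕ) (w : Equiv.Perm ℤ) : Equiv.Perm ℤ :=
  let w₁ := w * ascProd j (n - 1)
  let w₂ := moveDown (n - 1) (j - 1) 1 w₁
  let w₃ := flipTop (n - 1) (j - 1) (-1) w₂
  moveUp (n - 1) (j - 1) (-1) w₃

/-- The raising map `R`. -/
def raising (n j : ℕ) (v : Equiv.Perm ℤ) : Equiv.Perm ℤ :=
  let v₁ := moveDown (n - 1) (j - 1) (-1) v
  let v₂ := flipTop (n - 1) (j - 1) 1 v₁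
  let v₃ := moveUp (n - 1) (j - 1) 1 v₂
  v₃ * descProd j (n - 1)

end SignedPerm

/-! ### The group `B n`, its generators, and products of consecutive generators -/

namespace SignedPerm

/-! Put N = n-1 and k = j-1. Deleting row n and column j from an initially uncanceled matrix leaves
an element of B_N, to be studied with respect to column k. As k ≡ N, the columns right of k split
into pairs c, c+1 with c ≢ N. A sign ε treats both kinds of matrices at once: ε = 1 for the
initially uncanceled ones after the deletion, ε = -1 for the finally uncanceled ones. Below, a row
right of k is called positive if its entry is ε and negative if it is -ε; a pair of columns is
recorded by its signed rows times ε, as (a, b) with a < b in the cases of interest.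

Given the chessboard parities and the ascents inside the pairs, the seven conditions amount to a
local description `IsU` of each pair: a ≡ N, b ≢ N, and either 0 < a and b = a+1, or a < 0, b ≤ 1
and all rows between the two are positive (for b = 1: all rows above -a). This is
`Pattern.isU_of_uncanceled` and `Pattern.uncanceled_of_isU`.

Moving the positive blocks one row down brings the two rows of every negative pair together; the
only pair of mixed sign, with b = 1, lands in rows 1 and 2 and becomes positive by the sign change
in row 1. The result (`drop`) satisfies b = a+1 for every pair, with prescribed parities (`IsW`),
and this normal form does not change when ε is replaced by -ε (`isW_neg`). Moving the positive
blocks up is inverse to `drop` (`moveUp_drop`, `drop_moveUp`). So H passes from the description with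
ε = 1 to the normal form and leaves it again by the inverse of `drop` for ε = -1, while R follows
the same way back (`transfer_transfer`). Descents and chessboard parities survive because `drop`
preserves the order of the values within the columns 0, …, k and within the columns right of k, and
the parities of the rows left of k.

For the sign, the downward move uses one generator per positive row. Positive rows come in twos
except for row 1 of a mixed pair, and the resulting sign is compensated by s_0. For L, the row that
jumps over a positive block meets two columns of opposite parity in each pair, so each pair with b >
0 changes 2L by 2. In the normal form every pair is positive for exactly one of the two signs, hence
the two halves of H together lower 2L by N-k, and by 2 more if there is a mixed pair. Deleting the
column lowers 2L by another n-j, up to the same correction with the opposite sign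
(`twiceL_eq_column`): there the parities of the columns right of k shift, which is repaired by
exchanging the two columns of a pair. The corrections cancel. -/

theorem B_neg {n : ℕ} {w : Equiv.Perm ℤ} (hw : w ∈ B n) (x : ℤ) : w (-x) = -w x := hw.1 x

theorem B_zero {n : ℕ} {w : Equiv.Perm ℤ} (hw : w ∈ B n) : w 0 = 0 := by
  have := hw.1 0
  rw [neg_zero] at this
  omega

theorem B_fix {n : ℕ} {w : Equiv.Perm ℤ} (hw : w ∈ B n) {x : ℤ} (hx : x < -n ∨ n < x) :
    w x = x :=
  hw.2 x (by rcases abs_cases x with h | h <;> omega)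

theorem B_range {n : ℕ} {w : Equiv.Perm ℤ} (hw : w ∈ B n) {x : ℤ} (h₁ : -(n : ℤ) ≤ x)
    (h₂ : x ≤ n) : -(n : ℤ) ≤ w x ∧ w x ≤ n := by
  by_contra h
  have h' : w x < -n ∨ n < w x := by omega
  have := w.injective (B_fix hw h')
  omega

theorem B_ne_zero {n : ℕ} {w : Equiv.Perm ℤ} (hw : w ∈ B n) {x : ℤ} (hx : x ≠ 0) : w x ≠ 0 := by
  intro h
  exact hx (w.injective (h.trans (B_zero hw).symm))

theorem B_mono {m n : ℕ} (h : m ≤ n) : B m ≤ B n := by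
  intro w hw
  exact ⟨hw.1, fun x hx => hw.2 x (by omega)⟩

theorem mem_B_of_fix {n : ℕ} {w : Equiv.Perm ℤ} (hw : w ∈ B (n + 1)) (h : w (n + 1) = n + 1) :
    w ∈ B n := by
  refine ⟨hw.1, fun x hx => ?_⟩
  by_cases h' : ((n + 1 : ℕ) : ℤ) < |x|
  · exact hw.2 x h'
  · push_cast at h'
    rcases abs_cases x with h'' | h''
    · have : x = n + 1 := by omega
      rw [this, h]
    · have : x = -(n + 1) := by omega
      rw [this, hw.1, h]

theorem B_ext {n : ℕ} {v w : Equiv.Perm ℤ} (hv : v ∈ B n) (hw : w ∈ B n)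
    (h : ∀ x : ℤ, 1 ≤ x → x ≤ n → v x = w x) : v = w := by
  ext x
  rcases lt_trichotomy x 0 with h0 | h0 | h0
  · by_cases h1 : -(n : ℤ) ≤ x
    · have := h (-x) (by omega) (by omega)
      rw [B_neg hv, B_neg hw] at this
      omega
    · rw [B_fix hv (by omega), B_fix hw (by omega)]
  · rw [h0, B_zero hv, B_zero hw]
  · by_cases h1 : x ≤ (n : ℤ)
    · exact h x (by omega) h1
    · rw [B_fix hv (by omega), B_fix hw (by omega)]

theorem s_zero_apply (x : ℤ) : s 0 x = if x = 1 then -1 else if x = -1 then 1 else x := by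
  simp only [s, if_true, Equiv.swap_apply_def]

theorem s_apply {i : ℕ} (hi : i ≠ 0) (x : ℤ) :
    s i x = if x = i then (i : ℤ) + 1 else if x = i + 1 then (i : ℤ) else
      if x = -i then -((i : ℤ) + 1) else if x = -(i + 1) then -(i : ℤ) else x := by
  simp only [s, if_neg hi, Equiv.Perm.mul_apply, Equiv.swap_apply_def]
  grind

theorem s_mul_self (i : ℕ) : s i * s i = 1 := by
  ext x
  rw [Equiv.Perm.mul_apply, Equiv.Perm.one_apply]
  by_cases hi : i = 0
  · subst hi
    simp only [s_zero_apply]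
    grind
  · simp only [s_apply hi]
    split_ifs <;> omega

theorem s_inv (i : ℕ) : (s i)⁻¹ = s i := inv_eq_of_mul_eq_one_left (s_mul_self i)

theorem s_mem_B {i n : ℕ} (h : i < n) : s i ∈ B n := by
  by_cases hi : i = 0
  · subst hi
    refine ⟨fun x => ?_, fun x hx => ?_⟩
    · simp only [s_zero_apply]
      split_ifs <;> omega
    · rw [s_zero_apply]
      rcases abs_cases x with h | h <;> split_ifs <;> omega
  · refine ⟨fun x => ?_, fun x hx => ?_⟩
    · simp only [s_apply hi]
      split_ifs <;> omega
    · rw [s_apply hi]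
      rcases abs_cases x with h | h <;> split_ifs <;> omega

theorem ascProd_of_lt {a b : ℕ} (h : b < a) : ascProd a b = 1 := by
  rw [ascProd, show b + 1 - a = 0 by omega]
  rfl

theorem ascProd_cons {a b : ℕ} (h : a ≤ b) : ascProd a b = s a * ascProd (a + 1) b := by
  rw [ascProd, ascProd, show b + 1 - a = (b + 1 - (a + 1)) + 1 by omega, List.range'_succ]
  simp

theorem descProd_eq_inv (a b : ℕ) : descProd a b = (ascProd a b)⁻¹ := by
  rw [descProd, ascProd]
  generalize List.range' a (b + 1 - a) = l
  induction l with
  | nil => simp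
  | cons c l ih =>
    rw [List.reverse_cons, List.map_append, List.prod_append, ih]
    simp [s_inv]

theorem ascProd_mem_B {a b n : ℕ} (h : b < n) : ascProd a b ∈ B n := by
  refine Subgroup.list_prod_mem _ fun x hx => ?_
  obtain ⟨i, hi, rfl⟩ := List.mem_map.1 hx
  rw [List.mem_range'_1] at hi
  exact s_mem_B (by omega)

theorem descProd_mem_B {a b n : ℕ} (h : b < n) : descProd a b ∈ B n := by
  rw [descProd_eq_inv]
  exact inv_mem (ascProd_mem_B h)

theorem ascProd_apply {a b : ℕ} (ha : 1 ≤ a) (hab : a ≤ b + 1) (x : ℤ) :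
    ascProd a b x = if (a : ℤ) ≤ x ∧ x ≤ b then x + 1 else if x = b + 1 then (a : ℤ) else
      if (a : ℤ) ≤ -x ∧ -x ≤ b then x - 1 else if x = -(b + 1) then -(a : ℤ) else x := by
  obtain ⟨d, hd⟩ : ∃ d, b + 1 = a + d := ⟨b + 1 - a, by omega⟩
  · induction d generalizing a with
    | zero =>
      rw [ascProd_of_lt (by omega), Equiv.Perm.one_apply]
      split_ifs <;> omega
    | succ d ih =>
      rw [ascProd_cons (by omega), Equiv.Perm.mul_apply, ih (by omega) (by omega) (by omega),
        s_apply (by omega)]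
      push_cast
      split_ifs <;> omega

theorem descProd_apply {a b : ℕ} (ha : 1 ≤ a) (hab : a ≤ b + 1) (x : ℤ) :
    descProd a b x = if (a : ℤ) < x ∧ x ≤ b + 1 then x - 1 else if x = a then (b : ℤ) + 1 else
      if (a : ℤ) < -x ∧ -x ≤ b + 1 then x + 1 else if x = -a then -((b : ℤ) + 1) else x := by
  rw [descProd_eq_inv, Equiv.Perm.inv_eq_iff_eq, ascProd_apply ha hab]
  split_ifs <;> omega

/-- When a block starting in row 1 is moved up, its product ends with s_0, which acts first: the
entry of row 1 changes sign and then passes to the bottom of the block. -/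
theorem descProd_zero (b : ℕ) : descProd 0 b = descProd 1 b * s 0 := by
  rw [descProd_eq_inv, descProd_eq_inv, ascProd_cons (Nat.zero_le b), mul_inv_rev, s_inv]

theorem descProd_zero_apply (b : ℕ) (x : ℤ) :
    descProd 0 b x = if x = 1 then -((b : ℤ) + 1) else if x = -1 then (b : ℤ) + 1 else
      if 1 < x ∧ x ≤ b + 1 then x - 1 else if 1 < -x ∧ -x ≤ b + 1 then x + 1 else x := by
  rw [descProd_zero, Equiv.Perm.mul_apply, descProd_apply le_rfl (by omega), s_zero_apply]
  grind

end SignedPerm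

/-! ### Inversions under left multiplication by a generator -/

namespace SignedPerm

/-- The inversions `(a, b)` of `w` in `{-n, …, n}` that satisfy `Q a b`. -/
noncomputable def invSet (n : ℕ) (w : Equiv.Perm ℤ) (Q : ℤ → ℤ → Prop) [DecidableRel Q] :
    Finset (ℤ × ℤ) :=
  (Finset.Icc (-n : ℤ) n ×ˢ Finset.Icc (-n : ℤ) n).filter
    (fun p => p.1 < p.2 ∧ w p.2 < w p.1 ∧ Q p.1 p.2)

theorem mem_invSet {n : ℕ} {w : Equiv.Perm ℤ} {Q : ℤ → ℤ → Prop} [DecidableRel Q] {a b : ℤ} :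
    (a, b) ∈ invSet n w Q ↔ -(n : ℤ) ≤ a ∧ b ≤ n ∧ a < b ∧ w b < w a ∧ Q a b := by
  simp only [invSet, Finset.mem_filter, Finset.mem_product, Finset.mem_Icc]
  constructor
  · rintro ⟨⟨⟨h1, h2⟩, h3, h4⟩, h5, h6, h7⟩
    exact ⟨h1, h4, h5, h6, h7⟩
  · rintro ⟨h1, h2, h3, h4, h5⟩
    exact ⟨⟨⟨h1, by omega⟩, by omega, h2⟩, h3, h4, h5⟩

theorem s_lt_iff {i : ℕ} (hi : i ≠ 0) {x y : ℤ} (h₁ : ¬ (x = i ∧ y = i + 1))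
    (h₂ : ¬ (x = i + 1 ∧ y = i)) (h₃ : ¬ (x = -i ∧ y = -(i + 1)))
    (h₄ : ¬ (x = -(i + 1) ∧ y = -i)) : s i x < s i y ↔ x < y := by
  rw [s_apply hi, s_apply hi]
  split_ifs <;> omega

/-- Exchanging two neighbouring values alters the order of no other values, so the only new
inversions are (p, q) and its mirror image (-q, -p). The symmetry of `Q` counts both or neither. -/
theorem card_invSet_s_mul {n i : ℕ} {w : Equiv.Perm ℤ} (hw : w ∈ B n) (hi : 1 ≤ i) (hin : i < n)
    (Q : ℤ → ℤ → Prop) [DecidableRel Q] (hQ : ∀ a b, Q a b ↔ Q (-b) (-a)) {p q : ℤ}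
    (hp : w p = i) (hq : w q = i + 1) (hpq : p < q) :
    (invSet n (s i * w) Q).card = (invSet n w Q).card + if Q p q then 2 else 0 := by
  have hp' : w (-p) = -i := by rw [B_neg hw, hp]
  have hq' : w (-q) = -(i + 1) := by rw [B_neg hw, hq]
  have rp : -(n : ℤ) ≤ p ∧ p ≤ n := by
    by_contra h
    have := B_fix hw (x := p) (by omega)
    omega
  have rq : -(n : ℤ) ≤ q ∧ q ≤ n := by
    by_contra h
    have := B_fix hw (x := q) (by omega)
    omega
  have ep : ∀ a, w a = i ↔ a = p := fun a => by rw [← hp, w.injective.eq_iff]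
  have eq : ∀ a, w a = i + 1 ↔ a = q := fun a => by rw [← hq, w.injective.eq_iff]
  have ep' : ∀ a, w a = -i ↔ a = -p := fun a => by rw [← hp', w.injective.eq_iff]
  have eq' : ∀ a, w a = -(i + 1) ↔ a = -q := fun a => by rw [← hq', w.injective.eq_iff]
  have s1 : s i i = i + 1 := by rw [s_apply (by omega)]; simp
  have s2 : s i (i + 1) = i := by rw [s_apply (by omega)]; simp
  have s3 : s i (-i) = -(i + 1) := by rw [(s_mem_B hin).1, s1]
  have s4 : s i (-(i + 1)) = -i := by rw [(s_mem_B hin).1, s2]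
  have key : invSet n (s i * w) Q =
      invSet n w Q ∪ ({(p, q), (-q, -p)} : Finset (ℤ × ℤ)).filter (fun x => Q x.1 x.2) := by
    ext ⟨a, b⟩
    simp only [Finset.mem_union, mem_invSet, Finset.mem_filter, Finset.mem_insert,
      Finset.mem_singleton, Prod.mk.injEq, Equiv.Perm.mul_apply]
    by_cases h1 : a = p ∧ b = q
    · obtain ⟨rfl, rfl⟩ := h1
      rw [hp, hq, s1, s2]
      simp only [true_and, and_self, true_or]
      refine ⟨fun h => Or.inr h.2.2.2.2,
        fun h => ⟨by omega, by omega, by omega, by omega, ?_⟩⟩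
      rcases h with h | h
      · exact h.2.2.2.2
      · exact h
    by_cases h2 : a = -q ∧ b = -p
    · obtain ⟨rfl, rfl⟩ := h2
      rw [hp', hq', s3, s4]
      simp only [true_and, and_self, or_true]
      refine ⟨fun h => Or.inr h.2.2.2.2,
        fun h => ⟨by omega, by omega, by omega, by omega, ?_⟩⟩
      rcases h with h | h
      · exact h.2.2.2.2
      · exact h
    by_cases h3 : a < b
    · have h4 : ¬ (w b = i ∧ w a = i + 1) := fun h => by
        rw [ep, eq] at h
        omega
      have h5 : ¬ (w b = i + 1 ∧ w a = i) := fun h => by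
        rw [ep, eq] at h
        exact h1 h.symm
      have h6 : ¬ (w b = -i ∧ w a = -(i + 1)) := fun h => by
        rw [ep', eq'] at h
        exact h2 h.symm
      have h7 : ¬ (w b = -(i + 1) ∧ w a = -i) := fun h => by
        rw [ep', eq'] at h
        omega
      have h8 := s_lt_iff (by omega) h4 h5 h6 h7
      simp only [h8, h1, h2, or_self, false_and, or_false]
    · simp only [h1, h2, h3, or_self, false_and, and_false]
  rw [key, Finset.card_union_of_disjoint]
  · congr 1
    rw [Finset.filter_insert, Finset.filter_singleton]
    simp only [← hQ p q]
    split_ifs with h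
    · rw [Finset.card_pair]
      intro h'
      rw [Prod.mk.injEq] at h'
      rw [h'.1] at hp
      omega
    · rfl
  · rw [Finset.disjoint_left]
    rintro ⟨a, b⟩ h1 h2
    simp only [mem_invSet, Finset.mem_filter, Finset.mem_insert,
      Finset.mem_singleton, Prod.mk.injEq] at h1 h2
    have h3 := h1.2.2.2.1
    rcases h2.1 with ⟨rfl, rfl⟩ | ⟨rfl, rfl⟩
    · omega
    · rw [hp', hq'] at h3
      omega

/-- The new inversions are (-p, p), which is its own mirror image, and the mirror images (0, p) and
(-p, 0). -/
theorem card_invSet_s_zero_mul {n : ℕ} {w : Equiv.Perm ℤ} (hw : w ∈ B n) (hn : 0 < n)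
    (Q : ℤ → ℤ → Prop) [DecidableRel Q] (hQ : ∀ a b, Q a b ↔ Q (-b) (-a)) {p : ℤ}
    (hp : w p = 1) (hp0 : 0 < p) :
    (invSet n (s 0 * w) Q).card =
      (invSet n w Q).card + (if Q (-p) p then 1 else 0) + if Q 0 p then 2 else 0 := by
  have hp' : w (-p) = -1 := by rw [B_neg hw, hp]
  have h0 : w 0 = 0 := B_zero hw
  have rp : -(n : ℤ) ≤ p ∧ p ≤ n := by
    by_contra h
    have := B_fix hw (x := p) (by omega)
    omega
  have ep : ∀ a, w a = 1 ↔ a = p := fun a => by rw [← hp, w.injective.eq_iff]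
  have ep' : ∀ a, w a = -1 ↔ a = -p := fun a => by rw [← hp', w.injective.eq_iff]
  have e0 : ∀ a, w a = 0 ↔ a = 0 := fun a => by
    constructor
    · intro h
      exact w.injective (h.trans h0.symm)
    · rintro rfl
      exact h0
  have key : invSet n (s 0 * w) Q = invSet n w Q ∪
      ({(-p, p), (0, p), (-p, 0)} : Finset (ℤ × ℤ)).filter (fun x => Q x.1 x.2) := by
    ext ⟨a, b⟩
    simp only [Finset.mem_union, mem_invSet, Finset.mem_filter, Finset.mem_insert,
      Finset.mem_singleton, Prod.mk.injEq, Equiv.Perm.mul_apply, s_zero_apply]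
    have h1 := ep a
    have h2 := ep b
    have h3 := ep' a
    have h4 := ep' b
    have h5 := e0 a
    have h6 := e0 b
    have h9 : w a = w b → a = b := fun h => w.injective h
    generalize w a = x at *
    generalize w b = y at *
    by_cases hQab : Q a b
    · simp only [hQab, and_true]
      split_ifs <;> omega
    · simp [hQab]
  have hQ0 : Q (-p) 0 ↔ Q 0 p := by
    rw [hQ 0 p, neg_zero]
  rw [key, Finset.card_union_of_disjoint, add_assoc]
  · congr 1
    have e1 : (-p, p) ∉ ({(0, p), (-p, 0)} : Finset (ℤ × ℤ)) := by
      simp only [Finset.mem_insert, Finset.mem_singleton, Prod.mk.injEq]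
      omega
    have e2 : (0, p) ∉ ({(-p, 0)} : Finset (ℤ × ℤ)) := by
      simp only [Finset.mem_singleton, Prod.mk.injEq]
      omega
    rw [Finset.card_filter, Finset.sum_insert e1, Finset.sum_insert e2, Finset.sum_singleton]
    simp only [hQ0]
    split_ifs <;> rfl
  · rw [Finset.disjoint_left]
    rintro ⟨a, b⟩ h1 h2
    simp only [mem_invSet, Finset.mem_filter, Finset.mem_insert,
      Finset.mem_singleton, Prod.mk.injEq] at h1 h2
    rcases h2.1 with ⟨rfl, rfl⟩ | ⟨rfl, rfl⟩ | ⟨rfl, rfl⟩ <;> omega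

end SignedPerm

/-! ### Coxeter length, sign and descents from inversion counts -/

namespace SignedPerm

/-- Four times the Coxeter length, as a count of inversions. -/
noncomputable def fourLen (n : ℕ) (w : Equiv.Perm ℤ) : ℤ :=
  2 * (invSet n w⁻¹ (fun _ _ => True)).card - (invSet n w⁻¹ (fun a b => a = 0 ∨ b = 0)).card

theorem fourLen_nonneg (n : ℕ) (w : Equiv.Perm ℤ) : 0 ≤ fourLen n w := by
  have h : (invSet n w⁻¹ (fun a b => a = 0 ∨ b = 0)).card ≤
      (invSet n w⁻¹ (fun _ _ => True)).card := by
    refine Finset.card_le_card ?_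
    rintro ⟨a, b⟩ h
    rw [mem_invSet] at h ⊢
    exact ⟨h.1, h.2.1, h.2.2.1, h.2.2.2.1, trivial⟩
  rw [fourLen]
  omega

theorem fourLen_one (n : ℕ) : fourLen n 1 = 0 := by
  have h (Q : ℤ → ℤ → Prop) [DecidableRel Q] : invSet n (1 : Equiv.Perm ℤ)⁻¹ Q = ∅ := by
    rw [Finset.eq_empty_iff_forall_notMem]
    rintro ⟨a, b⟩ h
    rw [mem_invSet] at h
    have := h.2.2.2.1
    simp only [inv_one, Equiv.Perm.one_apply] at this
    omega
  rw [fourLen, h, h]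
  simp

theorem mul_s_apply_left {w : Equiv.Perm ℤ} {i : ℕ} (hi : i ≠ 0) :
    (w * s i) i = w (i + 1) ∧ (w * s i) (i + 1) = w i := by
  simp [Equiv.Perm.mul_apply, s_apply hi]

/-- Passing to inverses turns right multiplication into left multiplication. For i > 0 two
inversions arise, neither involving 0, and 2·2 - 0 = 4; for i = 0 three arise, two of them involving
0, and 2·3 - 2 = 4. The weights in `fourLen` are chosen to make these equal. -/
theorem fourLen_mul_s_of_lt {n i : ℕ} {w : Equiv.Perm ℤ} (hw : w ∈ B n) (hi : i < n)
    (h : w i < w (i + 1)) : fourLen n (w * s i) = fourLen n w + 4 := by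
  have hw' : w⁻¹ ∈ B n := inv_mem hw
  have e : (w * s i)⁻¹ = s i * w⁻¹ := by rw [mul_inv_rev, s_inv]
  have q1 : ∀ a b : ℤ, (a = 0 ∨ b = 0) ↔ (-b = 0 ∨ -a = 0) := by omega
  by_cases hi0 : i = 0
  · subst hi0
    have hp : w⁻¹ (w 1) = 1 := by simp
    have hp0 : 0 < w 1 := by
      have := B_zero hw
      simpa [this] using h
    rw [fourLen, fourLen, e, card_invSet_s_zero_mul hw' hi _ (fun _ _ => Iff.rfl) hp hp0,
      card_invSet_s_zero_mul hw' hi _ q1 hp hp0]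
    have : ¬ (-(w 1) = 0 ∨ w 1 = 0) := by omega
    simp only [this, if_true, if_false, true_or]
    push_cast
    ring
  · have hp : w⁻¹ (w i) = i := by simp
    have hq : w⁻¹ (w (i + 1)) = i + 1 := by simp
    rw [fourLen, fourLen, e,
      card_invSet_s_mul hw' (by omega) hi _ (fun _ _ => Iff.rfl) hp hq h,
      card_invSet_s_mul hw' (by omega) hi _ q1 hp hq h]
    have h1 : w i ≠ 0 := B_ne_zero hw (by omega)
    have h2 : w (i + 1) ≠ 0 := B_ne_zero hw (by omega)
    simp only [h1, h2, if_true, if_false, or_self]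
    push_cast
    ring

theorem fourLen_mul_s_of_gt {n i : ℕ} {w : Equiv.Perm ℤ} (hw : w ∈ B n) (hi : i < n)
    (h : w (i + 1) < w i) : fourLen n (w * s i) = fourLen n w - 4 := by
  have key : fourLen n (w * s i * s i) = fourLen n (w * s i) + 4 := by
    refine fourLen_mul_s_of_lt (mul_mem hw (s_mem_B hi)) hi ?_
    by_cases hi0 : i = 0
    · subst hi0
      have h0 := B_zero hw
      have h1 := B_neg hw 1
      simp only [Nat.cast_zero, zero_add, h0] at h
      simp only [Equiv.Perm.mul_apply, s_zero_apply]
      simp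
      omega
    · rw [(mul_s_apply_left hi0).1, (mul_s_apply_left hi0).2]
      exact h
  rw [mul_assoc, s_mul_self, mul_one] at key
  omega

theorem apply_succ_ne {i : ℕ} {w : Equiv.Perm ℤ} : w i ≠ w (i + 1) := by
  intro h
  have := w.injective h
  omega

/-- The values increase strictly on 0, …, n, start at 0 and stay at most n. -/
theorem eq_one_of_ascents {n : ℕ} {w : Equiv.Perm ℤ} (hw : w ∈ B n)
    (h : ∀ i : ℕ, i < n → w i < w (i + 1)) : w = 1 := by
  have h1 : ∀ i : ℕ, i ≤ n → (i : ℤ) ≤ w i := by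
    intro i hi
    induction i with
    | zero => simpa using (B_zero hw).ge
    | succ i ih =>
      have := ih (by omega)
      have := h i (by omega)
      push_cast
      omega
  have h2 : ∀ d i : ℕ, i + d = n → w i ≤ i := by
    intro d
    induction d with
    | zero =>
      intro i hi
      have := (B_range hw (x := i) (by omega) (by omega)).2
      omega
    | succ d ih =>
      intro i hi
      have h3 := ih (i + 1) (by omega)
      have := h i (by omega)
      push_cast at h3
      omega
  refine B_ext hw (one_mem _) fun x hx hxn => ?_
  lift x to ℕ using by omega
  have := h1 x (by omega)
  have := h2 (n - x) x (by omega)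
  rw [Equiv.Perm.one_apply]
  omega

/-- Sorting: as long as there is a descent, removing it lowers `fourLen` by 4. -/
theorem exists_word {n : ℕ} {w : Equiv.Perm ℤ} (hw : w ∈ B n) :
    ∃ word : List ℕ, (∀ i ∈ word, i < n) ∧ (word.map s).prod = w ∧
      4 * (word.length : ℤ) = fourLen n w := by
  obtain ⟨m, hm⟩ : ∃ m : ℕ, fourLen n w ≤ m := ⟨(fourLen n w).toNat, by omega⟩
  induction m using Nat.strong_induction_on generalizing w with
  | _ m ih =>
    by_cases h : ∀ i : ℕ, i < n → w i < w (i + 1)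
    · have := eq_one_of_ascents hw h
      subst this
      exact ⟨[], by simp, by simp, by simp [fourLen_one]⟩
    · push Not at h
      obtain ⟨i, hi, hwi⟩ := h
      have hlt := lt_of_le_of_ne hwi (apply_succ_ne).symm
      have e := fourLen_mul_s_of_gt hw hi hlt
      have hnn := fourLen_nonneg n (w * s i)
      obtain ⟨l, hl1, hl2, hl3⟩ := ih (m - 4) (by omega) (mul_mem hw (s_mem_B hi)) (by omega)
      refine ⟨l ++ [i], ?_, ?_, ?_⟩
      · intro a ha
        rcases List.mem_append.1 ha with ha | ha
        · exact hl1 a ha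
        · rw [List.mem_singleton.1 ha]
          exact hi
      · rw [List.map_append, List.prod_append, hl2]
        simp [mul_assoc, s_mul_self]
      · rw [List.length_append]
        push_cast
        rw [mul_add, hl3, e]
        simp

theorem word_prod_mem_B {n : ℕ} {word : List ℕ} (h : ∀ i ∈ word, i < n) :
    (word.map s).prod ∈ B n := by
  refine Subgroup.list_prod_mem _ fun x hx => ?_
  obtain ⟨i, hi, rfl⟩ := List.mem_map.1 hx
  exact s_mem_B (h i hi)

/-- The inequality gives the minimality needed for `four_mul_len`; the congruence modulo 8 says that
all words for one element have lengths of the same parity, which makes `sgn` multiplicative. -/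
theorem fourLen_word {n : ℕ} (word : List ℕ) (h : ∀ i ∈ word, i < n) :
    fourLen n (word.map s).prod ≤ 4 * word.length ∧
      (8 : ℤ) ∣ fourLen n (word.map s).prod - 4 * word.length := by
  induction word using List.reverseRecOn with
  | nil => simp [fourLen_one]
  | append_singleton l i ih =>
    have h' : ∀ i ∈ l, i < n := fun a ha => h a (by simp [ha])
    have hi : i < n := h i (by simp)
    have hm := word_prod_mem_B h'
    have ih := ih h'
    rw [List.map_append, List.prod_append, List.length_append]
    simp only [List.map_cons, List.map_nil, List.prod_cons, List.prod_nil, mul_one,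
      List.length_cons, List.length_nil]
    rcases lt_or_gt_of_ne (apply_succ_ne (i := i) (w := (l.map s).prod)) with h1 | h1
    · rw [fourLen_mul_s_of_lt hm hi h1]
      push_cast
      omega
    · rw [fourLen_mul_s_of_gt hm hi h1]
      push_cast
      omega

theorem four_mul_len {n : ℕ} {w : Equiv.Perm ℤ} (hw : w ∈ B n) :
    4 * (len n w : ℤ) = fourLen n w := by
  obtain ⟨l, hl1, hl2, hl3⟩ := exists_word hw
  have h1 : len n w ≤ l.length := Nat.sInf_le ⟨l, hl1, hl2, rfl⟩
  obtain ⟨l', hl1', hl2', hl3'⟩ := Nat.sInf_mem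
    (⟨l.length, l, hl1, hl2, rfl⟩ : {m | ∃ word : List ℕ, (∀ i ∈ word, i < n) ∧
      (word.map s).prod = w ∧ word.length = m}.Nonempty)
  have h2 := (fourLen_word l' hl1').1
  rw [hl2', hl3'] at h2
  change fourLen n w ≤ 4 * (len n w : ℤ) at h2
  omega

theorem sgn_word {n : ℕ} (word : List ℕ) (h : ∀ i ∈ word, i < n) :
    sgn n (word.map s).prod = (-1) ^ word.length := by
  have h1 := (fourLen_word word h).2
  have h2 := four_mul_len (word_prod_mem_B h)
  rw [sgn]
  have h3 : len n (word.map s).prod % 2 = word.length % 2 := by omega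
  rw [neg_one_pow_eq_pow_mod_two, h3, ← neg_one_pow_eq_pow_mod_two]

theorem sgn_mul {n : ℕ} {v w : Equiv.Perm ℤ} (hv : v ∈ B n) (hw : w ∈ B n) :
    sgn n (v * w) = sgn n v * sgn n w := by
  obtain ⟨l, hl, rfl, -⟩ := exists_word hv
  obtain ⟨l', hl', rfl, -⟩ := exists_word hw
  rw [← List.prod_append, ← List.map_append, sgn_word l hl, sgn_word l' hl', sgn_word,
    List.length_append, pow_add]
  intro i hi
  rcases List.mem_append.1 hi with h | h
  · exact hl i h
  · exact hl' i h

theorem sgn_of_le {m n : ℕ} (h : m ≤ n) {w : Equiv.Perm ℤ} (hw : w ∈ B m) :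
    sgn n w = sgn m w := by
  obtain ⟨l, hl, rfl, -⟩ := exists_word hw
  rw [sgn_word l hl, sgn_word l fun i hi => (hl i hi).trans_le h]

theorem sgn_s {n i : ℕ} (h : i < n) : sgn n (s i) = -1 := by
  simpa using sgn_word (n := n) [i] (by simpa using h)

theorem sgn_ascProd {n a b : ℕ} (h : b < n) : sgn n (ascProd a b) = (-1) ^ (b + 1 - a) := by
  rw [ascProd, sgn_word, List.length_range']
  intro i hi
  rw [List.mem_range'_1] at hi
  omega

theorem mem_descents {n i : ℕ} {w : Equiv.Perm ℤ} (hw : w ∈ B n) :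
    i ∈ descents n w ↔ i < n ∧ w (i + 1) < w i := by
  refine and_congr_right fun hi => ?_
  have h1 := four_mul_len hw
  have h2 := four_mul_len (mul_mem hw (s_mem_B hi))
  rcases lt_or_gt_of_ne (apply_succ_ne (i := i) (w := w)) with h | h
  · have := fourLen_mul_s_of_lt hw hi h
    omega
  · have := fourLen_mul_s_of_gt hw hi h
    omega

theorem mem_quotient_iff {n : ℕ} {I : Finset ℕ} {w : Equiv.Perm ℤ} :
    w ∈ quotient n (Finset.range n \ I) ↔
      w ∈ B n ∧ ∀ i : ℕ, i < n → i ∉ I → w i < w (i + 1) := by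
  refine and_congr_right fun hw => ?_
  constructor
  · intro h i hi hI
    by_contra h'
    have hlt := lt_of_le_of_ne (not_lt.1 h') (apply_succ_ne).symm
    have := h ((mem_descents hw).2 ⟨hi, hlt⟩)
    simp [hi, hI] at this
  · intro h i hi
    obtain ⟨h1, h2⟩ := (mem_descents hw).1 hi
    simp only [Finset.coe_sdiff, Set.mem_sdiff, Finset.mem_coe, Finset.mem_range, h1, true_and]
    intro h3
    have := h i h1 h3
    omega

end SignedPerm

/-! ### Runs of rows and the local shape of the pairs -/

namespace SignedPerm

/-- `{r, …, t}` is a maximal interval on which `P` holds. -/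
def IsRun (P : ℤ → Prop) (r t : ℤ) : Prop :=
  r ≤ t ∧ (∀ x, r ≤ x → x ≤ t → P x) ∧ ¬ P (r - 1) ∧ ¬ P (t + 1)

/-- The interval may be empty (r = x+1), so that rows without a run directly above need no separate
treatment. -/
theorem exists_run_start {P : ℤ → Prop} (hP : ∀ x, P x → 1 ≤ x) (x : ℤ) :
    ∃ r, r ≤ x + 1 ∧ (∀ z, r ≤ z → z ≤ x → P z) ∧ ¬ P (r - 1) ∧ (1 ≤ x + 1 → 1 ≤ r) := by
  obtain ⟨m, hm⟩ : ∃ m : ℕ, x ≤ m := ⟨x.toNat, by omega⟩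
  induction m generalizing x with
  | zero =>
    refine ⟨x + 1, le_rfl, fun z h1 h2 => by omega, fun h => ?_, fun h => h⟩
    have := hP _ h
    push_cast at hm
    omega
  | succ m ih =>
    by_cases hx : P x
    · obtain ⟨r, h1, h2, h3, h4⟩ := ih (x - 1) (by push_cast at hm; omega)
      have := hP x hx
      refine ⟨r, by omega, fun z h5 h6 => ?_, h3, by omega⟩
      rcases eq_or_ne z x with rfl | h7
      · exact hx
      · exact h2 z h5 (by omega)
    · refine ⟨x + 1, le_rfl, fun z h1 h2 => by omega, ?_, fun h => h⟩
      rwa [add_sub_cancel_right]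

theorem exists_run_end {P : ℤ → Prop} {N : ℤ} (hP : ∀ x, P x → x ≤ N) (x : ℤ) :
    ∃ t, x - 1 ≤ t ∧ (∀ z, x ≤ z → z ≤ t → P z) ∧ ¬ P (t + 1) ∧ (x - 1 ≤ N → t ≤ N) := by
  obtain ⟨m, hm⟩ : ∃ m : ℕ, N - x < m := ⟨(N - x).toNat + 1, by omega⟩
  induction m generalizing x with
  | zero =>
    refine ⟨x - 1, le_rfl, fun z h1 h2 => by omega, fun h => ?_, fun h => h⟩
    have := hP _ h
    push_cast at hm
    omega
  | succ m ih =>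
    by_cases hx : P x
    · obtain ⟨t, h1, h2, h3, h4⟩ := ih (x + 1) (by push_cast at hm; omega)
      have := hP x hx
      refine ⟨t, by omega, fun z h5 h6 => ?_, h3, by omega⟩
      rcases eq_or_ne z x with rfl | h7
      · exact hx
      · exact h2 z (by omega) h6
    · refine ⟨x - 1, le_rfl, fun z h1 h2 => by omega, ?_, fun h => h⟩
      rwa [sub_add_cancel]

theorem exists_run {P : ℤ → Prop} {N : ℤ} (h₁ : ∀ x, P x → 1 ≤ x) (h₂ : ∀ x, P x → x ≤ N)
    {x : ℤ} (hx : P x) : ∃ r t, IsRun P r t ∧ r ≤ x ∧ x ≤ t := by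
  obtain ⟨r, hr1, hr2, hr3, -⟩ := exists_run_start h₁ x
  obtain ⟨t, ht1, ht2, ht3, -⟩ := exists_run_end h₂ x
  have hr : r ≤ x := by
    by_contra h
    have : r - 1 = x := by omega
    exact hr3 (this ▸ hx)
  have ht : x ≤ t := by
    by_contra h
    have : t + 1 = x := by omega
    exact ht3 (this ▸ hx)
  refine ⟨r, t, ⟨by omega, fun z h3 h4 => ?_, hr3, ht3⟩, hr, ht⟩
  by_cases h5 : z ≤ x
  · exact hr2 z h3 h5
  · exact ht2 z (by omega) h4

/-- The rows `1, …, N` of a signed permutation matrix: `P` and `M` are the rows right of a column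
with entry of one or the other sign, and `T` lists the (signed) rows of the pairs of columns. -/
structure Pattern (N : ℤ) (P M : ℤ → Prop) (T : ℤ → ℤ → Prop) : Prop where
  pos_iff : ∀ x, P x ↔ 0 < x ∧ ∃ a b, T a b ∧ (a = x ∨ b = x)
  neg_iff : ∀ x, M x ↔ 0 < x ∧ ∃ a b, T a b ∧ (a = -x ∨ b = -x)
  disj : ∀ x, P x → ¬ M x
  range : ∀ a b, T a b → -N ≤ a ∧ a ≤ N ∧ -N ≤ b ∧ b ≤ N ∧ a ≠ 0 ∧ b ≠ 0
  right_unique : ∀ a b b', T a b → T a b' → b = b'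
  left_unique : ∀ a a' b, T a b → T a' b → a = a'
  cross : ∀ a b c, T a b → ¬ T b c

namespace Pattern

variable {N : ℤ} {P M : ℤ → Prop} {T : ℤ → ℤ → Prop}

theorem pos_left (h : Pattern N P M T) {a b : ℤ} (hab : T a b) (ha : 0 < a) : P a :=
  (h.pos_iff a).2 ⟨ha, a, b, hab, Or.inl rfl⟩

theorem pos_right (h : Pattern N P M T) {a b : ℤ} (hab : T a b) (hb : 0 < b) : P b :=
  (h.pos_iff b).2 ⟨hb, a, b, hab, Or.inr rfl⟩

theorem neg_left (h : Pattern N P M T) {a b : ℤ} (hab : T a b) (ha : a < 0) : M (-a) :=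
  (h.neg_iff (-a)).2 ⟨by omega, a, b, hab, by omega⟩

theorem neg_right (h : Pattern N P M T) {a b : ℤ} (hab : T a b) (hb : b < 0) : M (-b) :=
  (h.neg_iff (-b)).2 ⟨by omega, a, b, hab, by omega⟩

theorem pos_range (h : Pattern N P M T) {x : ℤ} (hx : P x) : 1 ≤ x ∧ x ≤ N := by
  obtain ⟨h0, a, b, hab, hx⟩ := (h.pos_iff x).1 hx
  have := h.range a b hab
  omega

theorem neg_range (h : Pattern N P M T) {x : ℤ} (hx : M x) : 1 ≤ x ∧ x ≤ N := by
  obtain ⟨h0, a, b, hab, hx⟩ := (h.neg_iff x).1 hx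
  have := h.range a b hab
  omega

end Pattern

/-- The pairs of an uncanceled pattern. -/
def IsU (N : ℤ) (P : ℤ → Prop) (T : ℤ → ℤ → Prop) : Prop :=
  ∀ a b, T a b → a % 2 = N % 2 ∧ b % 2 ≠ N % 2 ∧ ((0 < a ∧ b = a + 1) ∨
    (a < 0 ∧ a < b ∧ b ≤ 1 ∧ ∀ x, 0 < x → -b < x → x < -a → P x))

/-- The conditions on the rows and pairs of an uncanceled matrix. -/
structure Uncanceled (N : ℤ) (P M : ℤ → Prop) (T : ℤ → ℤ → Prop) : Prop where
  prop1 : ¬ P N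
  prop2 : ∀ r t, IsRun (fun x => P x ∨ M x) r t → r % 2 ≠ t % 2
  prop3 : ∀ t, P t → (∃ r q, IsRun P r q ∧ r % 2 ≠ q % 2 ∧ r ≤ t ∧ t ≤ q) ∨
    ∀ p, 1 ≤ p → p < t → P p
  prop4 : ∀ a b, T a b → a < 0 → 0 < b → b = 1 ∧ ∀ p, 1 ≤ p → p < -a → P p
  prop5 : ∀ a b, T a b → a < 0 → b < 0 → ∀ x, -b < x → x < -a → P x
  prop6 : ∀ r t p q, IsRun (fun x => P x ∨ M x) r t → IsRun M p q → r ≤ p → q ≤ t →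
    ¬ (p = r ∧ q = t) → (p % 2 = q % 2 ↔ p = r ∨ q = t)
  prop7 : ∀ r t, IsRun (fun x => P x ∨ M x) r t → r % 2 ≠ t % 2 →
    (∀ q, IsRun P r q → r % 2 ≠ q % 2 → q = t) ∧ ∀ p, IsRun P p t → p % 2 ≠ t % 2 → p = r

namespace Pattern

variable {N : ℤ} {P M : ℤ → Prop} {T : ℤ → ℤ → Prop}

/-- Conditions 4 and 5 give the shape of the pairs with a < 0 directly. For a > 0 the equality b =
a+1 comes from condition 3, which forces positive runs not starting at the top to be even. -/
theorem isU_of_uncanceled (h : Pattern N P M T) (hU : Uncanceled N P M T)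
    (hT : ∀ a b, T a b → a % 2 = N % 2 ∧ b % 2 ≠ N % 2 ∧ a < b) : IsU N P T := by
  -- Induction from the bottom row upwards; m bounds the distance of a from N.
  have key : ∀ m : ℕ, ∀ a b, T a b → 0 < a → N < a + m → b = a + 1 := by
    intro m
    induction m with
    | zero =>
      intro a b hab ha hN
      have := h.range a b hab
      push_cast at hN
      omega
    | succ m ih =>
      intro a b hab ha hN
      push_cast at hN
      have hp := hT a b hab
      by_contra hne
      have hb : P b := h.pos_right hab (by omega)
      -- If row b-1 is positive, its parity makes it the first member of a pair, whose second member
      -- is b by induction.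
      by_cases hb1 : P (b - 1)
      · obtain ⟨-, c, d, hcd, hc | hd⟩ := (h.pos_iff _).1 hb1
        · have := ih c d hcd (by omega) (by omega)
          have hd : d = b := by omega
          have := h.left_unique _ _ _ hab (hd ▸ hcd)
          omega
        · have := hT c d hcd
          omega
      · rcases hU.prop3 b hb with ⟨r, q, hr, hrq, hrb, hbq⟩ | h3
        · have hrb' : r = b := by
            by_contra hrb'
            exact hb1 (hr.2.1 _ (by omega) (by omega))
          have hq : P q := hr.2.1 q hr.1 le_rfl
          obtain ⟨-, c, d, hcd, hc | hd⟩ := (h.pos_iff _).1 hq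
          · have := ih c d hcd (by omega) (by omega)
            have hP := h.pos_right hcd (by omega)
            rw [this, hc] at hP
            exact hr.2.2.2 hP
          · have := hT c d hcd
            omega
        · exact hb1 (h3 _ (by omega) (by omega))
  intro a b hab
  have hp := hT a b hab
  have hr := h.range a b hab
  refine ⟨hp.1, hp.2.1, ?_⟩
  by_cases ha : 0 < a
  · exact Or.inl ⟨ha, key (N + 1).toNat a b hab ha (by omega)⟩
  · right
    have ha' : a < 0 := by omega
    by_cases hb : 0 < b
    · obtain ⟨hb1, h4⟩ := hU.prop4 a b hab ha' hb
      exact ⟨ha', hp.2.2, by omega, fun x h0 h1 h2 => h4 x (by omega) h2⟩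
    · exact ⟨ha', hp.2.2, by omega, fun x h0 h1 h2 => hU.prop5 a b hab ha' (by omega) x h1 h2⟩

/-- This and the next three lemmas read `IsU` backwards: the sign and parity of a right row tell
whether it is the first or second member of its pair and where the other member lies. -/
theorem IsU.pos_of_eq (h : Pattern N P M T) (hU : IsU N P T) {x : ℤ} (hx : P x)
    (hp : x % 2 = N % 2) : T x (x + 1) ∧ P (x + 1) := by
  obtain ⟨h0, a, b, hab, hc⟩ := (h.pos_iff x).1 hx
  obtain ⟨h1, h2, h3⟩ := hU a b hab
  have ha : a = x := by
    rcases hc with rfl | rfl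
    · rfl
    · exact absurd hp h2
  subst ha
  rcases h3 with ⟨-, rfl⟩ | h3
  · exact ⟨hab, h.pos_right hab (by omega)⟩
  · omega

theorem IsU.pos_of_ne (h : Pattern N P M T) (hU : IsU N P T) {x : ℤ} (hx : P x)
    (hp : x % 2 ≠ N % 2) : (T (x - 1) x ∧ P (x - 1)) ∨
      x = 1 ∧ ∃ a, T a 1 ∧ a < 0 ∧ a % 2 = N % 2 ∧ M (-a) ∧ ∀ z, 0 < z → z < -a → P z := by
  obtain ⟨h0, a, b, hab, hc⟩ := (h.pos_iff x).1 hx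
  obtain ⟨h1, h2, h3⟩ := hU a b hab
  have hb : b = x := by
    rcases hc with rfl | rfl
    · exact absurd h1 hp
    · rfl
  subst hb
  rcases h3 with ⟨ha, rfl⟩ | ⟨ha, -, h5, h6⟩
  · left
    rw [add_sub_cancel_right]
    exact ⟨hab, h.pos_left hab ha⟩
  · right
    have hb : b = 1 := by omega
    subst hb
    exact ⟨rfl, a, hab, ha, h1, h.neg_left hab ha, fun z h7 h8 => h6 z h7 (by omega) h8⟩

theorem IsU.neg_of_ne (h : Pattern N P M T) (hU : IsU N P T) {x : ℤ} (hx : M x)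
    (hp : x % 2 ≠ N % 2) : ∃ a, T a (-x) ∧ x < -a ∧ a % 2 = N % 2 ∧ M (-a) ∧
      ∀ z, x < z → z < -a → P z := by
  obtain ⟨h0, a, b, hab, hc⟩ := (h.neg_iff x).1 hx
  obtain ⟨h1, h2, h3⟩ := hU a b hab
  have hb : b = -x := by omega
  subst hb
  rcases h3 with h3 | ⟨ha, h4, -, h6⟩
  · omega
  · exact ⟨a, hab, by omega, h1, h.neg_left hab ha, fun z h7 h8 => h6 z (by omega) (by omega) h8⟩

theorem IsU.neg_of_eq (h : Pattern N P M T) (hU : IsU N P T) {x : ℤ} (hx : M x)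
    (hp : x % 2 = N % 2) : ∃ b, T (-x) b ∧ b ≤ 1 ∧ b ≠ 0 ∧ -b < x ∧ b % 2 ≠ N % 2 ∧
      (b < 0 → M (-b)) ∧ ∀ z, 0 < z → -b < z → z < x → P z := by
  obtain ⟨h0, a, b, hab, hc⟩ := (h.neg_iff x).1 hx
  obtain ⟨h1, h2, h3⟩ := hU a b hab
  have hr := h.range a b hab
  have ha : a = -x := by omega
  subst ha
  rcases h3 with h3 | ⟨ha, h4, h5, h6⟩
  · omega
  · exact ⟨b, hab, h5, by omega, by omega, h2, h.neg_right hab,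
      fun z h7 h8 h9 => h6 z h7 h8 (by omega)⟩

/-- No pair has one row in `{1, …, x}` and one row below. -/
def Closed (T : ℤ → ℤ → Prop) (x : ℤ) : Prop := ∀ a b, T a b → (|a| ≤ x ↔ |b| ≤ x)

/-- Between the two rows of a pair there are only positive rows, so a row that is not right of the
column lies inside no pair. -/
theorem IsU.closed_of_not (h : Pattern N P M T) (hU : IsU N P T) {x : ℤ} (hP : ¬ P x)
    (hM : ¬ M x) (h0 : 0 ≤ x) : Closed T x ∧ Closed T (x - 1) := by
  have key : ∀ a b, T a b → (|a| ≤ x ↔ |b| ≤ x) ∧ (|a| ≤ x - 1 ↔ |b| ≤ x - 1) := by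
    intro a b hab
    have hr := h.range a b hab
    obtain ⟨-, -, ⟨ha, hb⟩ | ⟨ha, h4, h5, h6⟩⟩ := hU a b hab
    · have ha' : x ≠ a := fun e => hP (e ▸ h.pos_left hab ha)
      have hb' : x ≠ b := fun e => hP (e ▸ h.pos_right hab (by omega))
      rw [abs_of_pos ha, abs_of_pos (by omega : 0 < b)]
      omega
    · have ha' : x ≠ -a := fun e => hM (e ▸ h.neg_left hab ha)
      have hx : ¬ (0 < x ∧ -b < x ∧ x < -a) := fun e => hP (h6 x e.1 e.2.1 e.2.2)
      rw [abs_of_neg ha]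
      by_cases hb : b < 0
      · have hb' : x ≠ -b := fun e => hM (e ▸ h.neg_right hab hb)
        rw [abs_of_neg hb]
        omega
      · have hb' : x ≠ b := fun e => hP (e ▸ h.pos_right hab (by omega))
        rw [abs_of_pos (by omega : 0 < b)]
        omega
  exact ⟨fun a b hab => (key a b hab).1, fun a b hab => (key a b hab).2⟩

/-- A beginning of a block that no pair leaves has an even number of rows. Induction on x: the pair
that contains row x is removed together with everything between its rows. If x is the second row of
a positive pair this leads to x-2; if x is the lower row of a negative pair with upper row -b it
leads to -b-1. -/
theorem IsU.parity_of_closed (h : Pattern N P M T) (hU : IsU N P T) {r t : ℤ}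
    (hrt : IsRun (fun x => P x ∨ M x) r t) (m : ℕ) :
    ∀ x, r - 1 ≤ x → x ≤ t → x < r + m → Closed T x → r % 2 ≠ x % 2 := by
  have hr1 : 1 ≤ r := by
    rcases hrt.2.1 r le_rfl hrt.1 with h1 | h1
    · exact (h.pos_range h1).1
    · exact (h.neg_range h1).1
  induction m with
  | zero =>
    intro x h1 h2 h3 h4
    push_cast at h3
    omega
  | succ m ih =>
    intro x h1 h2 h3 hc
    push_cast at h3
    rcases eq_or_lt_of_le h1 with rfl | h1
    · omega
    rcases hrt.2.1 x (by omega) h2 with hx | hx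
    · by_cases hp : x % 2 = N % 2
      · have := (hc x (x + 1) (IsU.pos_of_eq h hU hx hp).1).1 (by rw [abs_of_pos] <;> omega)
        rw [abs_of_pos (by omega)] at this
        omega
      · rcases IsU.pos_of_ne h hU hx hp with ⟨hT, hP⟩ | ⟨rfl, a, hT, ha, hpa, -, -⟩
        · have hxr : x - 1 ≠ r - 1 := fun e => hrt.2.2.1 (Or.inl (e ▸ hP))
          have := ih (x - 2) (by omega) (by omega) (by omega) ?_
          · omega
          · intro a b hab
            have hcab := hc a b hab
            have u1 : a = x - 1 → b = x := fun e => h.right_unique _ _ _ (e ▸ hab) hT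
            have u2 : b = x → a = x - 1 := fun e => h.left_unique _ _ _ (e ▸ hab) hT
            have u3 : a ≠ x := fun e => h.cross _ _ _ hT (e ▸ hab)
            have u4 : b ≠ x - 1 := fun e => h.cross _ _ _ hab (e ▸ hT)
            have v1 : a ≠ -x := fun e => h.disj x hx ((h.neg_iff x).2 ⟨by omega, a, b, hab, by omega⟩)
            have v2 : b ≠ -x := fun e => h.disj x hx ((h.neg_iff x).2 ⟨by omega, a, b, hab, by omega⟩)
            have v3 : a ≠ -(x - 1) := fun e =>
              h.disj _ hP ((h.neg_iff _).2 ⟨by omega, a, b, hab, by omega⟩)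
            have v4 : b ≠ -(x - 1) := fun e =>
              h.disj _ hP ((h.neg_iff _).2 ⟨by omega, a, b, hab, by omega⟩)
            rcases abs_cases a with e | e <;> rcases abs_cases b with e' | e' <;>
              rw [e.1, e'.1] at hcab ⊢ <;> omega
        · have := (hc a 1 hT).2 (by simp)
          rw [abs_of_neg ha] at this
          omega
    · by_cases hp : x % 2 = N % 2
      · obtain ⟨b, hT, hb1, hb0, hbx, hpb, hbM, hbP⟩ := IsU.neg_of_eq h hU hx hp
        by_cases hb : b < 0
        · have hbM := hbM hb
          have hbr : r ≤ -b := by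
            by_contra hbr
            rcases eq_or_ne (-b) (r - 1) with e | e
            · exact hrt.2.2.1 (Or.inr (e ▸ hbM))
            · exact hrt.2.2.1 (Or.inl (hbP _ (by omega) (by omega) (by omega)))
          have := ih (-b - 1) (by omega) (by omega) (by omega) ?_
          · omega
          -- A negative pair with row -b strictly inside it would make that row positive, and a pair
          -- of adjacent positive rows cannot use row -b at all; so no pair crosses the new cut.
          · intro a' b' hab
            have hcab := hc a' b' hab
            have hr := h.range a' b' hab
            have u1 : a' = -x → b' = b := fun e => h.right_unique _ _ _ (e ▸ hab) hT
            have u2 : b' = b → a' = -x := fun e => h.left_unique _ _ _ (e ▸ hab) hT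
            have u3 : a' ≠ b := fun e => h.cross _ _ _ hT (e ▸ hab)
            have u4 : b' ≠ -x := fun e => h.cross _ _ _ hab (e ▸ hT)
            have w1 : ∀ z, P z → z ≠ -b := fun z hz e => h.disj z hz (e ▸ hbM)
            have w2 : ∀ z, P z → z ≠ x := fun z hz e => h.disj z hz (e ▸ hx)
            have w3 : ∀ z, M z → ¬ (-b < z ∧ z < x) := fun z hz e =>
              h.disj z (hbP z (by omega) e.1 e.2) hz
            obtain ⟨-, -, ⟨ha', hb'⟩ | ⟨ha', h4, h5, h6⟩⟩ := hU a' b' hab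
            · have := w1 _ (h.pos_left hab ha')
              have := w1 _ (h.pos_right hab (by omega))
              have := w2 _ (h.pos_left hab ha')
              have := w2 _ (h.pos_right hab (by omega))
              rw [abs_of_pos ha', abs_of_pos (by omega : 0 < b')] at hcab ⊢
              omega
            · have := w3 _ (h.neg_left hab ha')
              have w4 : ¬ (-b' < -b ∧ -b < -a') := fun e =>
                w1 _ (h6 (-b) (by omega) (by omega) (by omega)) rfl
              rw [abs_of_neg ha'] at hcab ⊢
              by_cases hb' : b' < 0
              · have := w3 _ (h.neg_right hab hb')
                rw [abs_of_neg hb'] at hcab ⊢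
                omega
              · have := w1 _ (h.pos_right hab (by omega))
                rw [abs_of_pos (by omega : 0 < b')] at hcab ⊢
                omega
        -- Here b = 1, so all rows above x are positive, the block starts in row 1, and x ≡ N ≢ 1.
        · have : r = 1 := by
            by_contra hr
            exact hrt.2.2.1 (Or.inl (hbP _ (by omega) (by omega) (by omega)))
          omega
      · obtain ⟨a, hT, ha, hpa, -, -⟩ := IsU.neg_of_ne h hU hx hp
        have := (hc a (-x) hT).2 (by rw [abs_of_neg] <;> omega)
        rw [abs_of_neg (by omega)] at this
        omega

end Pattern

end SignedPerm

/-! ### The seven conditions deduced from the shape of the pairs -/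

namespace SignedPerm
namespace Pattern

variable {N : ℤ} {P M : ℤ → Prop} {T : ℤ → ℤ → Prop}

theorem IsU.run_end (h : Pattern N P M T) (hU : IsU N P T) {t : ℤ} (ht : P t)
    (ht' : ¬ P (t + 1)) : t % 2 ≠ N % 2 :=
  fun e => ht' (IsU.pos_of_eq h hU ht e).2

theorem IsU.run_start (h : Pattern N P M T) (hU : IsU N P T) {r : ℤ} (hr : P r)
    (hr' : ¬ P (r - 1)) (hr1 : r ≠ 1) : r % 2 = N % 2 := by
  by_contra e
  rcases IsU.pos_of_ne h hU hr e with h1 | h1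
  · exact hr' h1.2
  · exact hr1 h1.1

/-- A positive run ends in a row ≢ N and, unless it starts in row 1, begins in a row ≡ N. Together
with the position of the partners of negative rows, this turns the conditions on runs into
comparisons of parities with N. -/
theorem uncanceled_of_isU (h : Pattern N P M T) (hU : IsU N P T) : Uncanceled N P M T where
  prop1 hN := by
    have := h.pos_range (IsU.pos_of_eq h hU hN rfl).2
    omega
  prop2 r t hrt := by
    have h1 : 1 ≤ r := by
      rcases hrt.2.1 r le_rfl hrt.1 with h1 | h1
      · exact (h.pos_range h1).1
      · exact (h.neg_range h1).1
    have hc := (IsU.closed_of_not h hU (fun e => hrt.2.2.2 (Or.inl e))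
      (fun e => hrt.2.2.2 (Or.inr e)) (by have := hrt.1; omega)).2
    rw [add_sub_cancel_right] at hc
    exact IsU.parity_of_closed h hU hrt (t - r + 1).toNat t (by have := hrt.1; omega) le_rfl
      (by omega) hc
  prop3 t ht := by
    obtain ⟨r, q, hrq, hrt, htq⟩ := exists_run (fun x hx => (h.pos_range hx).1)
      (fun x hx => (h.pos_range hx).2) ht
    have hr := hrq.2.1 r le_rfl hrq.1
    have hq := hrq.2.1 q hrq.1 le_rfl
    by_cases hr1 : r = 1
    · exact Or.inr fun p hp hpt => hrq.2.1 p (by omega) (by omega)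
    · have := IsU.run_start h hU hr hrq.2.2.1 hr1
      have := IsU.run_end h hU hq hrq.2.2.2
      exact Or.inl ⟨r, q, hrq, by omega, hrt, htq⟩
  prop4 a b hab ha hb := by
    obtain ⟨-, -, h1 | ⟨-, -, h2, h3⟩⟩ := hU a b hab
    · omega
    · exact ⟨by omega, fun p hp hpa => h3 p (by omega) (by omega) hpa⟩
  prop5 a b hab ha hb := by
    obtain ⟨-, -, h1 | ⟨-, -, h2, h3⟩⟩ := hU a b hab
    · omega
    · exact fun x hx hxa => h3 x (by omega) hx hxa
  prop6 r t p q hrt hpq hrp hqt hne := by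
    have hle := hpq.1
    have hp := hpq.2.1 p le_rfl hpq.1
    have hq := hpq.2.1 q hpq.1 le_rfl
    -- The parity of each end of a negative run depends on whether it is also an end of the block: p
    -- ≢ N exactly if p = r, and q ≡ N exactly if q = t. The restriction to proper subsets of the
    -- block rules out that both equalities hold.
    have p1 : p = r → p % 2 ≠ N % 2 := by
      rintro rfl e
      obtain ⟨b, -, hb1, hb0, hbx, hpb, hbM, hbP⟩ := IsU.neg_of_eq h hU hp e
      rcases eq_or_ne (-b) (p - 1) with e1 | e1
      · exact hpq.2.2.1 (e1 ▸ hbM (by have := (h.neg_range hp).1; omega))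
      · rcases eq_or_ne p 1 with rfl | e2
        · omega
        · have := (h.neg_range hp).1
          exact hrt.2.2.1 (Or.inl (hbP _ (by omega) (by omega) (by omega)))
    have p2 : p ≠ r → p % 2 = N % 2 := by
      intro hpr
      have hP : P (p - 1) := (hrt.2.1 (p - 1) (by omega) (by omega)).resolve_right hpq.2.2.1
      by_contra e
      have := (IsU.pos_of_eq h hU hP (by omega)).2
      rw [sub_add_cancel] at this
      exact h.disj _ this hp
    have q1 : q = t → q % 2 = N % 2 := by
      rintro rfl
      by_contra e
      obtain ⟨a, -, ha, -, haM, haP⟩ := IsU.neg_of_ne h hU hq e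
      rcases eq_or_ne (-a) (q + 1) with e1 | e1
      · exact hpq.2.2.2 (e1 ▸ haM)
      · exact hrt.2.2.2 (Or.inl (haP _ (by omega) (by omega)))
    have q2 : q ≠ t → q % 2 ≠ N % 2 := by
      intro hqt' e
      have hP : P (q + 1) := (hrt.2.1 (q + 1) (by omega) (by omega)).resolve_right hpq.2.2.2
      rcases IsU.pos_of_ne h hU hP (by omega) with h1 | h1
      · have := h1.2
        rw [add_sub_cancel_right] at this
        exact h.disj _ this hq
      · have := h.neg_range hq
        omega
    constructor
    · intro e
      by_contra hc
      have := p2 (fun e => hc (Or.inl e))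
      have := q2 (fun e => hc (Or.inr e))
      omega
    · rintro (e | e)
      · have := p1 e
        have := q2 (fun e' => hne ⟨e, e'⟩)
        omega
      · have := q1 e
        have := p2 (fun e' => hne ⟨e', e⟩)
        omega
  prop7 r t hrt hpar := by
    constructor
    · intro q hrq hpq
      by_contra hne
      have hle := hrq.1
      have hr := hrq.2.1 r le_rfl hrq.1
      have hq := hrq.2.1 q hrq.1 le_rfl
      have hq' := IsU.run_end h hU hq hrq.2.2.2
      have hqt : q < t := by
        by_contra hqt
        have := hrt.1
        exact hrt.2.2.2 (Or.inl (hrq.2.1 (t + 1) (by omega) (by omega)))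
      have hM : M (q + 1) := (hrt.2.1 (q + 1) (by omega) (by omega)).resolve_left hrq.2.2.2
      -- Row q+1 is the lower row of its pair, and the upper row is not in the positive run, so the
      -- pair reaches beyond row r; then row r-1 would belong to the block, or r = 1 and b = 1,
      -- against the parity of r.
      obtain ⟨b, -, hb1, hb0, hbx, hpb, hbM, hbP⟩ := IsU.neg_of_eq h hU hM (by omega)
      have hbr : -b < r := by
        by_contra hbr
        exact h.disj (-b) (hrq.2.1 _ (by omega) (by omega))
          (hbM (by have := h.pos_range hr; omega))
      by_cases hr1 : r = 1
      · omega
      · have := (h.pos_range hr).1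
        rcases eq_or_ne (-b) (r - 1) with e1 | e1
        · exact hrt.2.2.1 (Or.inr (e1 ▸ hbM (by omega)))
        · exact hrq.2.2.1 (hbP _ (by omega) (by omega) (by omega))
    · intro p hpt hpp
      by_contra hne
      have hle := hpt.1
      have hp := hpt.2.1 p le_rfl hpt.1
      have ht := hpt.2.1 t hpt.1 le_rfl
      have ht' := IsU.run_end h hU ht hpt.2.2.2
      have hpr : r < p := by
        by_contra hpr
        exact hrt.2.2.1 (Or.inl (hpt.2.1 (r - 1) (by omega) (by have := hrt.1; omega)))
      have hM : M (p - 1) := (hrt.2.1 (p - 1) (by omega) (by omega)).resolve_left hpt.2.2.1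
      obtain ⟨a, -, ha, -, haM, haP⟩ := IsU.neg_of_ne h hU hM (by omega)
      have hat : t < -a := by
        by_contra hat
        exact h.disj (-a) (hpt.2.1 _ (by omega) (by omega)) haM
      rcases eq_or_ne (-a) (t + 1) with e1 | e1
      · exact hrt.2.2.2 (Or.inr (e1 ▸ haM))
      · exact hrt.2.2.2 (Or.inl (haP _ (by omega) (by omega)))

end Pattern
end SignedPerm

/-! ### From matrices to runs; the action of the block moves on a single entry -/

namespace SignedPerm

/-- Row `x` is right of column `k`, with entry `ε`. -/
def Right (N k : ℕ) (ε : ℤ) (w : Equiv.Perm ℤ) (x : ℤ) : Prop :=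
  1 ≤ x ∧ x ≤ N ∧ (k : ℤ) < w⁻¹ (ε * x)

theorem inv_apply_ne_zero {N : ℕ} {w : Equiv.Perm ℤ} (hw : w ∈ B N) {x : ℤ} (hx : x ≠ 0) :
    w⁻¹ x ≠ 0 :=
  B_ne_zero (inv_mem hw) hx

theorem rowSign_eq {N : ℕ} {w : Equiv.Perm ℤ} (hw : w ∈ B N) {x : ℕ} (hx : 1 ≤ x) :
    rowSign w x = if 0 < w⁻¹ (x : ℤ) then 1 else -1 := by
  have h0 := inv_apply_ne_zero hw (x := x) (by omega)
  rw [rowSign, entry, col]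
  split_ifs with h1 h2 h3 h4 h5
  · rfl
  · have : ((w⁻¹ (x : ℤ)).natAbs : ℤ) = -w⁻¹ (x : ℤ) := by omega
    rw [this, B_neg hw] at h1
    simp at h1
    omega
  · have : ((w⁻¹ (x : ℤ)).natAbs : ℤ) = w⁻¹ (x : ℤ) := by omega
    rw [this] at h1
    simp at h1
  · rfl
  · have : ((w⁻¹ (x : ℤ)).natAbs : ℤ) = w⁻¹ (x : ℤ) := by omega
    rw [this] at h1
    simp at h1
  · have : ((w⁻¹ (x : ℤ)).natAbs : ℤ) = -w⁻¹ (x : ℤ) := by omega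
    rw [this, B_neg hw] at h3
    simp at h3

theorem right_iff {N k : ℕ} {ε : ℤ} (hε : ε = 1 ∨ ε = -1) {w : Equiv.Perm ℤ} (hw : w ∈ B N)
    {x : ℕ} (hx : 1 ≤ x) (hxN : x ≤ N) :
    Right N k ε w x ↔ k < col w x ∧ rowSign w x = ε := by
  have h0 := inv_apply_ne_zero hw (x := x) (by omega)
  have h1 : (col w x : ℤ) = |w⁻¹ (x : ℤ)| := Int.natCast_natAbs _
  rw [Right, rowSign_eq hw hx]
  rcases hε with rfl | rfl
  · rw [one_mul]
    rcases abs_cases (w⁻¹ (x : ℤ)) with h2 | h2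
    · rw [if_pos (by omega)]
      omega
    · rw [if_neg (by omega)]
      omega
  · rw [neg_one_mul, B_neg (inv_mem hw)]
    rcases abs_cases (w⁻¹ (x : ℤ)) with h2 | h2
    · rw [if_pos (by omega)]
      omega
    · rw [if_neg (by omega)]
      omega

theorem not_right_iff {N k : ℕ} {ε : ℤ} (hε : ε = 1 ∨ ε = -1) {w : Equiv.Perm ℤ} (hw : w ∈ B N)
    {x : ℕ} (hx : 1 ≤ x) (hxN : x ≤ N) :
    ¬ Right N k ε w x ↔ col w x ≤ k ∨ rowSign w x = -ε := by
  rw [right_iff hε hw hx hxN, rowSign_eq hw hx]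
  rcases hε with rfl | rfl <;> split_ifs <;> norm_num

theorem right_or_iff {N k : ℕ} {ε : ℤ} (hε : ε = 1 ∨ ε = -1) {w : Equiv.Perm ℤ} (hw : w ∈ B N)
    {x : ℕ} (hx : 1 ≤ x) (hxN : x ≤ N) :
    Right N k ε w x ∨ Right N k (-ε) w x ↔ k < col w x := by
  rw [right_iff hε hw hx hxN, right_iff (by omega) hw hx hxN, rowSign_eq hw hx]
  rcases hε with rfl | rfl <;> split_ifs <;> norm_num

/-- Rows 0 and N+1 never satisfy `P`, so maximality at the border of the matrix holds automatically.
-/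
theorem isRun_cast_iff {N : ℕ} {P : ℤ → Prop} (hP : ∀ x, P x → 1 ≤ x ∧ x ≤ N) {r t : ℕ} :
    IsRun P r t ↔ 1 ≤ r ∧ r ≤ t ∧ t ≤ N ∧ (∀ x : ℕ, x ∈ Finset.Icc r t → P x) ∧
      (t ≠ N → ¬ P (t + 1 : ℕ)) ∧ (r ≠ 1 → ¬ P (r - 1 : ℕ)) := by
  constructor
  · rintro ⟨h1, h2, h3, h4⟩
    have h5 := hP _ (h2 r le_rfl h1)
    have h6 := hP _ (h2 t h1 le_rfl)
    refine ⟨by omega, by omega, by omega, fun x hx => ?_, fun _ => ?_, fun hr => ?_⟩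
    · rw [Finset.mem_Icc] at hx
      exact h2 x (by omega) (by omega)
    · exact_mod_cast h4
    · rw [Nat.cast_sub (by omega)]
      exact_mod_cast h3
  · rintro ⟨h1, h2, h3, h4, h5, h6⟩
    refine ⟨by omega, fun x hx hxt => ?_, fun h => ?_, fun h => ?_⟩
    · lift x to ℕ using by omega
      exact h4 x (Finset.mem_Icc.2 (by omega))
    · have := hP _ h
      refine h6 (by omega) ?_
      rw [Nat.cast_sub (by omega)]
      exact_mod_cast h
    · have := hP _ h
      refine h5 (by omega) ?_
      exact_mod_cast h

theorem isSignBlock_iff {N k : ℕ} {ε : ℤ} (hε : ε = 1 ∨ ε = -1) {w : Equiv.Perm ℤ} (hw : w ∈ B N)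
    {r t : ℕ} : IsSignBlock N k ε w r t ↔ IsRun (Right N k ε w) r t := by
  rw [isRun_cast_iff (N := N) fun x hx => ⟨hx.1, hx.2.1⟩, IsSignBlock]
  refine and_congr_right fun h1 => and_congr_right fun h2 => and_congr_right fun h3 => ?_
  refine and_congr (forall₂_congr fun x hx => ?_) (and_congr (forall_congr' fun h => ?_)
    (forall_congr' fun h => ?_))
  · rw [Finset.mem_Icc] at hx
    rw [right_iff hε hw (by omega) (by omega)]
  · rw [not_right_iff hε hw (by omega) (by omega)]
  · rw [not_right_iff hε hw (by omega) (by omega)]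

theorem isBlock_iff {N k : ℕ} {ε : ℤ} (hε : ε = 1 ∨ ε = -1) {w : Equiv.Perm ℤ} (hw : w ∈ B N)
    {r t : ℕ} : IsBlock N k w r t ↔
      IsRun (fun x => Right N k ε w x ∨ Right N k (-ε) w x) r t := by
  rw [isRun_cast_iff (N := N) fun x hx => ?_, IsBlock]
  · refine and_congr_right fun h1 => and_congr_right fun h2 => and_congr_right fun h3 => ?_
    refine and_congr (forall₂_congr fun x hx => ?_) (and_congr (forall_congr' fun h => ?_)
      (forall_congr' fun h => ?_))
    · rw [Finset.mem_Icc] at hx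
      rw [right_or_iff hε hw (by omega) (by omega)]
    · rw [right_or_iff hε hw (by omega) (by omega), not_lt]
    · rw [right_or_iff hε hw (by omega) (by omega), not_lt]
  · rcases hx with hx | hx <;> exact ⟨hx.1, hx.2.1⟩

/-- Different maximal runs have at least one row between them. The factor of a block acts on the
block and on one neighbouring row, always on the same side, so the factors of different blocks act
on disjoint sets of rows. -/
theorem IsRun.separated {P : ℤ → Prop} {r t r' t' : ℤ} (h : IsRun P r t) (h' : IsRun P r' t')
    (hne : ¬ (r = r' ∧ t = t')) : t + 1 < r' ∨ t' + 1 < r := by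
  obtain ⟨h1, h2, h3, h4⟩ := h
  obtain ⟨h1', h2', h3', h4'⟩ := h'
  by_contra hc
  have a1 := mt (h2 (r' - 1))
  have a2 := mt (h2' (r - 1))
  have a3 := mt (h2 (t' + 1))
  have a4 := mt (h2' (t + 1))
  simp only [h3, h3', h4, h4', not_false_iff, imp_false] at *
  omega

theorem foldl_mul_apply_of_fix {ι : Type*} (l : List ι) (f : ι → Equiv.Perm ℤ) (w : Equiv.Perm ℤ)
    (c : ℤ) (h : ∀ b ∈ l, f b (w c) = w c) : (l.foldl (fun x b => f b * x) w) c = w c := by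
  induction l generalizing w with
  | nil => rfl
  | cons b l ih =>
    have h0 : (f b * w) c = w c := h b (by simp)
    rw [List.foldl_cons, ih, h0]
    intro b' hb'
    rw [h0]
    exact h b' (by simp [hb'])

/-- Only the factor `f b` acts on the row of column c; the others fix the row both before and after
that move, so their positions in the list do not matter. -/
theorem foldl_mul_apply {ι : Type*} (l : List ι) (hl : l.Nodup) (f : ι → Equiv.Perm ℤ)
    (w : Equiv.Perm ℤ) (c : ℤ) {b : ι} (hb : b ∈ l) (h₁ : ∀ b' ∈ l, b' ≠ b → f b' (w c) = w c)
    (h₂ : ∀ b' ∈ l, b' ≠ b → f b' (f b (w c)) = f b (w c)) :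
    (l.foldl (fun x b => f b * x) w) c = f b (w c) := by
  induction l generalizing w with
  | nil => simp at hb
  | cons a l ih =>
    rw [List.foldl_cons]
    obtain ⟨ha, hl⟩ := List.nodup_cons.1 hl
    by_cases hab : a = b
    · subst hab
      refine foldl_mul_apply_of_fix l f (f a * w) c fun b' hb' => ?_
      exact h₂ b' (by simp [hb']) (fun e => ha (e ▸ hb'))
    · have h0 : (f a * w) c = w c := h₁ a (by simp) hab
      rw [ih hl (f a * w) ?_ ?_ ?_, h0]
      · simpa [Ne.symm hab] using hb
      · intro b' hb' hne
        rw [h0]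
        exact h₁ b' (by simp [hb']) hne
      · intro b' hb' hne
        rw [h0]
        exact h₂ b' (by simp [hb']) hne

theorem mem_signBlocks {N k : ℕ} {ε : ℤ} {w : Equiv.Perm ℤ} {b : ℕ × ℕ} :
    b ∈ signBlocks N k ε w ↔ IsSignBlock N k ε w b.1 b.2 := by
  obtain ⟨r, t⟩ := b
  rw [signBlocks, List.mem_filter, decide_eq_true_iff, List.pair_mem_product,
    List.mem_range'_1, List.mem_range'_1]
  refine ⟨fun h => h.2, fun h => ⟨?_, h⟩⟩
  have := h.1
  have := h.2.1
  have := h.2.2.1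
  omega

theorem nodup_signBlocks {N k : ℕ} {ε : ℤ} {w : Equiv.Perm ℤ} : (signBlocks N k ε w).Nodup :=
  (List.Nodup.product List.nodup_range' List.nodup_range').filter _

theorem ascProd_apply_mul {a b : ℕ} (ha : 1 ≤ a) (hab : a ≤ b + 1) {δ : ℤ} (hδ : δ = 1 ∨ δ = -1)
    {y : ℤ} (hy : 0 < y) : ascProd a b (δ * y) =
      δ * if (a : ℤ) ≤ y ∧ y ≤ b then y + 1 else if y = b + 1 then (a : ℤ) else y := by
  rw [ascProd_apply ha hab]
  rcases hδ with rfl | rfl <;> split_ifs <;> omega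

theorem descProd_apply_mul {a b : ℕ} (ha : 1 ≤ a) (hab : a ≤ b + 1) {δ : ℤ} (hδ : δ = 1 ∨ δ = -1)
    {y : ℤ} (hy : 0 < y) : descProd a b (δ * y) =
      δ * if (a : ℤ) < y ∧ y ≤ b + 1 then y - 1 else if y = a then (b : ℤ) + 1 else y := by
  rw [descProd_apply ha hab]
  rcases hδ with rfl | rfl <;> split_ifs <;> omega

theorem descProd_zero_apply_mul {b : ℕ} {δ : ℤ} (hδ : δ = 1 ∨ δ = -1) {y : ℤ} (hy : 0 < y) :
    descProd 0 b (δ * y) =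
      δ * if 1 < y ∧ y ≤ b + 1 then y - 1 else if y = 1 then -((b : ℤ) + 1) else y := by
  rw [descProd_zero_apply]
  rcases hδ with rfl | rfl <;> split_ifs <;> omega

section moves

variable {N k : ℕ} {ε δ : ℤ} {w : Equiv.Perm ℤ} {c : ℤ}

theorem moveDown_apply_of_right (hε : ε = 1 ∨ ε = -1) (hw : w ∈ B N) (hδ : δ = 1 ∨ δ = -1) {x : ℤ}
    (hx : Right N k ε w x) (hc : w c = δ * x) : moveDown N k ε w c = δ * (x + 1) := by
  obtain ⟨r, t, hrt, hrx, hxt⟩ := exists_run (fun x hx => hx.1)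
    (fun (x : ℤ) (hx : Right N k ε w x) => hx.2.1) hx
  have hr1 := (hrt.2.1 r le_rfl hrt.1).1
  lift r to ℕ using by omega
  lift t to ℕ using by omega
  have h0 : ascProd r t (w c) = δ * (x + 1) := by
    rw [hc, ascProd_apply_mul (by omega) (by omega) hδ hx.1, if_pos ⟨hrx, hxt⟩]
  rw [moveDown, foldl_mul_apply (b := (r, t)) _ nodup_signBlocks (fun b => ascProd b.1 b.2), h0]
  · exact mem_signBlocks.2 ((isSignBlock_iff hε hw).2 hrt)
  · intro b hb hne
    have hb' := (isSignBlock_iff hε hw).1 (mem_signBlocks.1 hb)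
    have hb1 := hb'.1
    have hb2 := (hb'.2.1 _ le_rfl hb1).1
    have hs := hrt.separated hb' fun h => hne (Prod.ext (by omega) (by omega))
    rw [hc, ascProd_apply_mul (by omega) (by omega) hδ hx.1, if_neg (by omega), if_neg (by omega)]
  · intro b hb hne
    have hb' := (isSignBlock_iff hε hw).1 (mem_signBlocks.1 hb)
    have hb1 := hb'.1
    have hb2 := (hb'.2.1 _ le_rfl hb1).1
    have hs := hrt.separated hb' fun h => hne (Prod.ext (by omega) (by omega))
    dsimp only
    rw [h0, ascProd_apply_mul (by omega) (by omega) hδ (by omega), if_neg (by omega),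
      if_neg (by omega)]

/-- The row below a run rises to the first row of the run. For r = y there is no run directly above
and the row stays. -/
theorem moveDown_apply_of_not_right (hε : ε = 1 ∨ ε = -1) (hw : w ∈ B N) (hδ : δ = 1 ∨ δ = -1)
    {r y : ℤ} (hr : 1 ≤ r) (hry : r ≤ y) (hy : ¬ Right N k ε w y)
    (h₁ : ∀ z, r ≤ z → z < y → Right N k ε w z) (h₂ : ¬ Right N k ε w (r - 1))
    (hc : w c = δ * y) : moveDown N k ε w c = δ * r := by
  rcases eq_or_lt_of_le hry with rfl | hry
  · rw [moveDown, foldl_mul_apply_of_fix _ (fun b : ℕ × ℕ => ascProd b.1 b.2), hc]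
    intro b hb
    have hb' := (isSignBlock_iff hε hw).1 (mem_signBlocks.1 hb)
    have hb1 := hb'.1
    have hb2 := (hb'.2.1 _ le_rfl hb1).1
    have h3 := mt (hb'.2.1 r)
    have h4 := mt (hb'.2.1 (r - 1))
    simp only [hy, h₂, imp_false] at h3 h4
    rw [hc, ascProd_apply_mul (by omega) (by omega) hδ (by omega), if_neg (by omega),
      if_neg (by omega)]
  · have hrt : IsRun (Right N k ε w) r (y - 1) :=
      ⟨by omega, fun z h3 h4 => h₁ z h3 (by omega), h₂, by rwa [sub_add_cancel]⟩
    obtain ⟨t, rfl⟩ : ∃ t : ℕ, y = t + 1 := ⟨(y - 1).toNat, by omega⟩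
    rw [add_sub_cancel_right] at hrt
    lift r to ℕ using by omega
    have h0 : ascProd r t (w c) = δ * r := by
      rw [hc, ascProd_apply_mul (by omega) (by omega) hδ (by omega), if_neg (by omega),
        if_pos rfl]
    rw [moveDown, foldl_mul_apply (b := (r, t)) _ nodup_signBlocks (fun b => ascProd b.1 b.2), h0]
    · exact mem_signBlocks.2 ((isSignBlock_iff hε hw).2 hrt)
    · intro b hb hne
      have hb' := (isSignBlock_iff hε hw).1 (mem_signBlocks.1 hb)
      have hb1 := hb'.1
      have hb2 := (hb'.2.1 _ le_rfl hb1).1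
      have hs := hrt.separated hb' fun h => hne (Prod.ext (by omega) (by omega))
      rw [hc, ascProd_apply_mul (by omega) (by omega) hδ (by omega), if_neg (by omega),
        if_neg (by omega)]
    · intro b hb hne
      have hb' := (isSignBlock_iff hε hw).1 (mem_signBlocks.1 hb)
      have hb1 := hb'.1
      have hb2 := (hb'.2.1 _ le_rfl hb1).1
      have hs := hrt.separated hb' fun h => hne (Prod.ext (by omega) (by omega))
      dsimp only
      rw [h0, ascProd_apply_mul (by omega) (by omega) hδ (by omega), if_neg (by omega),
        if_neg (by omega)]

theorem descProd_pred_apply_mul {r t : ℕ} (hr : 1 ≤ r) (hrt : r ≤ t) (hδ : δ = 1 ∨ δ = -1)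
    {y : ℤ} (hy : 0 < y) : descProd (r - 1) (t - 1) (δ * y) =
      δ * if (r : ℤ) ≤ y ∧ y ≤ t ∧ y ≠ 1 then y - 1 else if y = r - 1 then (t : ℤ) else
        if r = 1 ∧ y = 1 then -(t : ℤ) else y := by
  rcases eq_or_ne r 1 with rfl | hr1
  · rw [Nat.sub_self, descProd_zero_apply_mul hδ hy]
    congr 1
    split_ifs <;> omega
  · rw [descProd_apply_mul (by omega) (by omega) hδ hy]
    congr 1
    split_ifs <;> omega

theorem moveUp_apply_of_run (hε : ε = 1 ∨ ε = -1) (hw : w ∈ B N) (hδ : δ = 1 ∨ δ = -1)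
    {r t : ℕ} {y y' : ℤ} (hrt : IsRun (Right N k ε w) r t) (hy1 : 1 ≤ y) (hyr : r - 1 ≤ y)
    (hyt : y ≤ t) (hc : w c = δ * y)
    (hy' : (if (r : ℤ) ≤ y ∧ y ≤ t ∧ y ≠ 1 then y - 1 else if y = r - 1 then (t : ℤ) else
        if r = 1 ∧ y = 1 then -(t : ℤ) else y) = y') : moveUp N k ε w c = δ * y' := by
  have hr1 := (hrt.2.1 r le_rfl hrt.1).1
  have hr2 := hrt.1
  have h0 : descProd (r - 1) (t - 1) (w c) = δ * y' := by
    rw [hc, descProd_pred_apply_mul (by omega) (by omega) hδ hy1, hy']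
  have hy'' : 1 ≤ |y'| ∧ r - 1 ≤ |y'| ∧ |y'| ≤ t ∧ (y' = |y'| ∨ r = 1 ∧ y' = -|y'|) := by
    rcases abs_cases y' with h | h <;> rw [h.1] <;> split_ifs at hy' <;> omega
  -- A block starting in row 1 reverses the sign of that entry, so its image is rewritten with a
  -- positive row z before checking that the other factors fix it.
  obtain ⟨z, δ', hz, hδ', h3⟩ : ∃ z δ' : ℤ, 1 ≤ z ∧ (δ' = 1 ∨ δ' = -1) ∧ δ * y' = δ' * z ∧
      r - 1 ≤ z ∧ z ≤ t := by
    rcases hy''.2.2.2 with h | h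
    · exact ⟨y', δ, by omega, hδ, rfl, by omega, by omega⟩
    · exact ⟨-y', -δ, by omega, by omega, by ring, by omega, by omega⟩
  rw [moveUp, foldl_mul_apply (b := (r, t)) _ nodup_signBlocks
    (fun b => descProd (b.1 - 1) (b.2 - 1)), h0]
  · exact mem_signBlocks.2 ((isSignBlock_iff hε hw).2 hrt)
  · intro b hb hne
    have hb' := (isSignBlock_iff hε hw).1 (mem_signBlocks.1 hb)
    have hb1 := hb'.1
    have hb2 := (hb'.2.1 _ le_rfl hb1).1
    have hs := hrt.separated hb' fun h => hne (Prod.ext (by omega) (by omega))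
    rw [hc, descProd_pred_apply_mul (by omega) (by omega) hδ hy1]
    congr 1
    split_ifs <;> omega
  · intro b hb hne
    have hb' := (isSignBlock_iff hε hw).1 (mem_signBlocks.1 hb)
    have hb1 := hb'.1
    have hb2 := (hb'.2.1 _ le_rfl hb1).1
    have hs := hrt.separated hb' fun h => hne (Prod.ext (by omega) (by omega))
    dsimp only
    rw [h0, h3.1, descProd_pred_apply_mul (by omega) (by omega) hδ' hz]
    congr 1
    split_ifs <;> omega

theorem moveUp_apply_of_right (hε : ε = 1 ∨ ε = -1) (hw : w ∈ B N) (hδ : δ = 1 ∨ δ = -1) {x : ℤ}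
    (hx : Right N k ε w x) (hx1 : x ≠ 1) (hc : w c = δ * x) :
    moveUp N k ε w c = δ * (x - 1) := by
  obtain ⟨r, t, hrt, hrx, hxt⟩ := exists_run (fun x hx => hx.1)
    (fun (x : ℤ) (hx : Right N k ε w x) => hx.2.1) hx
  have hr1 := (hrt.2.1 r le_rfl hrt.1).1
  lift r to ℕ using by omega
  lift t to ℕ using by omega
  exact moveUp_apply_of_run hε hw hδ hrt hx.1 (by omega) hxt hc (by rw [if_pos ⟨hrx, hxt, hx1⟩])

theorem moveUp_apply_of_not_right (hε : ε = 1 ∨ ε = -1) (hw : w ∈ B N) (hδ : δ = 1 ∨ δ = -1)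
    {y t : ℤ} (hy1 : 1 ≤ y) (hyt : y ≤ t) (hy : ¬ Right N k ε w y)
    (h₁ : ∀ z, y < z → z ≤ t → Right N k ε w z) (h₂ : ¬ Right N k ε w (t + 1))
    (hc : w c = δ * y) : moveUp N k ε w c = δ * t := by
  rcases eq_or_lt_of_le hyt with rfl | hyt
  · rw [moveUp, foldl_mul_apply_of_fix _ (fun b : ℕ × ℕ => descProd (b.1 - 1) (b.2 - 1)), hc]
    intro b hb
    have hb' := (isSignBlock_iff hε hw).1 (mem_signBlocks.1 hb)
    have hb1 := hb'.1
    have hb2 := (hb'.2.1 _ le_rfl hb1).1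
    have h3 := mt (hb'.2.1 y)
    have h4 := mt (hb'.2.1 (y + 1))
    simp only [hy, h₂, imp_false] at h3 h4
    rw [hc, descProd_pred_apply_mul (by omega) (by omega) hδ (by omega)]
    congr 1
    split_ifs <;> omega
  · lift t to ℕ using by omega
    obtain ⟨r, rfl⟩ : ∃ r : ℕ, y = r - 1 := ⟨(y + 1).toNat, by omega⟩
    have hrt : IsRun (Right N k ε w) r t :=
      ⟨by omega, fun z h3 h4 => h₁ z (by omega) h4, hy, h₂⟩
    refine moveUp_apply_of_run hε hw hδ hrt hy1 le_rfl (by omega) hc ?_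
    rw [if_neg (by omega), if_pos rfl]

theorem moveUp_apply_one (hε : ε = 1 ∨ ε = -1) (hw : w ∈ B N) (hδ : δ = 1 ∨ δ = -1) {t : ℤ}
    (ht : 1 ≤ t) (h₁ : ∀ z, 1 ≤ z → z ≤ t → Right N k ε w z) (h₂ : ¬ Right N k ε w (t + 1))
    (hc : w c = δ) : moveUp N k ε w c = δ * -t := by
  lift t to ℕ using by omega
  have hrt : IsRun (Right N k ε w) (1 : ℕ) t :=
    ⟨by simpa using ht, fun z h3 h4 => h₁ z (by omega) h4, fun h => by simpa using h.1, h₂⟩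
  exact moveUp_apply_of_run (y := 1) hε hw hδ hrt le_rfl (by simp) ht (by rw [hc, mul_one])
    (by simp)

end moves

end SignedPerm

/-! ### The downward move with sign correction, and what it preserves -/

namespace SignedPerm

variable {N k : ℕ} {ε δ : ℤ} {w : Equiv.Perm ℤ}

theorem right_iff_of_apply (hε : ε = 1 ∨ ε = -1) (hw : w ∈ B N) (hδ : δ = 1 ∨ δ = -1) {c y : ℤ}
    (hc1 : 1 ≤ c) (hy1 : 1 ≤ y) (hyN : y ≤ N) (hc : w c = δ * y) :
    Right N k ε w y ↔ k < c ∧ δ = ε := by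
  have h : w⁻¹ (ε * y) = if δ = ε then c else -c := by
    split_ifs with h
    · rw [Equiv.Perm.inv_eq_iff_eq, hc, h]
    · rw [Equiv.Perm.inv_eq_iff_eq, B_neg hw, hc, ← neg_mul]
      congr 1
      omega
  rw [Right, h]
  split_ifs with h'
  · exact ⟨fun h2 => ⟨h2.2.2, h'⟩, fun h2 => ⟨hy1, hyN, h2.1⟩⟩
  · exact ⟨fun h2 => by omega, fun h2 => absurd h2.2 h'⟩

theorem exists_sign_mul (hw : w ∈ B N) {c : ℤ} (hc1 : 1 ≤ c) (hcN : c ≤ N) :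
    ∃ δ y : ℤ, (δ = 1 ∨ δ = -1) ∧ 1 ≤ y ∧ y ≤ N ∧ w c = δ * y := by
  have h0 := B_ne_zero hw (x := c) (by omega)
  have h1 := B_range hw (x := c) (by omega) hcN
  by_cases h : 0 < w c
  · exact ⟨1, w c, by omega, by omega, by omega, by ring⟩
  · exact ⟨-1, -w c, by omega, by omega, by omega, by ring⟩

theorem Right.exists_column (hε : ε = 1 ∨ ε = -1) (hw : w ∈ B N) {x : ℤ}
    (h : Right N k ε w x) : ∃ c : ℤ, k < c ∧ c ≤ N ∧ w c = ε * x := by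
  have h2 := h.1
  have h3 := h.2.1
  have h1 := B_range (inv_mem hw) (x := ε * x) (by rcases hε with rfl | rfl <;> omega)
    (by rcases hε with rfl | rfl <;> omega)
  exact ⟨w⁻¹ (ε * x), h.2.2, h1.2, by simp⟩

theorem right_of_apply {c x : ℤ} (hkc : k < c) (hx1 : 1 ≤ x) (hxN : x ≤ N) (hc : w c = ε * x) :
    Right N k ε w x :=
  ⟨hx1, hxN, by rw [← hc]; simpa using hkc⟩

theorem Right.not_neg (hw : w ∈ B N) {x : ℤ} (h : Right N k ε w x) :
    ¬ Right N k (-ε) w x := by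
  rintro ⟨-, -, h'⟩
  have h3 := h.2.2
  rw [neg_mul, B_neg (inv_mem hw)] at h'
  omega

theorem foldl_mul_mem {ι : Type*} (l : List ι) (f : ι → Equiv.Perm ℤ) (hw : w ∈ B N)
    (h : ∀ b ∈ l, f b ∈ B N) : l.foldl (fun x b => f b * x) w ∈ B N := by
  induction l generalizing w with
  | nil => exact hw
  | cons b l ih =>
    exact ih (mul_mem (h b (by simp)) hw) fun b' hb' => h b' (by simp [hb'])

/-- A positive row N would be pushed out of the matrix. -/
theorem moveDown_mem (hε : ε = 1 ∨ ε = -1) (hw : w ∈ B N) (hN : ¬ Right N k ε w N) :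
    moveDown N k ε w ∈ B N := by
  refine foldl_mul_mem _ (fun b : ℕ × ℕ => ascProd b.1 b.2) hw fun b hb => ascProd_mem_B ?_
  have hb' := (isSignBlock_iff hε hw).1 (mem_signBlocks.1 hb)
  have h := hb'.2.1 b.2 hb'.1 le_rfl
  refine lt_of_le_of_ne (by exact_mod_cast h.2.1) fun e => hN (by rwa [e] at h)

theorem moveUp_mem (hw : w ∈ B N) : moveUp N k ε w ∈ B N := by
  refine foldl_mul_mem _ (fun b : ℕ × ℕ => descProd (b.1 - 1) (b.2 - 1)) hw
    fun b hb => descProd_mem_B ?_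
  have hb' := mem_signBlocks.1 hb
  have := hb'.1
  have := hb'.2.1
  have := hb'.2.2.1
  omega

open Classical in
theorem flipTop_apply (hε : ε = 1 ∨ ε = -1) (hw : w ∈ B N) (c : ℤ) :
    flipTop N k ε w c =
      if Right N k ε w 1 ∧ ¬ Right N k ε w 2 then s 0 (w c) else w c := by
  have h : IsSignBlock N k ε w 1 1 ↔ Right N k ε w 1 ∧ ¬ Right N k ε w 2 := by
    rw [isSignBlock_iff hε hw]
    constructor
    · rintro ⟨-, h1, -, h2⟩
      exact ⟨h1 1 (by simp) (by simp), h2⟩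
    · rintro ⟨h1, h2⟩
      refine ⟨le_rfl, fun x hx hx' => ?_, fun h => by simpa using h.1, h2⟩
      rwa [show x = 1 by push_cast at hx hx'; omega]
  rw [flipTop]
  split_ifs with h1 h2 h2
  · rfl
  · exact absurd (h.1 h1) h2
  · exact absurd (h.2 h2) h1
  · rfl

theorem flipTop_mem (hw : w ∈ B N) : flipTop N k ε w ∈ B N := by
  rw [flipTop]
  split_ifs with h
  · exact mul_mem (s_mem_B (by have := h.2.2.1; omega)) hw
  · exact hw

/-- The first two steps of the lowering (`ε = 1`) and raising (`ε = -1`) maps. -/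
def drop (N k : ℕ) (ε : ℤ) (w : Equiv.Perm ℤ) : Equiv.Perm ℤ :=
  flipTop N k (-ε) (moveDown N k ε w)

theorem drop_mem (hε : ε = 1 ∨ ε = -1) (hw : w ∈ B N) (hN : ¬ Right N k ε w N) :
    drop N k ε w ∈ B N :=
  flipTop_mem (moveDown_mem hε hw hN)

theorem not_right_start (hε : ε = 1 ∨ ε = -1) (hw : w ∈ B N) {y : ℤ} (hy : 1 ≤ y)
    (hδ : δ = 1 ∨ δ = -1) {c : ℤ} (hc : w c = δ * y) (hP : ¬ Right N k ε w y) :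
    ∃ r, 1 ≤ r ∧ r ≤ y ∧ (∀ z, r ≤ z → z < y → Right N k ε w z) ∧ ¬ Right N k ε w (r - 1) ∧
      moveDown N k ε w c = δ * r := by
  obtain ⟨r, h1, h2, h3, h4⟩ := exists_run_start (P := Right N k ε w) (fun x hx => hx.1) (y - 1)
  refine ⟨r, by omega, by omega, fun z h5 h6 => h2 z h5 (by omega), h3, ?_⟩
  exact moveDown_apply_of_not_right hε hw hδ (by omega) (by omega) hP
    (fun z h5 h6 => h2 z h5 (by omega)) h3 hc

/-- Signs are kept by the move, so the positive rows afterwards are exactly the old ones shifted by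
one. In particular row 1 is not positive any more. -/
theorem right_moveDown_succ (hε : ε = 1 ∨ ε = -1) (hw : w ∈ B N) (hN : ¬ Right N k ε w N) {x : ℤ} :
    Right N k ε (moveDown N k ε w) x ↔ Right N k ε w (x - 1) := by
  have hm := moveDown_mem hε hw hN
  constructor
  · intro h
    obtain ⟨c, hkc, hcN, hc⟩ := h.exists_column hε hm
    obtain ⟨δ, y, hδ, hy1, hyN, hy⟩ := exists_sign_mul hw (by omega) hcN
    have hiff := right_iff_of_apply (k := k) hε hw hδ (by omega) hy1 hyN hy
    have hx := h.1
    by_cases hP : Right N k ε w y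
    · rw [moveDown_apply_of_right hε hw hδ hP hy, (hiff.1 hP).2] at hc
      have : y = x - 1 := by rcases hε with rfl | rfl <;> omega
      exact this ▸ hP
    · obtain ⟨r, hr1, -, -, -, hr⟩ := not_right_start hε hw hy1 hδ hy hP
      rw [hr] at hc
      have : δ = ε := by rcases hε with rfl | rfl <;> rcases hδ with rfl | rfl <;> omega
      exact absurd (hiff.2 ⟨hkc, this⟩) hP
  · intro h
    obtain ⟨c, hkc, hcN, hc⟩ := h.exists_column hε hw
    have := moveDown_apply_of_right hε hw hε h hc
    have h1 := h.1
    have h2 := h.2.1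
    have h3 : x - 1 ≠ N := fun e => hN (e ▸ h)
    exact right_of_apply hkc (by omega) (by omega) (by rw [this, sub_add_cancel])

/-- Positive entries move away from zero by one each. The negative ones move towards zero, but jump
over positive rows only and hence never over each other. -/
theorem moveDown_mono_right (hε : ε = 1 ∨ ε = -1) (hw : w ∈ B N) {c c' : ℤ}
    (hc : k < c) (hcN : c ≤ N) (hc' : k < c') (hcN' : c' ≤ N) (h : ε * w c < ε * w c') :
    ε * moveDown N k ε w c < ε * moveDown N k ε w c' := by
  obtain ⟨δ, y, hδ, hy1, hyN, hy⟩ := exists_sign_mul hw (by omega) hcN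
  obtain ⟨δ', y', hδ', hy1', hyN', hy'⟩ := exists_sign_mul hw (by omega) hcN'
  have hiff := right_iff_of_apply (k := k) hε hw hδ (by omega) hy1 hyN hy
  have hiff' := right_iff_of_apply (k := k) hε hw hδ' (by omega) hy1' hyN' hy'
  rw [hy, hy'] at h
  by_cases hP : Right N k ε w y
  · rw [moveDown_apply_of_right hε hw hδ hP hy]
    by_cases hP' : Right N k ε w y'
    · rw [moveDown_apply_of_right hε hw hδ' hP' hy', (hiff.1 hP).2, (hiff'.1 hP').2]
      rw [(hiff.1 hP).2, (hiff'.1 hP').2] at h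
      rcases hε with rfl | rfl <;> omega
    · have hδε : δ' ≠ ε := fun e => hP' (hiff'.2 ⟨hc', e⟩)
      rw [(hiff.1 hP).2] at h
      rcases hε with rfl | rfl <;> rcases hδ' with rfl | rfl <;> omega
  · have hδε : δ ≠ ε := fun e => hP (hiff.2 ⟨hc, e⟩)
    obtain ⟨r, hr1, hr2, hr3, -, hr⟩ := not_right_start hε hw hy1 hδ hy hP
    rw [hr]
    by_cases hP' : Right N k ε w y'
    · rw [moveDown_apply_of_right hε hw hδ' hP' hy', (hiff'.1 hP').2]
      rcases hε with rfl | rfl <;> rcases hδ with rfl | rfl <;> omega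
    · have hδε' : δ' ≠ ε := fun e => hP' (hiff'.2 ⟨hc', e⟩)
      obtain ⟨r', hr1', hr2', hr3', -, hr'⟩ := not_right_start hε hw hy1' hδ' hy' hP'
      rw [hr']
      have : ¬ (r ≤ y' ∧ y' < y) := fun e => hP' (hr3 y' e.1 e.2)
      rcases hε with rfl | rfl <;> rcases hδ with rfl | rfl <;> rcases hδ' with rfl | rfl <;> omega

/-- Rows left of the column jump only over rows right of it. -/
theorem moveDown_mono_left (hε : ε = 1 ∨ ε = -1) (hw : w ∈ B N) (hN : ¬ Right N k ε w N)
    (hkN : k ≤ N) {c c' : ℤ} (hc : 0 ≤ c) (hck : c ≤ k) (hc' : 0 ≤ c') (hck' : c' ≤ k)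
    (h : w c < w c') : moveDown N k ε w c < moveDown N k ε w c' := by
  have key : ∀ c : ℤ, 0 ≤ c → c ≤ k → (c = 0 ∧ w c = 0 ∧ moveDown N k ε w c = 0) ∨
      ∃ y r δ : ℤ, 1 ≤ r ∧ r ≤ y ∧ (δ = 1 ∨ δ = -1) ∧ w c = δ * y ∧
        moveDown N k ε w c = δ * r ∧ ¬ Right N k ε w y ∧
        (∀ z, r ≤ z → z < y → Right N k ε w z) := by
    intro c hc hck
    rcases eq_or_lt_of_le hc with rfl | hc0
    · exact Or.inl ⟨rfl, B_zero hw, B_zero (moveDown_mem hε hw hN)⟩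
    · right
      obtain ⟨δ, y, hδ, hy1, hyN, hy⟩ := exists_sign_mul hw (c := c) (by omega) (by omega)
      have hP : ¬ Right N k ε w y := by
        rw [right_iff_of_apply (k := k) hε hw hδ (by omega) hy1 hyN hy]
        omega
      obtain ⟨r, hr1, hr2, hr3, -, hr⟩ := not_right_start hε hw hy1 hδ hy hP
      exact ⟨y, r, δ, hr1, hr2, hδ, hy, hr, hP, hr3⟩
  rcases key c hc hck with ⟨-, h1, h2⟩ | ⟨y, r, δ, h1, h2, hδ, h3, h4, h5, h6⟩ <;>
    rcases key c' hc' hck' with ⟨-, h1', h2'⟩ | ⟨y', r', δ', h1', h2', hδ', h3', h4', h5', h6'⟩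
  · omega
  · rcases hδ' with rfl | rfl <;> omega
  · rcases hδ with rfl | rfl <;> omega
  · have e1 : ¬ (r ≤ y' ∧ y' < y) := fun e => h5' (h6 y' e.1 e.2)
    have e2 : ¬ (r' ≤ y ∧ y < y') := fun e => h5 (h6' y e.1 e.2)
    rcases hδ with rfl | rfl <;> rcases hδ' with rfl | rfl <;> omega

/-- `drop` changes the sign of row `1` in the second step. -/
def Flips (N k : ℕ) (ε : ℤ) (w : Equiv.Perm ℤ) : Prop :=
  Right N k (-ε) (moveDown N k ε w) 1 ∧ ¬ Right N k (-ε) (moveDown N k ε w) 2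

theorem drop_apply_of_flips (hε : ε = 1 ∨ ε = -1) (hw : w ∈ B N) (hN : ¬ Right N k ε w N)
    (h : Flips N k ε w) (c : ℤ) : drop N k ε w c = s 0 (moveDown N k ε w c) := by
  rw [drop, flipTop_apply (by omega) (moveDown_mem hε hw hN)]
  exact if_pos h

theorem drop_apply_of_not_flips (hε : ε = 1 ∨ ε = -1) (hw : w ∈ B N) (hN : ¬ Right N k ε w N)
    (h : ¬ Flips N k ε w) (c : ℤ) : drop N k ε w c = moveDown N k ε w c := by
  rw [drop, flipTop_apply (by omega) (moveDown_mem hε hw hN)]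
  exact if_neg h

theorem drop_mono_right (hε : ε = 1 ∨ ε = -1) (hw : w ∈ B N) (hN : ¬ Right N k ε w N) {c c' : ℤ}
    (hc : k < c) (hcN : c ≤ N) (hc' : k < c') (hcN' : c' ≤ N) (h : w c < w c') :
    drop N k ε w c < drop N k ε w c' := by
  have key : ∀ c c' : ℤ, k < c → c ≤ N → k < c' → c' ≤ N → ε * w c < ε * w c' →
      ε * drop N k ε w c < ε * drop N k ε w c' := by
    intro c c' hc hcN hc' hcN' h
    have h1 := moveDown_mono_right hε hw hc hcN hc' hcN' h
    by_cases hF : Flips N k ε w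
    · rw [drop_apply_of_flips hε hw hN hF, drop_apply_of_flips hε hw hN hF]
      -- After the move no column right of k has the value ε or 0, so replacing the value -ε by ε
      -- changes no comparison among these columns.
      have hne : ∀ c : ℤ, k < c → moveDown N k ε w c ≠ ε := by
        intro c hc e
        have h3 := right_of_apply (N := N) (ε := ε) (x := 1) hc le_rfl hF.1.2.1 (by rw [e, mul_one])
        rw [right_moveDown_succ hε hw hN] at h3
        exact absurd h3.1 (by norm_num)
      have h0 : ∀ c : ℤ, k < c → moveDown N k ε w c ≠ 0 := fun c hc =>
        B_ne_zero (moveDown_mem hε hw hN) (by omega)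
      have := hne c hc
      have := hne c' hc'
      have := h0 c hc
      have := h0 c' hc'
      rw [s_zero_apply, s_zero_apply]
      rcases hε with rfl | rfl <;> split_ifs <;> omega
    · rwa [drop_apply_of_not_flips hε hw hN hF, drop_apply_of_not_flips hε hw hN hF]
  rcases hε with rfl | rfl
  · simpa using key c c' hc hcN hc' hcN' (by omega)
  · have := key c' c hc' hcN' hc hcN (by omega)
    omega

/-- The row whose sign is changed belongs to a column right of k. -/
theorem drop_apply_left (hε : ε = 1 ∨ ε = -1) (hw : w ∈ B N) (hN : ¬ Right N k ε w N)
    {c : ℤ} (hc : 0 ≤ c) (hck : c ≤ k) : drop N k ε w c = moveDown N k ε w c := by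
  by_cases hF : Flips N k ε w
  · rw [drop_apply_of_flips hε hw hN hF, s_zero_apply]
    obtain ⟨d, hd, hdN, hdv⟩ := hF.1.exists_column (by omega) (moveDown_mem hε hw hN)
    have h1 : moveDown N k ε w c ≠ -ε := fun e => by
      have := (moveDown N k ε w).injective (a₁ := c) (a₂ := d) (by rw [e, hdv, mul_one])
      omega
    have h2 : moveDown N k ε w c ≠ ε := fun e => by
      have := (moveDown N k ε w).injective (a₁ := c) (a₂ := -d)
        (by rw [e, B_neg (moveDown_mem hε hw hN), hdv]; ring)
      omega
    rw [if_neg (by omega), if_neg (by omega)]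
  · exact drop_apply_of_not_flips hε hw hN hF c

theorem drop_mono_left (hε : ε = 1 ∨ ε = -1) (hw : w ∈ B N) (hN : ¬ Right N k ε w N)
    (hkN : k ≤ N) {c c' : ℤ} (hc : 0 ≤ c) (hck : c ≤ k) (hc' : 0 ≤ c') (hck' : c' ≤ k)
    (h : w c < w c') : drop N k ε w c < drop N k ε w c' := by
  rw [drop_apply_left hε hw hN hc hck, drop_apply_left hε hw hN hc' hck']
  exact moveDown_mono_left hε hw hN hkN hc hck hc' hck' h

theorem drop_lt_iff_right (hε : ε = 1 ∨ ε = -1) (hw : w ∈ B N) (hN : ¬ Right N k ε w N) {c c' : ℤ}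
    (hc : k < c) (hcN : c ≤ N) (hc' : k < c') (hcN' : c' ≤ N) :
    drop N k ε w c < drop N k ε w c' ↔ w c < w c' := by
  refine ⟨fun h => ?_, drop_mono_right hε hw hN hc hcN hc' hcN'⟩
  by_contra h'
  rcases eq_or_lt_of_le (not_lt.1 h') with e | e
  · rw [w.injective e] at h
    omega
  · have := drop_mono_right hε hw hN hc' hcN' hc hcN e
    omega

theorem drop_lt_iff_left (hε : ε = 1 ∨ ε = -1) (hw : w ∈ B N) (hN : ¬ Right N k ε w N)
    (hkN : k ≤ N) {c c' : ℤ} (hc : 0 ≤ c) (hck : c ≤ k) (hc' : 0 ≤ c') (hck' : c' ≤ k) :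
    drop N k ε w c < drop N k ε w c' ↔ w c < w c' := by
  refine ⟨fun h => ?_, drop_mono_left hε hw hN hkN hc hck hc' hck'⟩
  by_contra h'
  rcases eq_or_lt_of_le (not_lt.1 h') with e | e
  · rw [w.injective e] at h
    omega
  · have := drop_mono_left hε hw hN hkN hc' hck' hc hck e
    omega

end SignedPerm

/-! ### Pairs of columns and their normal form -/

namespace SignedPerm

variable {N k : ℕ} {ε δ : ℤ} {w : Equiv.Perm ℤ}

/-- The column of the pair `c, c + 1` whose entry, up to the sign `ε`, is in the lower row. -/
def pairLo (ε : ℤ) (c : ℕ) : ℕ := if ε = 1 then c else c + 1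

/-- The other column of the pair `c, c + 1`. -/
def pairHi (ε : ℤ) (c : ℕ) : ℕ := if ε = 1 then c + 1 else c

/-- `c, c + 1` are the columns of a pair with respect to column `k`. -/
def IsPairCol (N k c : ℕ) : Prop := k < c ∧ c + 1 ≤ N ∧ c % 2 ≠ N % 2

/-- `a, b` are the signed rows of the entries of a pair of columns, multiplied by `ε`. -/
def PairRows (N k : ℕ) (ε : ℤ) (w : Equiv.Perm ℤ) (a b : ℤ) : Prop :=
  ∃ c, IsPairCol N k c ∧ ε * w (pairLo ε c) = a ∧ ε * w (pairHi ε c) = b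

theorem pair_cases (ε : ℤ) (c : ℕ) : (pairLo ε c = c ∧ pairHi ε c = c + 1 ∧ ε = 1) ∨
    (pairLo ε c = c + 1 ∧ pairHi ε c = c ∧ ε ≠ 1) := by
  rw [pairLo, pairHi]
  split_ifs <;> simp_all

theorem exists_pairCol (hk : k % 2 = N % 2) {d : ℤ} (hd : k < d) (hdN : d ≤ N) (ε : ℤ) :
    ∃ c, IsPairCol N k c ∧ (d = pairLo ε c ∨ d = pairHi ε c) := by
  lift d to ℕ using by omega
  by_cases h : d % 2 = N % 2
  · refine ⟨d - 1, ⟨by omega, by omega, by omega⟩, ?_⟩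
    have := pair_cases ε (d - 1)
    omega
  · refine ⟨d, ⟨by omega, by omega, by omega⟩, ?_⟩
    have := pair_cases ε d
    omega

theorem pairRows_cancel (hε : ε = 1 ∨ ε = -1) {c c' : ℤ} (h : ε * w c = ε * w c') : c = c' :=
  w.injective (mul_left_cancel₀ (by rcases hε with rfl | rfl <;> norm_num) h)

theorem pairCol_range {c : ℕ} (hc : IsPairCol N k c) (ε : ℤ) : k < pairLo ε c ∧ pairLo ε c ≤ N ∧
    k < pairHi ε c ∧ pairHi ε c ≤ N := by
  obtain ⟨h1, h2, h3⟩ := hc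
  have := pair_cases ε c
  omega

theorem mul_range (hε : ε = 1 ∨ ε = -1) (hw : w ∈ B N) {c : ℤ} (hc1 : 1 ≤ c) (hcN : c ≤ N) :
    -(N : ℤ) ≤ ε * w c ∧ ε * w c ≤ N ∧ ε * w c ≠ 0 := by
  have h1 := B_range hw (x := c) (by omega) hcN
  have h2 := B_ne_zero hw (x := c) (by omega)
  rcases hε with rfl | rfl <;> omega

theorem right_iff_pairRows (hε : ε = 1 ∨ ε = -1) (hw : w ∈ B N) (hk : k % 2 = N % 2) {ε' : ℤ}
    (hε' : ε' = 1 ∨ ε' = -1) (x : ℤ) :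
    Right N k (ε * ε') w x ↔
      0 < x ∧ ∃ a b, PairRows N k ε w a b ∧ (a = ε' * x ∨ b = ε' * x) := by
  have hεε : ε * ε = 1 := by rcases hε with rfl | rfl <;> rfl
  have hεε' : ε * ε' = 1 ∨ ε * ε' = -1 := by
    rcases hε with rfl | rfl <;> rcases hε' with rfl | rfl <;> norm_num
  constructor
  · intro h
    obtain ⟨d, hkd, hdN, hd⟩ := h.exists_column hεε' hw
    have hd' : ε * w d = ε' * x := by rw [hd, ← mul_assoc, ← mul_assoc, hεε, one_mul]
    obtain ⟨c, hc, rfl | rfl⟩ := exists_pairCol hk hkd hdN ε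
    · exact ⟨by have := h.1; omega, _, _, ⟨c, hc, rfl, rfl⟩, Or.inl hd'⟩
    · exact ⟨by have := h.1; omega, _, _, ⟨c, hc, rfl, rfl⟩, Or.inr hd'⟩
  · rintro ⟨h0, a, b, ⟨c, hc, rfl, rfl⟩, h⟩
    obtain ⟨h1, h2, h3, h4⟩ := pairCol_range hc ε
    have key : ∀ d : ℕ, k < d → d ≤ N → ε * w d = ε' * x → Right N k (ε * ε') w x := by
      intro d hkd hdN hd
      have hr := mul_range hε hw (c := d) (by omega) (by omega)
      have hd' : w d = ε * ε' * x := by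
        rw [mul_assoc, ← hd, ← mul_assoc, hεε, one_mul]
      refine right_of_apply (c := d) (by omega) (by omega) ?_ hd'
      rcases hε' with rfl | rfl <;> omega
    rcases h with h | h
    · exact key _ h1 h2 h
    · exact key _ h3 h4 h

theorem pattern_of_mem (hε : ε = 1 ∨ ε = -1) (hw : w ∈ B N) (hk : k % 2 = N % 2) :
    Pattern N (Right N k ε w) (Right N k (-ε) w) (PairRows N k ε w) where
  pos_iff x := by simpa using right_iff_pairRows hε hw hk (ε' := 1) (Or.inl rfl) x
  neg_iff x := by simpa using right_iff_pairRows hε hw hk (ε' := -1) (Or.inr rfl) x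
  disj x h := h.not_neg hw
  range := by
    rintro a b ⟨c, hc, rfl, rfl⟩
    obtain ⟨h1, h2, h3, h4⟩ := pairCol_range hc ε
    have h5 := mul_range hε hw (c := pairLo ε c) (by omega) (by omega)
    have h6 := mul_range hε hw (c := pairHi ε c) (by omega) (by omega)
    exact ⟨h5.1, h5.2.1, h6.1, h6.2.1, h5.2.2, h6.2.2⟩
  right_unique := by
    rintro a b b' ⟨c, hc, rfl, rfl⟩ ⟨c', hc', h, rfl⟩
    have := pairRows_cancel hε h
    have h1 := pair_cases ε c
    have h2 := pair_cases ε c'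
    have : c = c' := by omega
    rw [this]
  left_unique := by
    rintro a a' b ⟨c, hc, rfl, rfl⟩ ⟨c', hc', rfl, h⟩
    have := pairRows_cancel hε h
    have h1 := pair_cases ε c
    have h2 := pair_cases ε c'
    have : c = c' := by omega
    rw [this]
  cross := by
    rintro a b d ⟨c, hc, rfl, rfl⟩ ⟨c', hc', h, rfl⟩
    have := pairRows_cancel hε h
    have h1 := pair_cases ε c
    have h2 := pair_cases ε c'
    obtain ⟨-, -, h3⟩ := hc
    obtain ⟨-, -, h4⟩ := hc'
    omega

/-- The pairs of the matrices between the second and third step of the lowering map. -/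
def IsW (N : ℤ) (T : ℤ → ℤ → Prop) : Prop :=
  ∀ a b, T a b → b = a + 1 ∧ (0 < a → a % 2 ≠ N % 2) ∧ (a < 0 → a % 2 = N % 2)

theorem pairRows_neg {a b : ℤ} (hε : ε = 1 ∨ ε = -1) :
    PairRows N k (-ε) w a b ↔ PairRows N k ε w (-b) (-a) := by
  refine exists_congr fun c => and_congr_right fun _ => ?_
  have h1 := pair_cases ε c
  have h2 := pair_cases (-ε) c
  have e1 : pairLo (-ε) c = pairHi ε c := by omega
  have e2 : pairHi (-ε) c = pairLo ε c := by omega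
  rw [e1, e2, neg_mul, neg_mul]
  omega

/-- Changing ε replaces (a, a+1) by (-a-1, -a), which interchanges the two parity requirements.
Since the normal form is thus common to both signs, it can be entered with ε and left with -ε. -/
theorem isW_neg (hε : ε = 1 ∨ ε = -1) (hw : w ∈ B N) :
    IsW N (PairRows N k (-ε) w) ↔ IsW N (PairRows N k ε w) := by
  have key : ∀ ε : ℤ, (ε = 1 ∨ ε = -1) → IsW N (PairRows N k ε w) →
      IsW N (PairRows N k (-ε) w) := by
    intro ε hε h a b hab
    have h1 := h _ _ ((pairRows_neg hε).1 hab)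
    obtain ⟨c, hc, rfl, rfl⟩ := hab
    have h2 := pairCol_range hc (-ε)
    have h3 := mul_range (ε := -ε) (by omega) hw (c := pairHi (-ε) c) (by omega) (by omega)
    omega
  refine ⟨fun h => ?_, key ε hε⟩
  simpa using key (-ε) (by omega) h

theorem uncanceled_bottom (hε : ε = 1 ∨ ε = -1) (hw : w ∈ B N) (hk : k % 2 = N % 2)
    (hU : IsU N (Right N k ε w) (PairRows N k ε w)) : ¬ Right N k ε w N :=
  ((pattern_of_mem hε hw hk).uncanceled_of_isU hU).prop1

section eps

theorem apply_eq_of_mul_eq (hε : ε = 1 ∨ ε = -1) {x y : ℤ} : ε * x = y ↔ x = ε * y := by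
  rcases hε with rfl | rfl <;> omega

/-- The effect of `drop` on the pairs of columns. -/
theorem drop_apply_pair (hε : ε = 1 ∨ ε = -1) (hw : w ∈ B N) (hk : k % 2 = N % 2)
    (hU : IsU N (Right N k ε w) (PairRows N k ε w)) {c : ℕ} (hc : IsPairCol N k c) :
    (0 < ε * w (pairHi ε c) ∧ ε * drop N k ε w (pairLo ε c) = ε * w (pairHi ε c) ∧
      ε * drop N k ε w (pairHi ε c) = ε * w (pairHi ε c) + 1) ∨
    (ε * w (pairHi ε c) < 0 ∧ ε * drop N k ε w (pairLo ε c) = ε * w (pairHi ε c) - 1 ∧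
      ε * drop N k ε w (pairHi ε c) = ε * w (pairHi ε c)) := by
  have hpat := pattern_of_mem hε hw hk
  have hN := uncanceled_bottom hε hw hk hU
  have hT : PairRows N k ε w _ _ := ⟨c, hc, rfl, rfl⟩
  obtain ⟨hr1, hr2, hr3, hr4⟩ := pairCol_range hc ε
  have hm := moveDown_mem hε hw hN
  set a := ε * w (pairLo ε c) with ha
  set b := ε * w (pairHi ε c) with hb
  have ha' : w (pairLo ε c) = ε * a := (apply_eq_of_mul_eq hε).1 ha.symm
  have hb' : w (pairHi ε c) = ε * b := (apply_eq_of_mul_eq hε).1 hb.symm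
  have ha'' : w (pairLo ε c) = -ε * -a := by rw [ha']; ring
  have hb'' : w (pairHi ε c) = -ε * -b := by rw [hb']; ring
  obtain ⟨hpa, hpb, ⟨h1, h2⟩ | ⟨h1, h2, h3, h4⟩⟩ := hU a b hT
  · left
    have hPa := hpat.pos_left hT h1
    have hPb := hpat.pos_right hT (by omega)
    have e1 := moveDown_apply_of_right hε hw hε hPa ha'
    have e2 := moveDown_apply_of_right hε hw hε hPb hb'
    have e : ∀ d : ℤ, ∀ x : ℤ, 2 ≤ x → moveDown N k ε w d = ε * x →
        drop N k ε w d = ε * x := by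
      intro d x hx hd
      by_cases hF : Flips N k ε w
      · rw [drop_apply_of_flips hε hw hN hF, hd, s_zero_apply]
        rcases hε with rfl | rfl <;> rw [if_neg (by omega), if_neg (by omega)]
      · rw [drop_apply_of_not_flips hε hw hN hF, hd]
    refine ⟨by omega, ?_, ?_⟩
    · rw [apply_eq_of_mul_eq hε, e _ _ (by omega) e1, h2]
    · rw [apply_eq_of_mul_eq hε, e _ _ (by omega) e2]
  · have hMa := hpat.neg_left hT h1
    have hna : ¬ Right N k ε w (-a) := fun h => hpat.disj _ h hMa
    obtain ⟨r, hra1, hra2, hra3, hra4, hra5⟩ :=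
      not_right_start hε hw (by omega) (show -ε = 1 ∨ -ε = -1 by omega) ha'' hna
    by_cases hb0 : b < 0
    · right
      have hMb := hpat.neg_right hT hb0
      have hnb : ¬ Right N k ε w (-b) := fun h => hpat.disj _ h hMb
      obtain ⟨q, hqb1, hqb2, hqb3, hqb4, hqb5⟩ :=
        not_right_start hε hw (by omega) (show -ε = 1 ∨ -ε = -1 by omega) hb'' hnb
      have hq : q = -b := by
        by_contra hq
        have := (Pattern.IsU.pos_of_eq hpat hU (hqb3 (-b - 1) (by omega) (by omega)) (by omega)).2
        rw [sub_add_cancel] at this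
        exact hnb this
      have hr : r = -b + 1 := by
        have e1 : ¬ r ≤ -b := fun h => hnb (hra3 _ h (by omega))
        have e2 : ¬ -b + 1 < r := fun h => hra4 (h4 _ (by omega) (by omega) (by omega))
        omega
      have hF : ¬ (Flips N k ε w ∧ b = -1) := by
        rintro ⟨hF, hb1⟩
        refine hF.2 (right_of_apply (c := pairLo ε c) (by omega) (by omega) ?_ ?_)
        · have := hpat.range _ _ hT
          omega
        · rw [hra5, hr, hb1]
          norm_num
      have e : ∀ d : ℤ, ∀ x : ℤ, 1 ≤ x → (x = 1 → b = -1) → moveDown N k ε w d = -ε * x →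
          drop N k ε w d = -ε * x := by
        intro d x hx hxb hd
        by_cases hF' : Flips N k ε w
        · have : x ≠ 1 := fun e => hF ⟨hF', hxb e⟩
          rw [drop_apply_of_flips hε hw hN hF', hd, s_zero_apply]
          rcases hε with rfl | rfl <;> rw [if_neg (by omega), if_neg (by omega)]
        · rw [drop_apply_of_not_flips hε hw hN hF', hd]
      refine ⟨hb0, ?_, ?_⟩
      · rw [apply_eq_of_mul_eq hε, e _ _ (by omega) (by omega) hra5, hr]
        ring
      · rw [apply_eq_of_mul_eq hε, e _ _ (by omega) (by omega) hqb5, hq]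
        ring
    · left
      have hb1 : b = 1 := by
        have := hpat.range _ _ hT
        omega
      have hPb := hpat.pos_right hT (by omega)
      have e2 := moveDown_apply_of_right hε hw hε hPb hb'
      -- The mixed pair: all rows above -a are positive, so row -a rises to row 1 while row 1 goes
      -- down to row 2. The sign change then makes the pair (1, 2).
      have hr : r = 1 := by
        by_contra hr
        exact hra4 (h4 _ (by omega) (by omega) (by omega))
      have hF : Flips N k ε w := by
        constructor
        · exact right_of_apply (c := pairLo ε c) (by omega) le_rfl (by omega) (by rw [hra5, hr])
        · intro h
          have : Right N k ε (moveDown N k ε w) 2 := by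
            rw [right_moveDown_succ hε hw hN]
            rw [hb1] at hPb
            exact hPb
          exact this.not_neg hm h
      rw [drop_apply_of_flips hε hw hN hF, drop_apply_of_flips hε hw hN hF, hra5, e2, hr, hb1,
        s_zero_apply, s_zero_apply]
      rcases hε with rfl | rfl <;> norm_num

theorem isW_drop (hε : ε = 1 ∨ ε = -1) (hw : w ∈ B N) (hk : k % 2 = N % 2)
    (hU : IsU N (Right N k ε w) (PairRows N k ε w)) :
    IsW N (PairRows N k ε (drop N k ε w)) := by
  rintro a b ⟨c, hc, rfl, rfl⟩
  have h1 := drop_apply_pair hε hw hk hU hc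
  have h2 := hU _ _ ⟨c, hc, rfl, rfl⟩
  omega

/-- A left row rises by the length of the positive run above it. This is even unless the run starts
with row 1 of the mixed pair, and then the row below the run is the negative row of that pair, not a
left row. -/
theorem drop_parity_left (hε : ε = 1 ∨ ε = -1) (hw : w ∈ B N) (hk : k % 2 = N % 2) (hkN : k ≤ N)
    (hU : IsU N (Right N k ε w) (PairRows N k ε w)) {c : ℤ} (hc : 1 ≤ c) (hck : c ≤ k) :
    drop N k ε w c % 2 = w c % 2 := by
  have hpat := pattern_of_mem hε hw hk
  have hN := uncanceled_bottom hε hw hk hU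
  rw [drop_apply_left hε hw hN (by omega) hck]
  obtain ⟨δ, y, hδ, hy1, hyN, hy⟩ := exists_sign_mul hw (c := c) (by omega) (by omega)
  have hP : ¬ Right N k ε w y := by
    rw [right_iff_of_apply (k := k) hε hw hδ (by omega) hy1 hyN hy]
    omega
  have hM : ¬ Right N k (-ε) w y := by
    rw [right_iff_of_apply (k := k) (by omega) hw hδ (by omega) hy1 hyN hy]
    omega
  obtain ⟨r, hr1, hr2, hr3, hr4, hr⟩ := not_right_start hε hw hy1 hδ hy hP
  have key : r % 2 = y % 2 := by
    rcases eq_or_lt_of_le hr2 with rfl | hlt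
    · rfl
    have h1 := Pattern.IsU.run_end hpat hU (hr3 (y - 1) (by omega) (by omega))
      (by rwa [sub_add_cancel])
    by_cases h2 : r % 2 = N % 2
    · omega
    · rcases Pattern.IsU.pos_of_ne hpat hU (hr3 r le_rfl hlt) h2 with h3 | ⟨h3, a, -, ha, -, hMa, hPa⟩
      · exact absurd h3.2 hr4
      · rcases lt_trichotomy y (-a) with h | h | h
        · exact absurd (hPa y (by omega) h) hP
        · exact absurd (h ▸ hMa) hM
        · exact absurd hMa (hpat.disj _ (hr3 (-a) (by omega) h))
  rw [hr, hy]
  rcases hδ with rfl | rfl <;> omega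

end eps

end SignedPerm

/-! ### Moving blocks up: the inverse of the downward move -/

namespace SignedPerm

variable {N k : ℕ} {ε δ : ℤ} {w : Equiv.Perm ℤ}

namespace Pattern

variable {n : ℤ} {P M : ℤ → Prop} {T : ℤ → ℤ → Prop}

theorem IsW.pos_of_ne (h : Pattern n P M T) (hW : IsW n T) {x : ℤ} (hx : P x)
    (hp : x % 2 ≠ n % 2) : P (x + 1) := by
  obtain ⟨h0, a, b, hab, hc⟩ := (h.pos_iff x).1 hx
  have h1 := hW a b hab
  have h2 := h.range a b hab
  rcases hc with rfl | rfl
  · rw [← h1.1]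
    exact h.pos_right hab (by omega)
  · omega

theorem IsW.pos_of_eq (h : Pattern n P M T) (hW : IsW n T) {x : ℤ} (hx : P x)
    (hp : x % 2 = n % 2) : P (x - 1) := by
  obtain ⟨h0, a, b, hab, hc⟩ := (h.pos_iff x).1 hx
  have h1 := hW a b hab
  have h2 := h.range a b hab
  rcases hc with rfl | rfl
  · omega
  · rw [show b - 1 = a by omega]
    exact h.pos_left hab (by omega)

end Pattern

theorem not_right_end (hε : ε = 1 ∨ ε = -1) (hw : w ∈ B N) {y : ℤ} (hy : 1 ≤ y) (hyN : y ≤ N)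
    (hδ : δ = 1 ∨ δ = -1) {c : ℤ} (hc : w c = δ * y) (hP : ¬ Right N k ε w y) :
    ∃ t, y ≤ t ∧ t ≤ N ∧ (∀ z, y < z → z ≤ t → Right N k ε w z) ∧ ¬ Right N k ε w (t + 1) ∧
      moveUp N k ε w c = δ * t := by
  obtain ⟨t, h1, h2, h3, h4⟩ := exists_run_end (P := Right N k ε w) (fun x hx => hx.2.1) (y + 1)
  refine ⟨t, by omega, by omega, fun z h5 h6 => h2 z (by omega) h6, h3, ?_⟩
  exact moveUp_apply_of_not_right hε hw hδ hy (by omega) hP (fun z h5 h6 => h2 z (by omega) h6) h3 hc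

theorem right_one_end (hε : ε = 1 ∨ ε = -1) (hw : w ∈ B N) (hδ : δ = 1 ∨ δ = -1) {c : ℤ}
    (hc : w c = δ) (hP : Right N k ε w 1) :
    ∃ t : ℤ, 1 ≤ t ∧ t ≤ N ∧ (∀ z, 1 ≤ z → z ≤ t → Right N k ε w z) ∧ ¬ Right N k ε w (t + 1) ∧
      moveUp N k ε w c = δ * -t := by
  obtain ⟨t, h1, h2, h3, h4⟩ := exists_run_end (P := Right N k ε w) (fun x hx => hx.2.1) 1
  have h5 : 1 ≤ t := by
    by_contra h
    have : t + 1 = 1 := by omega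
    rw [this] at h3
    exact h3 hP
  exact ⟨t, h5, h4 (by have := hP.2.1; omega), h2, h3, moveUp_apply_one hε hw hδ h5 h2 h3 hc⟩

/-- In the normal form a positive row ≢ N is followed by the other row of its pair. -/
theorem run_end_parity (hε : ε = 1 ∨ ε = -1) (hw : w ∈ B N) (hk : k % 2 = N % 2)
    (hW : IsW N (PairRows N k ε w)) {t : ℤ} (ht : Right N k ε w t)
    (ht' : ¬ Right N k ε w (t + 1)) : t % 2 = (N : ℤ) % 2 := by
  by_contra h
  exact ht' (Pattern.IsW.pos_of_ne (pattern_of_mem hε hw hk) hW ht h)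

/-- The effect of `moveUp` on the pairs of columns. -/
theorem moveUp_apply_pair (hε : ε = 1 ∨ ε = -1) (hw : w ∈ B N) (hk : k % 2 = N % 2)
    (hW : IsW N (PairRows N k ε w)) {c : ℕ} (hc : IsPairCol N k c) :
    (1 < ε * w (pairLo ε c) ∧ ε * moveUp N k ε w (pairLo ε c) = ε * w (pairLo ε c) - 1 ∧
      ε * moveUp N k ε w (pairHi ε c) = ε * w (pairLo ε c)) ∨
    (∃ t, ε * w (pairLo ε c) = 1 ∧ 1 ≤ t ∧ t % 2 = (N : ℤ) % 2 ∧
      (∀ x, 1 < x → x ≤ t → Right N k ε w x) ∧ ε * moveUp N k ε w (pairLo ε c) = -t ∧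
      ε * moveUp N k ε w (pairHi ε c) = 1) ∨
    (∃ t, ε * w (pairLo ε c) < 0 ∧ -(ε * w (pairLo ε c)) ≤ t ∧ t % 2 = (N : ℤ) % 2 ∧
      (∀ x, -(ε * w (pairLo ε c)) < x → x ≤ t → Right N k ε w x) ∧
      ε * moveUp N k ε w (pairLo ε c) = -t ∧
      ε * moveUp N k ε w (pairHi ε c) = ε * w (pairLo ε c) + 1) := by
  have hpat := pattern_of_mem hε hw hk
  have hT : PairRows N k ε w _ _ := ⟨c, hc, rfl, rfl⟩
  obtain ⟨hr1, hr2, hr3, hr4⟩ := pairCol_range hc ε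
  set a := ε * w (pairLo ε c) with ha
  set b := ε * w (pairHi ε c) with hb
  have ha' : w (pairLo ε c) = ε * a := (apply_eq_of_mul_eq hε).1 ha.symm
  have hb' : w (pairHi ε c) = ε * b := (apply_eq_of_mul_eq hε).1 hb.symm
  have ha'' : w (pairLo ε c) = -ε * -a := by rw [ha']; ring
  have hb'' : w (pairHi ε c) = -ε * -b := by rw [hb']; ring
  have hrange := hpat.range _ _ hT
  obtain ⟨hab, hpa, hpa'⟩ := hW a b hT
  rcases lt_or_gt_of_ne hrange.2.2.2.2.1 with h0 | h0
  · right; right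
    have hMa := hpat.neg_left hT h0
    have hMb := hpat.neg_right hT (by omega)
    have hna : ¬ Right N k ε w (-a) := fun h => hpat.disj _ h hMa
    have hnb : ¬ Right N k ε w (-b) := fun h => hpat.disj _ h hMb
    obtain ⟨t, ht1, ht2, ht3, ht4, ht5⟩ :=
      not_right_end hε hw (by omega) (by omega) (show -ε = 1 ∨ -ε = -1 by omega) ha'' hna
    obtain ⟨q, hq1, hq2, hq3, hq4, hq5⟩ :=
      not_right_end hε hw (by omega) (by omega) (show -ε = 1 ∨ -ε = -1 by omega) hb'' hnb
    have hq : q = -b := by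
      by_contra hq
      exact hna (hq3 _ (by omega) (by omega))
    have htN : t % 2 = (N : ℤ) % 2 := by
      rcases eq_or_lt_of_le ht1 with e | e
      · omega
      · exact run_end_parity hε hw hk hW (ht3 t e le_rfl) ht4
    refine ⟨t, h0, ht1, htN, ht3, ?_, ?_⟩
    · rw [apply_eq_of_mul_eq hε, ht5]
      ring
    · rw [apply_eq_of_mul_eq hε, hq5, hq, ← hab]
      ring
  · have hPa := hpat.pos_left hT h0
    have hPb := hpat.pos_right hT (by omega)
    have e2 := moveUp_apply_of_right hε hw hε hPb (by omega) hb'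
    by_cases ha1 : a = 1
    · right; left
      have ha3 : w (pairLo ε c) = ε := by rw [ha', ha1, mul_one]
      obtain ⟨t, ht1, ht2, ht3, ht4, ht5⟩ := right_one_end hε hw hε ha3 (ha1 ▸ hPa)
      refine ⟨t, ha1, ht1, run_end_parity hε hw hk hW (ht3 t ht1 le_rfl) ht4,
        fun x hx hxt => ht3 x (by omega) hxt, ?_, ?_⟩
      · rw [apply_eq_of_mul_eq hε, ht5]
      · rw [apply_eq_of_mul_eq hε, e2, hab, ha1]
        ring
    · left
      refine ⟨by omega, ?_, ?_⟩
      · rw [apply_eq_of_mul_eq hε]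
        exact moveUp_apply_of_right hε hw hε hPa ha1 ha'
      · rw [apply_eq_of_mul_eq hε, e2, hab]
        ring

theorem right_moveUp (hε : ε = 1 ∨ ε = -1) (hw : w ∈ B N) {x : ℤ} (hx1 : 1 ≤ x)
    (hx : Right N k ε w (x + 1)) : Right N k ε (moveUp N k ε w) x := by
  obtain ⟨c, hkc, hcN, hc⟩ := hx.exists_column hε hw
  have h1 := moveUp_apply_of_right hε hw hε hx (by omega) hc
  rw [add_sub_cancel_right] at h1
  exact right_of_apply hkc hx1 (by have := hx.2.1; omega) h1

theorem of_right_moveUp (hε : ε = 1 ∨ ε = -1) (hw : w ∈ B N) {x : ℤ}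
    (hx : Right N k ε (moveUp N k ε w) x) : Right N k ε w (x + 1) := by
  have hx1 := hx.1
  obtain ⟨c, hkc, hcN, hc⟩ := hx.exists_column hε (moveUp_mem hw)
  obtain ⟨δ, y, hδ, hy1, hyN, hy⟩ := exists_sign_mul hw (by omega) hcN
  have hiff := right_iff_of_apply (k := k) hε hw hδ (by omega) hy1 hyN hy
  by_cases hP : Right N k ε w y
  · have hδε := (hiff.1 hP).2
    by_cases hy0 : y = 1
    · obtain ⟨t, ht1, -, -, -, ht⟩ := right_one_end hε hw hδ (by rw [hy, hy0, mul_one]) (hy0 ▸ hP)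
      rw [hc, hδε] at ht
      rcases hε with rfl | rfl <;> omega
    · rw [moveUp_apply_of_right hε hw hδ hP hy0 hy, hδε] at hc
      have : x + 1 = y := by rcases hε with rfl | rfl <;> omega
      exact this ▸ hP
  · have hδε : δ ≠ ε := fun e => hP (hiff.2 ⟨hkc, e⟩)
    obtain ⟨t, ht1, -, -, -, ht⟩ := not_right_end hε hw hy1 hyN hδ hy hP
    rw [hc] at ht
    rcases hε with rfl | rfl <;> rcases hδ with rfl | rfl <;> omega

theorem isU_moveUp (hε : ε = 1 ∨ ε = -1) (hw : w ∈ B N) (hk : k % 2 = N % 2)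
    (hW : IsW N (PairRows N k ε w)) :
    IsU N (Right N k ε (moveUp N k ε w)) (PairRows N k ε (moveUp N k ε w)) := by
  rintro a b ⟨c, hc, rfl, rfl⟩
  have h0 := hW _ _ ⟨c, hc, rfl, rfl⟩
  rcases moveUp_apply_pair hε hw hk hW hc with ⟨h1, h2, h3⟩ | ⟨t, h1, h2, h3, h4, h5, h6⟩ |
    ⟨t, h1, h2, h3, h4, h5, h6⟩
  · omega
  · refine ⟨by omega, by omega, Or.inr ⟨by omega, by omega, by omega, fun x hx hx1 hx2 => ?_⟩⟩
    exact right_moveUp hε hw (by omega) (h4 _ (by omega) (by omega))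
  · refine ⟨by omega, by omega, Or.inr ⟨by omega, by omega, by omega, fun x hx hx1 hx2 => ?_⟩⟩
    exact right_moveUp hε hw (by omega) (h4 _ (by omega) (by omega))

/-- In the normal form positive runs consist of whole pairs, hence have even length. -/
theorem moveUp_parity_left (hε : ε = 1 ∨ ε = -1) (hw : w ∈ B N) (hk : k % 2 = N % 2) (hkN : k ≤ N)
    (hW : IsW N (PairRows N k ε w)) {c : ℤ} (hc : 1 ≤ c) (hck : c ≤ k) :
    moveUp N k ε w c % 2 = w c % 2 := by
  have hpat := pattern_of_mem hε hw hk
  obtain ⟨δ, y, hδ, hy1, hyN, hy⟩ := exists_sign_mul hw (c := c) (by omega) (by omega)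
  have hP : ¬ Right N k ε w y := by
    rw [right_iff_of_apply (k := k) hε hw hδ (by omega) hy1 hyN hy]
    omega
  obtain ⟨t, ht1, ht2, ht3, ht4, ht⟩ := not_right_end hε hw hy1 hyN hδ hy hP
  have key : t % 2 = y % 2 := by
    rcases eq_or_lt_of_le ht1 with rfl | hlt
    · rfl
    have h1 := run_end_parity hε hw hk hW (ht3 t hlt le_rfl) ht4
    by_contra h2
    have := Pattern.IsW.pos_of_eq hpat hW (ht3 (y + 1) (by omega) (by omega)) (by omega)
    rw [add_sub_cancel_right] at this
    exact hP this
  rw [ht, hy]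
  rcases hδ with rfl | rfl <;> omega

theorem moveUp_bottom (hε : ε = 1 ∨ ε = -1) (hw : w ∈ B N) :
    ¬ Right N k ε (moveUp N k ε w) N := fun h => by
  have := (of_right_moveUp hε hw h).2.1
  omega

theorem right_drop_succ (hε : ε = 1 ∨ ε = -1) (hw : w ∈ B N) (hN : ¬ Right N k ε w N) {x : ℤ}
    (hx : 1 ≤ x) : Right N k ε (drop N k ε w) (x + 1) ↔ Right N k ε w x := by
  have hm := moveDown_mem hε hw hN
  rw [← add_sub_cancel_right x 1, ← right_moveDown_succ hε hw hN, add_sub_cancel_right]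
  by_cases hF : Flips N k ε w
  · have hd : drop N k ε w = s 0 * moveDown N k ε w := by
      ext c
      exact drop_apply_of_flips hε hw hN hF c
    have e : (drop N k ε w)⁻¹ (ε * (x + 1)) = (moveDown N k ε w)⁻¹ (ε * (x + 1)) := by
      rw [hd, mul_inv_rev, s_inv, Equiv.Perm.mul_apply, s_zero_apply]
      rcases hε with rfl | rfl <;> rw [if_neg (by omega), if_neg (by omega)]
    rw [Right, Right, e]
  · have hd : drop N k ε w = moveDown N k ε w := by
      ext c
      exact drop_apply_of_not_flips hε hw hN hF c
    rw [hd]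

/-- The only delicate column is the one whose sign was changed in row 1: the new entry starts a
positive block there, and the upward move of a block from row 1 restores the sign and sends the
entry back below the block. No condition on the pairs enters. -/
theorem moveUp_drop (hε : ε = 1 ∨ ε = -1) (hw : w ∈ B N) (hN : ¬ Right N k ε w N) :
    moveUp N k ε (drop N k ε w) = w := by
  have hd := drop_mem hε hw hN
  have hm := moveDown_mem hε hw hN
  refine B_ext (moveUp_mem hd) hw fun c hc1 hcN => ?_
  obtain ⟨δ, y, hδ, hy1, hyN, hy⟩ := exists_sign_mul hw hc1 hcN
  have hiff := right_iff_of_apply (k := k) hε hw hδ (by omega) hy1 hyN hy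
  by_cases hP : Right N k ε w y
  · have h1 := moveDown_apply_of_right hε hw hδ hP hy
    have h2 : drop N k ε w c = δ * (y + 1) := by
      by_cases hF : Flips N k ε w
      · rw [drop_apply_of_flips hε hw hN hF, h1, s_zero_apply]
        rcases hδ with rfl | rfl <;> rw [if_neg (by omega), if_neg (by omega)]
      · rw [drop_apply_of_not_flips hε hw hN hF, h1]
    have h3 := (right_drop_succ hε hw hN hy1).2 hP
    rw [moveUp_apply_of_right hε hd hδ h3 (by omega) h2, hy, add_sub_cancel_right]
  · obtain ⟨r, hr1, hr2, hr3, hr4, hr⟩ := not_right_start hε hw hy1 hδ hy hP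
    have h2 : ¬ Right N k ε (drop N k ε w) (y + 1) := fun h =>
      hP ((right_drop_succ hε hw hN hy1).1 h)
    have h3 : ∀ z, r < z → z ≤ y → Right N k ε (drop N k ε w) z := by
      intro z hz hzy
      rw [← sub_add_cancel z 1, right_drop_succ hε hw hN (by omega)]
      exact hr3 _ (by omega) (by omega)
    -- `drop` can differ from the downward move only by the sign change in row 1.
    by_cases h4 : drop N k ε w c = δ * r
    · rw [moveUp_apply_of_not_right hε hd hδ hr1 hr2 ?_ h3 h2 h4, hy]
      rw [right_iff_of_apply (k := k) hε hd hδ (by omega) hr1 (by omega) h4, ← hiff]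
      exact hP
    · have hF : Flips N k ε w := by
        by_contra hF
        exact h4 (by rw [drop_apply_of_not_flips hε hw hN hF, hr])
      have h5 : drop N k ε w c = s 0 (δ * r) := by
        rw [drop_apply_of_flips hε hw hN hF, hr]
      have hr0 : r = 1 := by
        rw [s_zero_apply] at h5
        by_contra hr0
        rw [if_neg (by rcases hδ with rfl | rfl <;> omega),
          if_neg (by rcases hδ with rfl | rfl <;> omega)] at h5
        exact h4 h5
      have h6 : drop N k ε w c = -δ := by
        rw [h5, hr0, s_zero_apply]
        rcases hδ with rfl | rfl <;> norm_num
      have h7 : (k : ℤ) < c ∧ δ = -ε := by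
        rw [← right_iff_of_apply (N := N) (w := moveDown N k ε w) (y := 1) (by omega) hm hδ
          (by omega) le_rfl (by omega) (by rw [hr, hr0])]
        exact hF.1
      have h8 : drop N k ε w c = ε := by omega
      have h9 : Right N k ε (drop N k ε w) 1 :=
        right_of_apply h7.1 le_rfl (by omega) (by rw [h8, mul_one])
      rw [moveUp_apply_one hε hd hε hy1 ?_ h2 h8, hy, h7.2]
      · ring
      · intro z hz hzy
        rcases eq_or_lt_of_le hz with rfl | hz
        · exact h9
        · exact h3 z (by omega) hzy

/-- Here the normal form is needed so that the sign change occurs exactly when it should. A positive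
row 1 is followed by a positive row 2, which moves up and down without creating a second negative
row at the top; a negative row 1 is followed by a negative row 2, which prevents a flip. -/
theorem drop_moveUp (hε : ε = 1 ∨ ε = -1) (hw : w ∈ B N) (hk : k % 2 = N % 2)
    (hW : IsW N (PairRows N k ε w)) : drop N k ε (moveUp N k ε w) = w := by
  have hpat := pattern_of_mem hε hw hk
  have hu := moveUp_mem (k := k) (ε := ε) hw
  have hN := moveUp_bottom (k := k) hε hw
  have hm := moveDown_mem hε hu hN
  have key : ∀ c δ y : ℤ, (δ = 1 ∨ δ = -1) → 1 ≤ c → c ≤ N → 1 ≤ y → y ≤ N → w c = δ * y →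
      ¬ (y = 1 ∧ Right N k ε w 1) → moveDown N k ε (moveUp N k ε w) c = δ * y := by
    intro c δ y hδ hc1 hcN hy1 hyN hy h1
    have hiff := right_iff_of_apply (k := k) hε hw hδ (by omega) hy1 hyN hy
    by_cases hP : Right N k ε w y
    · have hy0 : y ≠ 1 := fun e => h1 ⟨e, e ▸ hP⟩
      have h2 := moveUp_apply_of_right hε hw hδ hP hy0 hy
      have h3 : Right N k ε (moveUp N k ε w) (y - 1) :=
        right_moveUp hε hw (by omega) (by rwa [sub_add_cancel])
      rw [moveDown_apply_of_right hε hu hδ h3 h2, sub_add_cancel]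
    · obtain ⟨t, ht1, htN, ht3, ht4, ht⟩ := not_right_end hε hw hy1 hyN hδ hy hP
      refine moveDown_apply_of_not_right hε hu hδ hy1 ht1 (fun h => ht4 (of_right_moveUp hε hw h))
        (fun z h2 h3 => right_moveUp hε hw (by omega) (ht3 _ (by omega) (by omega)))
        (fun h => ?_) ht
      have := of_right_moveUp hε hw h
      rw [sub_add_cancel] at this
      exact hP this
  by_cases hP1 : Right N k ε w 1
  · have hP2 : Right N k ε w 2 := by
      by_cases h : (1 : ℤ) % 2 = (N : ℤ) % 2
      · exact absurd (Pattern.IsW.pos_of_eq hpat hW hP1 h).1 (by norm_num)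
      · exact Pattern.IsW.pos_of_ne hpat hW hP1 h
    obtain ⟨d, hkd, hdN, hd⟩ := hP1.exists_column hε hw
    rw [mul_one] at hd
    have hd1 : moveDown N k ε (moveUp N k ε w) d = -ε := by
      obtain ⟨t, ht1, htN, ht3, ht4, ht⟩ := right_one_end hε hw hε hd hP1
      rw [← mul_one (-ε)]
      refine moveDown_apply_of_not_right (y := t) hε hu (by omega) le_rfl ht1
        (fun h => ht4 (of_right_moveUp hε hw h))
        (fun z h2 h3 => right_moveUp hε hw (by omega) (ht3 _ (by omega) (by omega)))
        (fun h => by simpa using h.1) (by rw [ht]; ring)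
    have hF : Flips N k ε (moveUp N k ε w) := by
      refine ⟨right_of_apply hkd le_rfl (by omega) (by rw [hd1, mul_one]), fun h => ?_⟩
      obtain ⟨d', hkd', hdN', hd'⟩ := hP2.exists_column hε hw
      have h3 := key d' ε 2 hε (by omega) hdN' (by omega) hP2.2.1 hd' (by norm_num)
      exact (right_of_apply (N := N) hkd' (by omega) hP2.2.1 h3).not_neg hm h
    refine B_ext (drop_mem hε hu hN) hw fun c hc1 hcN => ?_
    rw [drop_apply_of_flips hε hu hN hF]
    obtain ⟨δ, y, hδ, hy1, hyN, hy⟩ := exists_sign_mul hw hc1 hcN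
    by_cases hy0 : y = 1
    · have h4 : w c = ε ∨ w c = w (-d) := by
        rw [B_neg hw, hd, hy, hy0]
        rcases hε with rfl | rfl <;> omega
      have h5 : c = d := by
        rcases h4 with h4 | h4
        · exact w.injective (h4.trans hd.symm)
        · have := w.injective h4
          omega
      rw [h5, hd1, hd, s_zero_apply]
      rcases hε with rfl | rfl <;> norm_num
    · rw [key c δ y hδ hc1 hcN hy1 hyN hy (fun h => hy0 h.1), hy, s_zero_apply]
      rcases hδ with rfl | rfl <;> rw [if_neg (by omega), if_neg (by omega)]
  · have heq : moveDown N k ε (moveUp N k ε w) = w := by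
      refine B_ext hm hw fun c hc1 hcN => ?_
      obtain ⟨δ, y, hδ, hy1, hyN, hy⟩ := exists_sign_mul hw hc1 hcN
      rw [key c δ y hδ hc1 hcN hy1 hyN hy (fun h => hP1 h.2), hy]
    have hF : ¬ Flips N k ε (moveUp N k ε w) := by
      rintro ⟨h1, h2⟩
      rw [heq] at h1 h2
      obtain ⟨h0, a, b, hab, hc⟩ := (hpat.neg_iff 1).1 h1
      have h3 := hW a b hab
      have h4 := hpat.range a b hab
      have h5 := hpat.neg_left hab (by omega)
      rw [show -a = 2 by omega] at h5
      exact h2 h5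
    ext c
    rw [drop_apply_of_not_flips hε hu hN hF, heq]

end SignedPerm

/-! ### The statistic `L` and the sign under block moves -/

namespace SignedPerm

/-- Twice the statistic `L`. -/
noncomputable def twiceL (n : ℕ) (w : Equiv.Perm ℤ) : ℤ :=
  (invSet n w (fun a b => a % 2 ≠ b % 2)).card

theorem L_eq (n : ℕ) (w : Equiv.Perm ℤ) : L n w = 1 / 2 * (twiceL n w : ℚ) := by
  have h : ∀ p : ℤ × ℤ, (p.1 < p.2 ∧ w p.2 < w p.1 ∧ ¬ p.1 ≡ p.2 [ZMOD 2]) ↔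
      (p.1 < p.2 ∧ w p.2 < w p.1 ∧ p.1 % 2 ≠ p.2 % 2) := fun p => Iff.rfl
  rw [L, twiceL, invSet]
  simp only [h]
  norm_cast

/-- The sign ε records whether the exchange removes an inversion (ε = 1) or creates one (ε = -1);
the mirror image accounts for the factor 2. -/
theorem twiceL_s_mul {n i : ℕ} {w : Equiv.Perm ℤ} (hw : w ∈ B n) (hi : 1 ≤ i) (hin : i < n)
    {ε : ℤ} (hε : ε = 1 ∨ ε = -1) (h : ε * w⁻¹ (i + 1) < ε * w⁻¹ i) :
    twiceL n (s i * w) =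
      twiceL n w - 2 * ε * if w⁻¹ i % 2 ≠ w⁻¹ (i + 1) % 2 then 1 else 0 := by
  have hQ : ∀ a b : ℤ, a % 2 ≠ b % 2 ↔ -b % 2 ≠ -a % 2 := by omega
  rcases hε with rfl | rfl
  · have e : s i * (s i * w) = w := by rw [← mul_assoc, s_mul_self, one_mul]
    have h1 := card_invSet_s_mul (mul_mem (s_mem_B hin) hw) hi hin _ hQ
      (p := w⁻¹ (i + 1)) (q := w⁻¹ i) (by simp [s_apply (show i ≠ 0 by omega)])
      (by simp [s_apply (show i ≠ 0 by omega)]) (by omega)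
    rw [e] at h1
    rw [twiceL, twiceL, h1]
    push_cast
    split_ifs <;> omega
  · have h1 := card_invSet_s_mul hw hi hin _ hQ
      (p := w⁻¹ i) (q := w⁻¹ (i + 1)) (by simp) (by simp) (by omega)
    rw [twiceL, twiceL, h1]
    push_cast
    split_ifs <;> omega

theorem ascProd_inv_apply_of_fix {r t : ℕ} {x : ℤ} (hr : 1 ≤ r) (hrt : r ≤ t + 1)
    (hx : 0 ≤ x) (h : x < r ∨ t + 1 < x) : (ascProd r t)⁻¹ x = x := by
  rw [Equiv.Perm.inv_eq_iff_eq, ascProd_apply hr hrt]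
  split_ifs <;> omega

/-- Row t+1 passes the rows t, …, r one at a time, and each passage affects only the inversion
between those two rows. -/
theorem twiceL_ascProd_mul {n r t : ℕ} {w : Equiv.Perm ℤ} (hw : w ∈ B n) (hr : 1 ≤ r)
    (hrt : r ≤ t + 1) (htn : t < n) {ε : ℤ} (hε : ε = 1 ∨ ε = -1)
    (h : ∀ x ∈ Finset.Icc r t, ε * w⁻¹ (t + 1 : ℕ) < ε * w⁻¹ (x : ℕ)) :
    twiceL n (ascProd r t * w) = twiceL n w - 2 * ε * ∑ x ∈ Finset.Icc r t,
      if w⁻¹ (x : ℕ) % 2 ≠ w⁻¹ (t + 1 : ℕ) % 2 then 1 else 0 := by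
  obtain ⟨d, hd⟩ : ∃ d, t + 1 = r + d := ⟨t + 1 - r, by omega⟩
  induction d generalizing r with
  | zero =>
    rw [ascProd_of_lt (by omega), one_mul, Finset.Icc_eq_empty (by omega)]
    simp
  | succ d ih =>
    rw [ascProd_cons (by omega), mul_assoc]
    have hmem : ascProd (r + 1) t * w ∈ B n := mul_mem (ascProd_mem_B htn) hw
    have e1 : (ascProd (r + 1) t * w)⁻¹ r = w⁻¹ r := by
      rw [mul_inv_rev, Equiv.Perm.mul_apply, ascProd_inv_apply_of_fix (by omega) (by omega)
        (by omega) (by push_cast; omega)]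
    have e2 : (ascProd (r + 1) t * w)⁻¹ (r + 1) = w⁻¹ (t + 1 : ℕ) := by
      rw [mul_inv_rev, Equiv.Perm.mul_apply]
      congr 1
      rw [Equiv.Perm.inv_eq_iff_eq, ascProd_apply (by omega) (by omega)]
      push_cast
      split_ifs <;> omega
    rw [twiceL_s_mul hmem hr (by omega) hε, e1, e2, ih (by omega) (by omega) ?_ (by omega),
      ← Finset.insert_Icc_succ_left_eq_Icc (show r ≤ t by omega), Finset.sum_insert (by simp)]
    · simp only [Order.succ_eq_add_one]
      ring
    · intro x hx
      rw [Finset.mem_Icc] at hx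
      exact h x (Finset.mem_Icc.2 (by omega))
    · rw [e1, e2]
      exact h r (Finset.mem_Icc.2 (by omega))

/-- The intervals `b` and `b'` of rows are disjoint and not adjacent. -/
def Separated (b b' : ℕ × ℕ) : Prop := b.2 + 1 < b'.1 ∨ b'.2 + 1 < b.1

/-- The factors of separated blocks do not change the columns of each other's rows, so every
contribution may be computed in the original w. -/
theorem twiceL_foldl {n : ℕ} {ε : ℤ} (hε : ε = 1 ∨ ε = -1) (l : List (ℕ × ℕ))
    (hl : l.Pairwise Separated) {w : Equiv.Perm ℤ} (hw : w ∈ B n)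
    (h : ∀ b ∈ l, 1 ≤ b.1 ∧ b.1 ≤ b.2 ∧ b.2 < n ∧
      ∀ x ∈ Finset.Icc b.1 b.2, ε * w⁻¹ (b.2 + 1 : ℕ) < ε * w⁻¹ (x : ℕ)) :
    twiceL n (l.foldl (fun x b => ascProd b.1 b.2 * x) w) = twiceL n w -
      2 * ε * (l.map fun b => ∑ x ∈ Finset.Icc b.1 b.2,
        if w⁻¹ (x : ℕ) % 2 ≠ w⁻¹ (b.2 + 1 : ℕ) % 2 then (1 : ℤ) else 0).sum := by
  induction l generalizing w with
  | nil => simp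
  | cons b l ih =>
    obtain ⟨hb, hl⟩ := List.pairwise_cons.1 hl
    obtain ⟨h1, h2, h3, h4⟩ := h b (by simp)
    have e : ∀ b' ∈ l, ∀ x : ℕ, b'.1 ≤ x → x ≤ b'.2 + 1 →
        (ascProd b.1 b.2 * w)⁻¹ (x : ℕ) = w⁻¹ (x : ℕ) := by
      intro b' hb' x hx hx'
      have hs := hb b' hb'
      have hbb := h b' (by simp [hb'])
      rw [Separated] at hs
      rw [mul_inv_rev, Equiv.Perm.mul_apply, ascProd_inv_apply_of_fix h1 (by omega) (by omega)
        (by omega)]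
    rw [List.foldl_cons, ih hl (mul_mem (ascProd_mem_B h3) hw), twiceL_ascProd_mul hw h1
      (by omega) h3 hε h4, List.map_cons, List.sum_cons]
    · have : (l.map fun b' => ∑ x ∈ Finset.Icc b'.1 b'.2,
          if (ascProd b.1 b.2 * w)⁻¹ (x : ℕ) % 2 ≠ (ascProd b.1 b.2 * w)⁻¹ (b'.2 + 1 : ℕ) % 2
            then (1 : ℤ) else 0) = l.map fun b => ∑ x ∈ Finset.Icc b.1 b.2,
          if w⁻¹ (x : ℕ) % 2 ≠ w⁻¹ (b.2 + 1 : ℕ) % 2 then (1 : ℤ) else 0 := by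
        refine List.map_congr_left fun b' hb' => Finset.sum_congr rfl fun x hx => ?_
        rw [Finset.mem_Icc] at hx
        have := h b' (by simp [hb'])
        rw [e b' hb' x hx.1 (by omega), e b' hb' (b'.2 + 1) (by omega) le_rfl]
      rw [this]
      ring
    · intro b' hb'
      obtain ⟨h1', h2', h3', h4'⟩ := h b' (by simp [hb'])
      refine ⟨h1', h2', h3', fun x hx => ?_⟩
      have hx' := Finset.mem_Icc.1 hx
      rw [e b' hb' x hx'.1 (by omega), e b' hb' (b'.2 + 1) (by omega) le_rfl]
      exact h4' x hx

theorem sgn_foldl {n : ℕ} (l : List (ℕ × ℕ)) {w : Equiv.Perm ℤ} (hw : w ∈ B n)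
    (h : ∀ b ∈ l, b.2 < n) : sgn n (l.foldl (fun x b => ascProd b.1 b.2 * x) w) =
      (-1) ^ (l.map fun b => ∑ _x ∈ Finset.Icc b.1 b.2, 1).sum * sgn n w := by
  induction l generalizing w with
  | nil => simp
  | cons b l ih =>
    have hb := h b (by simp)
    rw [List.foldl_cons, ih (mul_mem (ascProd_mem_B hb) hw) fun b' hb' => h b' (by simp [hb']),
      sgn_mul (ascProd_mem_B hb) hw, sgn_ascProd hb, List.map_cons, List.sum_cons, pow_add]
    rw [Finset.sum_const, Nat.card_Icc]
    simp only [smul_eq_mul, mul_one]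
    ring

variable {N k : ℕ} {ε δ : ℤ} {w : Equiv.Perm ℤ}

theorem pairwise_signBlocks (hε : ε = 1 ∨ ε = -1) (hw : w ∈ B N) :
    (signBlocks N k ε w).Pairwise Separated := by
  refine List.Pairwise.imp_of_mem ?_ (nodup_signBlocks (N := N) (k := k) (ε := ε) (w := w))
  intro b b' hb hb' hne
  have h := (isSignBlock_iff hε hw).1 (mem_signBlocks.1 hb)
  have h' := (isSignBlock_iff hε hw).1 (mem_signBlocks.1 hb')
  have := h.separated h' fun e => hne (Prod.ext (by omega) (by omega))
  rw [Separated]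
  omega

open Classical in
theorem sum_signBlocks {A : Type*} [AddCommMonoid A] (hε : ε = 1 ∨ ε = -1) (hw : w ∈ B N)
    (f : ℕ → A) : ((signBlocks N k ε w).map fun b => ∑ x ∈ Finset.Icc b.1 b.2, f x).sum =
      ∑ x ∈ (Finset.Icc 1 N).filter (fun x : ℕ => Right N k ε w x), f x := by
  rw [← List.sum_toFinset _ nodup_signBlocks, ← Finset.sum_biUnion]
  · refine Finset.sum_congr ?_ fun _ _ => rfl
    ext x
    simp only [Finset.mem_biUnion, List.mem_toFinset, Finset.mem_Icc, Finset.mem_filter]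
    constructor
    · rintro ⟨b, hb, hbx⟩
      have h := (isSignBlock_iff hε hw).1 (mem_signBlocks.1 hb)
      have hx := h.2.1 x (by omega) (by omega)
      have h1 := hx.1
      have h2 := hx.2.1
      exact ⟨by omega, hx⟩
    · rintro ⟨-, hx⟩
      obtain ⟨r, t, hrt, hrx, hxt⟩ := exists_run (fun x hx => hx.1)
        (fun (x : ℤ) (hx : Right N k ε w x) => hx.2.1) hx
      have hr1 := (hrt.2.1 r le_rfl hrt.1).1
      lift r to ℕ using by omega
      lift t to ℕ using by omega
      exact ⟨(r, t), mem_signBlocks.2 ((isSignBlock_iff hε hw).2 hrt), by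
        dsimp only
        omega⟩
  · intro b hb b' hb' hne
    rw [Finset.mem_coe, List.mem_toFinset] at hb hb'
    have h := (isSignBlock_iff hε hw).1 (mem_signBlocks.1 hb)
    have h' := (isSignBlock_iff hε hw).1 (mem_signBlocks.1 hb')
    have := h.separated h' fun e => hne (Prod.ext (by omega) (by omega))
    rw [Function.onFun, Finset.disjoint_left]
    intro x hx hx'
    rw [Finset.mem_Icc] at hx hx'
    omega

theorem sum_Icc_pairs {f g : ℕ → ℤ} (m r : ℕ)
    (h : ∀ i < m, f (r + 2 * i) + f (r + 2 * i + 1) = g (r + 2 * i) + g (r + 2 * i + 1)) :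
    ∑ x ∈ Finset.Ico r (r + 2 * m), f x = ∑ x ∈ Finset.Ico r (r + 2 * m), g x := by
  induction m with
  | zero => simp
  | succ m ih =>
    rw [show r + 2 * (m + 1) = r + 2 * m + 1 + 1 by ring,
      Finset.sum_Ico_succ_top (by omega), Finset.sum_Ico_succ_top (by omega),
      Finset.sum_Ico_succ_top (by omega), Finset.sum_Ico_succ_top (by omega),
      ih fun i hi => h i (by omega)]
    have := h m (by omega)
    omega

end SignedPerm

/-! ### Counting positive pairs; the effect of `drop` on sign and `L` -/

namespace SignedPerm

variable {N k : ℕ} {ε δ : ℤ} {w : Equiv.Perm ℤ}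

instance : DecidablePred (IsPairCol N k) := fun c => by
  unfold IsPairCol
  infer_instance

/-- The first columns of the pairs. -/
def pairCols (N k : ℕ) : Finset ℕ := (Finset.range N).filter (IsPairCol N k)

theorem mem_pairCols {c : ℕ} : c ∈ pairCols N k ↔ IsPairCol N k c := by
  rw [pairCols, Finset.mem_filter, Finset.mem_range]
  exact ⟨fun h => h.2, fun h => ⟨by have := h.2.1; omega, h⟩⟩

theorem card_pairCols (hk : k % 2 = N % 2) (hkN : k ≤ N) : 2 * (pairCols N k).card = N - k := by
  have h : pairCols N k = (Finset.range ((N - k) / 2)).image (fun i => k + 1 + 2 * i) := by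
    ext c
    rw [mem_pairCols, Finset.mem_image, IsPairCol]
    constructor
    · rintro ⟨h1, h2, h3⟩
      exact ⟨(c - k - 1) / 2, Finset.mem_range.2 (by omega), by omega⟩
    · rintro ⟨i, hi, rfl⟩
      rw [Finset.mem_range] at hi
      omega
  rw [h, Finset.card_image_of_injective _ fun i j hij => by
    have h : k + 1 + 2 * i = k + 1 + 2 * j := hij
    omega,
    Finset.card_range]
  omega

/-- The number of pairs whose upper row is positive. -/
def posPairs (N k : ℕ) (ε : ℤ) (w : Equiv.Perm ℤ) : ℕ :=
  ((pairCols N k).filter fun c => 0 < ε * w (pairHi ε c)).card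

open Classical in
theorem card_filter_right (hε : ε = 1 ∨ ε = -1) (hw : w ∈ B N) (hk : k % 2 = N % 2)
    (d : ℕ → ℕ) (hd : ∀ c, d c = c ∨ d c = c + 1) (p : ℕ → Prop)
    [DecidablePred p] (hp : ∀ c, IsPairCol N k c → ∀ x : ℕ, ε * w (d c) = x → p x)
    (hp' : ∀ x : ℕ, Right N k ε w x → p x → ∃ c, IsPairCol N k c ∧ ε * w (d c) = x) :
    ((Finset.Icc 1 N).filter fun x : ℕ => Right N k ε w x ∧ p x).card =
      ((pairCols N k).filter fun c => 0 < ε * w (d c)).card := by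
  symm
  refine Finset.card_bij (fun c _ => (ε * w (d c)).toNat) ?_ ?_ ?_
  · intro c hc
    rw [Finset.mem_filter, mem_pairCols] at hc
    obtain ⟨hc, h0⟩ := hc
    have hdc := hd c
    obtain ⟨h1, h2, h3⟩ := hc
    have hr := mul_range hε hw (c := d c) (by omega) (by omega)
    have e : (((ε * w (d c)).toNat : ℕ) : ℤ) = ε * w (d c) := by omega
    rw [Finset.mem_filter, Finset.mem_Icc, e]
    refine ⟨by omega, ?_, hp c ⟨h1, h2, h3⟩ _ e.symm⟩
    exact right_of_apply (c := d c) (by omega) (by omega) hr.2.1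
      ((apply_eq_of_mul_eq hε).1 rfl)
  · intro c hc c' hc' h
    rw [Finset.mem_filter, mem_pairCols] at hc hc'
    have := pairRows_cancel hε (show ε * w (d c) = ε * w (d c') by omega)
    have h1 := hd c
    have h2 := hd c'
    obtain ⟨⟨-, -, h3⟩, -⟩ := hc
    obtain ⟨⟨-, -, h4⟩, -⟩ := hc'
    omega
  · intro x hx
    rw [Finset.mem_filter, Finset.mem_Icc] at hx
    obtain ⟨c, hc, h⟩ := hp' x hx.2.1 hx.2.2
    refine ⟨c, ?_, by omega⟩
    rw [Finset.mem_filter, mem_pairCols]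
    exact ⟨hc, by omega⟩

-- The positive rows ≢ N are the second members b > 0 of the pairs; in the lemma after this one, the
-- positive rows ≡ N are the first members a > 0.
open Classical in
theorem card_right_upper (hε : ε = 1 ∨ ε = -1) (hw : w ∈ B N) (hk : k % 2 = N % 2)
    (hU : IsU N (Right N k ε w) (PairRows N k ε w)) :
    ((Finset.Icc 1 N).filter fun x : ℕ => Right N k ε w x ∧ x % 2 ≠ N % 2).card =
      posPairs N k ε w := by
  refine card_filter_right hε hw hk (pairHi ε) (fun c => ?_) (fun x => x % 2 ≠ N % 2)
    (fun c hc x hx => ?_)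
    (fun x hx hxN => ?_)
  · have := pair_cases ε c
    omega
  · have := hU _ _ ⟨c, hc, rfl, hx⟩
    omega
  · obtain ⟨-, a, b, hab, h⟩ := ((pattern_of_mem hε hw hk).pos_iff x).1 hx
    have := hU a b hab
    obtain ⟨c, hc, rfl, rfl⟩ := hab
    exact ⟨c, hc, by omega⟩

open Classical in
theorem card_right_lower (hε : ε = 1 ∨ ε = -1) (hw : w ∈ B N) (hk : k % 2 = N % 2)
    (hU : IsU N (Right N k ε w) (PairRows N k ε w)) :
    ((Finset.Icc 1 N).filter fun x : ℕ => Right N k ε w x ∧ ¬ x % 2 ≠ N % 2).card =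
      ((pairCols N k).filter fun c => 0 < ε * w (pairLo ε c)).card := by
  refine card_filter_right hε hw hk (pairLo ε) (fun c => ?_) (fun x => ¬ x % 2 ≠ N % 2)
    (fun c hc x hx => ?_)
    (fun x hx hxN => ?_)
  · have := pair_cases ε c
    omega
  · have := hU _ _ ⟨c, hc, hx, rfl⟩
    omega
  · obtain ⟨-, a, b, hab, h⟩ := ((pattern_of_mem hε hw hk).pos_iff x).1 hx
    have := hU a b hab
    obtain ⟨c, hc, rfl, rfl⟩ := hab
    exact ⟨c, hc, by omega⟩

/-- The upper row of some pair is `1`, and its lower row is negative. -/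
def HasTop (N k : ℕ) (ε : ℤ) (w : Equiv.Perm ℤ) : Prop := ∃ a, PairRows N k ε w a 1 ∧ a < 0

-- A pair with b > 0 and a < 0 has b = 1, so there is at most one.
open Classical in
theorem posPairs_eq (hε : ε = 1 ∨ ε = -1) (hw : w ∈ B N) (hk : k % 2 = N % 2)
    (hU : IsU N (Right N k ε w) (PairRows N k ε w)) :
    posPairs N k ε w = ((pairCols N k).filter fun c => 0 < ε * w (pairLo ε c)).card +
      if HasTop N k ε w then 1 else 0 := by
  have hpat := pattern_of_mem hε hw hk
  have h1 : (pairCols N k).filter (fun c => 0 < ε * w (pairHi ε c)) =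
      (pairCols N k).filter (fun c => 0 < ε * w (pairLo ε c)) ∪
      (pairCols N k).filter (fun c => ε * w (pairLo ε c) < 0 ∧ ε * w (pairHi ε c) = 1) := by
    rw [← Finset.filter_or]
    refine Finset.filter_congr fun c hc => ?_
    rw [mem_pairCols] at hc
    have h2 := hU _ _ ⟨c, hc, rfl, rfl⟩
    omega
  rw [posPairs, h1, Finset.card_union_of_disjoint]
  · congr 1
    split_ifs with h
    · obtain ⟨a, ⟨c, hc, rfl, h2⟩, h3⟩ := h
      rw [Finset.card_eq_one]
      refine ⟨c, ?_⟩
      ext c'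
      rw [Finset.mem_filter, mem_pairCols, Finset.mem_singleton]
      constructor
      · rintro ⟨hc', h4, h5⟩
        have := pairRows_cancel hε (h2.trans h5.symm)
        have h6 := pair_cases ε c
        have h7 := pair_cases ε c'
        omega
      · rintro rfl
        exact ⟨hc, h3, h2⟩
    · rw [Finset.card_eq_zero, Finset.filter_eq_empty_iff]
      rintro c hc ⟨h2, h3⟩
      exact h ⟨_, ⟨c, mem_pairCols.1 hc, rfl, h3⟩, h2⟩
  · rw [Finset.disjoint_filter]
    intro c _ h2 h3
    omega

theorem signBlock_bounds (hε : ε = 1 ∨ ε = -1) (hw : w ∈ B N) (hN : ¬ Right N k ε w N)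
    {b : ℕ × ℕ} (hb : b ∈ signBlocks N k ε w) : IsRun (Right N k ε w) b.1 b.2 ∧ 1 ≤ b.1 ∧
      b.1 ≤ b.2 ∧ b.2 < N := by
  have h := (isSignBlock_iff hε hw).1 (mem_signBlocks.1 hb)
  have h1 := h.2.1 b.2 h.1 le_rfl
  have h2 := h.1
  have h3 := (h.2.1 b.1 le_rfl h.1).1
  have h4 := h1.2.1
  have h5 : (b.2 : ℤ) ≠ N := fun e => hN (e ▸ h1)
  exact ⟨h, by omega, by omega, by omega⟩

theorem mul_inv_apply_of_right (hε : ε = 1 ∨ ε = -1) (hw : w ∈ B N) {c x : ℤ}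
    (h : ε * w c = x) : ε * w⁻¹ x = c := by
  have h1 := (apply_eq_of_mul_eq hε).1 h
  rcases hε with rfl | rfl
  · rw [one_mul, ← h, one_mul]
    simp
  · rw [neg_one_mul, ← B_neg (inv_mem hw), ← neg_one_mul, ← h1]
    simp

theorem inv_parity (hε : ε = 1 ∨ ε = -1) (hw : w ∈ B N) {c x : ℤ} (h : ε * w c = x) :
    w⁻¹ x % 2 = c % 2 := by
  have := mul_inv_apply_of_right hε hw h
  rcases hε with rfl | rfl <;> omega

-- When a row jumps over the rows of a positive pair, exactly one of the two columns has the parity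
-- opposite to its own. So each such pair changes 2L by 2, whatever the parity of the jumping row's
-- column.
open Classical in
theorem twiceL_moveDown (hε : ε = 1 ∨ ε = -1) (hw : w ∈ B N) (hk : k % 2 = N % 2)
    (hU : IsU N (Right N k ε w) (PairRows N k ε w)) :
    twiceL N (moveDown N k ε w) = twiceL N w - 2 * ε * posPairs N k ε w := by
  have hpat := pattern_of_mem hε hw hk
  have hN := uncanceled_bottom hε hw hk hU
  rw [moveDown, twiceL_foldl hε _ (pairwise_signBlocks hε hw) hw]
  · congr 2
    rw [← card_right_upper hε hw hk hU, Finset.card_filter, Nat.cast_sum]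
    rw [show (∑ x ∈ Finset.Icc 1 N,
        ((if Right N k ε w x ∧ x % 2 ≠ N % 2 then 1 else 0 : ℕ) : ℤ)) =
        ∑ x ∈ (Finset.Icc 1 N).filter (fun x : ℕ => Right N k ε w x),
          if x % 2 ≠ N % 2 then (1 : ℤ) else 0 by
      rw [Finset.sum_filter]
      refine Finset.sum_congr rfl fun x _ => ?_
      by_cases h1 : Right N k ε w x <;> simp [h1]]
    rw [← sum_signBlocks hε hw]
    congr 1
    refine List.map_congr_left fun b hb => ?_
    obtain ⟨hrun, hb1, hb2, hb3⟩ := signBlock_bounds hε hw hN hb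
    obtain ⟨r, t⟩ := b
    dsimp only at hrun hb1 hb2 hb3 ⊢
    have ht := Pattern.IsU.run_end hpat hU (hrun.2.1 t hrun.1 le_rfl) hrun.2.2.2
    -- From a row r' ≡ N to its end the run splits into pairs of adjacent rows. On each of them both
    -- indicators add up to 1, which replaces the column parities by row parities.
    have key : ∀ r' : ℕ, r ≤ r' → r' ≤ t → r' % 2 = N % 2 →
        ∑ x ∈ Finset.Icc r' t, (if w⁻¹ (x : ℕ) % 2 ≠ w⁻¹ (t + 1 : ℕ) % 2 then (1 : ℤ) else 0) =
        ∑ x ∈ Finset.Icc r' t, (if x % 2 ≠ N % 2 then (1 : ℤ) else 0) := by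
      intro r' hr' hr't hr'N
      have e : Finset.Icc r' t = Finset.Ico r' (r' + 2 * ((t + 1 - r') / 2)) := by
        ext x
        rw [Finset.mem_Icc, Finset.mem_Ico]
        omega
      rw [e]
      refine sum_Icc_pairs _ _ fun i hi => ?_
      have hT := (Pattern.IsU.pos_of_eq hpat hU
        (hrun.2.1 (r' + 2 * i : ℕ) (by push_cast; omega) (by push_cast; omega))
        (by push_cast; omega)).1
      obtain ⟨c, hc, h1, h2⟩ := hT
      have h3 := inv_parity hε hw h1
      have h4 := inv_parity hε hw h2
      have h5 := pair_cases ε c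
      rw [show ((r' + 2 * i + 1 : ℕ) : ℤ) = (r' + 2 * i : ℕ) + 1 by push_cast; ring]
      split_ifs <;> omega
    by_cases hr : r % 2 = N % 2
    · exact key r le_rfl hb2 hr
    · rcases Pattern.IsU.pos_of_ne hpat hU (hrun.2.1 r le_rfl hrun.1) (by omega) with
        h1 | ⟨h1, a, hT, ha, hpa, hMa, hPa⟩
      · exact absurd h1.2 hrun.2.2.1
      -- The run starts with row 1 of the mixed pair. The row below the run is then the other row of
      -- this pair, in a neighbouring column, so row 1 contributes 1 to both sums.
      · have hr1 : r = 1 := by omega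
        have hat : -a = t + 1 := by
          have e1 : ¬ (r ≤ -a ∧ -a ≤ t) := fun e => hpat.disj _ (hrun.2.1 _ e.1 e.2) hMa
          have e2 : ¬ ((t : ℤ) + 1 < -a) := fun e => hrun.2.2.2 (hPa _ (by omega) e)
          omega
        rw [← Finset.insert_Icc_succ_left_eq_Icc hb2, Finset.sum_insert (by simp),
          Finset.sum_insert (by simp)]
        congr 1
        · obtain ⟨c, hc, h2, h3⟩ := hT
          have h4 := inv_parity hε hw h3
          have h5 : w⁻¹ (t + 1 : ℕ) % 2 = (pairLo ε c : ℤ) % 2 := by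
            have h6 := inv_parity (ε := -ε) (c := pairLo ε c) (x := (t + 1 : ℕ)) (by omega) hw
              (by rw [neg_mul, h2]; push_cast; omega)
            exact h6
          have h7 := pair_cases ε c
          rw [h5, h1, h4, if_pos (by omega), if_pos (by omega)]
        · by_cases h2 : r + 1 ≤ t
          · exact key (r + 1) (by omega) h2 (by omega)
          · rw [Finset.Icc_eq_empty (by simpa using h2)]
            simp
  · intro b hb
    obtain ⟨hrun, hb1, hb2, hb3⟩ := signBlock_bounds hε hw hN hb
    refine ⟨hb1, hb2, hb3, fun x hx => ?_⟩
    rw [Finset.mem_Icc] at hx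
    have hx1 := (hrun.2.1 x (by omega) (by omega)).2.2
    have hx2 : ¬ (k : ℤ) < w⁻¹ (ε * (b.2 + 1 : ℕ)) := fun h =>
      hrun.2.2.2 ⟨by omega, by omega, by exact_mod_cast h⟩
    rcases hε with rfl | rfl
    · rw [one_mul] at *
      omega
    · rw [neg_one_mul, B_neg (inv_mem hw)] at hx1 hx2
      omega

-- The number of generators used is the number of positive rows: two for each pair with a > 0, and
-- one more for a mixed pair.
open Classical in
theorem sgn_moveDown (hε : ε = 1 ∨ ε = -1) (hw : w ∈ B N) (hk : k % 2 = N % 2)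
    (hU : IsU N (Right N k ε w) (PairRows N k ε w)) :
    sgn N (moveDown N k ε w) = (if HasTop N k ε w then -1 else 1) * sgn N w := by
  have hN := uncanceled_bottom hε hw hk hU
  rw [moveDown, sgn_foldl _ hw fun b hb => (signBlock_bounds hε hw hN hb).2.2.2,
    sum_signBlocks hε hw, ← Finset.card_eq_sum_ones,
    ← Finset.card_filter_add_card_filter_not (p := fun x : ℕ => x % 2 ≠ N % 2),
    Finset.filter_filter, Finset.filter_filter, card_right_upper hε hw hk hU,
    card_right_lower hε hw hk hU, posPairs_eq hε hw hk hU]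
  congr 1
  split_ifs
  · rw [add_right_comm, pow_add, Even.neg_one_pow ⟨_, rfl⟩]
    norm_num
  · rw [add_zero, Even.neg_one_pow ⟨_, rfl⟩]

/-- A right entry that becomes positive in row 1 after the sign change can only come from a pair
with b = 1; conversely, the shape of the result in `drop_apply_pair` for b = 1 requires the sign
change. -/
theorem flips_iff_hasTop (hε : ε = 1 ∨ ε = -1) (hw : w ∈ B N) (hk : k % 2 = N % 2)
    (hU : IsU N (Right N k ε w) (PairRows N k ε w)) : Flips N k ε w ↔ HasTop N k ε w := by
  have hpat := pattern_of_mem hε hw hk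
  have hN := uncanceled_bottom hε hw hk hU
  have hm := moveDown_mem hε hw hN
  constructor
  · intro hF
    obtain ⟨d, hkd, hdN, hd⟩ := hF.1.exists_column (by omega) hm
    have hd' : ε * drop N k ε w d = 1 := by
      rw [drop_apply_of_flips hε hw hN hF, hd, s_zero_apply]
      rcases hε with rfl | rfl <;> norm_num
    obtain ⟨c, hc, rfl | rfl⟩ := exists_pairCol hk hkd hdN ε
    · have h1 := drop_apply_pair hε hw hk hU hc
      have h2 := hU _ _ ⟨c, hc, rfl, rfl⟩
      have h3 := (pattern_of_mem hε hw hk).range _ _ ⟨c, hc, rfl, rfl⟩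
      have h4 : ε * w (pairHi ε c) = 1 := by omega
      refine ⟨_, ⟨c, hc, rfl, h4⟩, by omega⟩
    · have h1 := drop_apply_pair hε hw hk hU hc
      omega
  · rintro ⟨a, hT, ha⟩
    by_contra hF
    have hMa := hpat.neg_left hT ha
    have hna : ¬ Right N k ε w (-a) := fun h => hpat.disj _ h hMa
    obtain ⟨c, hc, h2, h3⟩ := hT
    have h1 := drop_apply_pair hε hw hk hU hc
    rw [drop_apply_of_not_flips hε hw hN hF, h3] at h1
    obtain ⟨r, hr1, hr2, -, -, hr⟩ := not_right_start (c := pairLo ε c) hε hw (by omega)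
      (show -ε = 1 ∨ -ε = -1 by omega) (by rw [(apply_eq_of_mul_eq hε).1 h2]; ring) hna
    rw [hr] at h1
    rcases hε with rfl | rfl <;> omega

theorem hasTop_even (hU : IsU N (Right N k ε w) (PairRows N k ε w)) (h : HasTop N k ε w) :
    N % 2 = 0 := by
  obtain ⟨a, hT, ha⟩ := h
  have := hU _ _ hT
  omega

theorem drop_eq_s_mul (hε : ε = 1 ∨ ε = -1) (hw : w ∈ B N) (hN : ¬ Right N k ε w N)
    (hF : Flips N k ε w) : drop N k ε w = s 0 * moveDown N k ε w := by
  ext c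
  exact drop_apply_of_flips hε hw hN hF c

theorem drop_eq_moveDown (hε : ε = 1 ∨ ε = -1) (hw : w ∈ B N) (hN : ¬ Right N k ε w N)
    (hF : ¬ Flips N k ε w) : drop N k ε w = moveDown N k ε w := by
  ext c
  exact drop_apply_of_not_flips hε hw hN hF c

theorem sgn_drop (hε : ε = 1 ∨ ε = -1) (hw : w ∈ B N) (hk : k % 2 = N % 2)
    (hU : IsU N (Right N k ε w) (PairRows N k ε w)) : sgn N (drop N k ε w) = sgn N w := by
  have hN := uncanceled_bottom hε hw hk hU
  have hm := moveDown_mem hε hw hN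
  have h1 := sgn_moveDown hε hw hk hU
  by_cases hF : Flips N k ε w
  · have hN0 : 0 < N := by
      have := hF.1.2.1
      omega
    rw [drop_eq_s_mul hε hw hN hF, sgn_mul (s_mem_B hN0) hm, sgn_s hN0, h1,
      if_pos ((flips_iff_hasTop hε hw hk hU).1 hF)]
    ring
  · rw [drop_eq_moveDown hε hw hN hF, h1, if_neg (mt (flips_iff_hasTop hε hw hk hU).2 hF), one_mul]

-- If the sign change takes place in column p, the inversion (-p, p) has equal parities and does not
-- count, while (0, p) and (-p, 0) count exactly for odd p. A mixed pair forces N to be even, so the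
-- affected column, c for ε = 1 and c+1 for ε = -1, is odd in the first case only.
open Classical in
theorem twiceL_drop (hε : ε = 1 ∨ ε = -1) (hw : w ∈ B N) (hk : k % 2 = N % 2)
    (hU : IsU N (Right N k ε w) (PairRows N k ε w)) : twiceL N (drop N k ε w) =
      twiceL N w - 2 * ε * posPairs N k ε w - if ε = 1 ∧ HasTop N k ε w then 2 else 0 := by
  have hN := uncanceled_bottom hε hw hk hU
  have hm := moveDown_mem hε hw hN
  rw [← twiceL_moveDown hε hw hk hU]
  by_cases hF : Flips N k ε w
  · have hN0 : 0 < N := by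
      have := hF.1.2.1
      omega
    have hT := (flips_iff_hasTop hε hw hk hU).1 hF
    have hev := hasTop_even hU hT
    have hQ : ∀ a b : ℤ, a % 2 ≠ b % 2 ↔ -b % 2 ≠ -a % 2 := by omega
    have hd0 := drop_eq_s_mul hε hw hN hF
    obtain ⟨a, ⟨c, hc, h2, h3⟩, ha⟩ := hT
    have hr := pairCol_range hc ε
    have h4 := drop_apply_pair hε hw hk hU hc
    have h5 : ε * drop N k ε w (pairLo ε c) = 1 := by omega
    have h6 := pair_cases ε c
    have h7 : s 0 * drop N k ε w = moveDown N k ε w := by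
      rw [hd0, ← mul_assoc, s_mul_self, one_mul]
    have h8 := hc.2.2
    rcases hε with rfl | rfl
    · have h9 := card_invSet_s_zero_mul (mul_mem (s_mem_B hN0) hm) hN0 _ hQ
        (p := pairLo 1 c) (by rw [← hd0]; simpa using h5) (by omega)
      rw [← hd0, h7] at h9
      rw [twiceL, twiceL, h9, if_neg (show ¬ -(pairLo 1 c : ℤ) % 2 ≠ (pairLo 1 c : ℤ) % 2 by omega),
        if_pos (show (0 : ℤ) % 2 ≠ (pairLo 1 c : ℤ) % 2 by omega),
        if_pos (show (1 : ℤ) = 1 ∧ HasTop N k 1 w from ⟨rfl, a, ⟨c, hc, h2, h3⟩, ha⟩)]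
      push_cast
      ring
    · have h9 := card_invSet_s_zero_mul hm hN0 _ hQ (p := pairLo (-1) c) (by
        rw [← h7, Equiv.Perm.mul_apply, show drop N k (-1) w (pairLo (-1) c) = -1 by omega,
          s_zero_apply]
        norm_num) (by omega)
      rw [← hd0] at h9
      rw [twiceL, twiceL, h9, if_neg (by omega), if_neg (by omega), if_neg (by omega)]
      push_cast
      ring
  · rw [drop_eq_moveDown hε hw hN hF,
      if_neg fun h => hF ((flips_iff_hasTop hε hw hk hU).2 h.2), sub_zero]

end SignedPerm

/-! ### The effect on `L` of deleting a row and a column -/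

namespace SignedPerm

variable {N k : ℕ} {ε δ : ℤ} {w : Equiv.Perm ℤ}

/-- The other column of the pair of a column right of `k`, extended to negative columns. -/
def partner (N k : ℕ) (a : ℤ) : ℤ :=
  if (k : ℤ) < a then (if a % 2 ≠ N % 2 then a + 1 else a - 1)
  else if a < -k then (if a % 2 ≠ N % 2 then a - 1 else a + 1) else a

theorem partner_neg (a : ℤ) : partner N k (-a) = -partner N k a := by
  rw [partner, partner]
  split_ifs <;> omega

theorem partner_range (hk : k % 2 = N % 2) {a : ℤ} (h1 : -(N : ℤ) ≤ a) (h2 : a ≤ N) :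
    -(N : ℤ) ≤ partner N k a ∧ partner N k a ≤ N ∧ partner N k (partner N k a) = a ∧
      (k < a ↔ k < partner N k a) ∧ (a < -k ↔ partner N k a < -k) ∧
      (k < a ∨ a < -k → partner N k a % 2 ≠ a % 2) := by
  rw [partner, partner]
  split_ifs <;> omega

theorem partner_of_left {a : ℤ} (h1 : -(k : ℤ) ≤ a) (h2 : a ≤ k) : partner N k a = a := by
  rw [partner, if_neg (by omega), if_neg (by omega)]

theorem exists_partner (hk : k % 2 = N % 2) {b : ℤ} (hb : k < b) (hbN : b ≤ N) :
    ∃ c, IsPairCol N k c ∧ ((b = c ∧ partner N k b = c + 1) ∨ (b = c + 1 ∧ partner N k b = c)) := by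
  obtain ⟨c, hc, h⟩ := exists_pairCol hk hb hbN 1
  have h1 := pair_cases 1 c
  obtain ⟨h2, h3, h4⟩ := hc
  refine ⟨c, ⟨h2, h3, h4⟩, ?_⟩
  rw [partner, if_pos hb]
  split_ifs <;> omega

theorem isU_one_pair (hU : IsU N (Right N k 1 w) (PairRows N k 1 w)) {c : ℕ}
    (hc : IsPairCol N k c) : w c % 2 = N % 2 ∧ w (c + 1) % 2 ≠ N % 2 ∧
      ((0 < w c ∧ w (c + 1) = w c + 1) ∨ (w c < 0 ∧ w c < w (c + 1) ∧ w (c + 1) ≤ 1 ∧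
        ∀ x, 0 < x → -w (c + 1) < x → x < -w c → Right N k 1 w x)) := by
  have h := hU _ _ ⟨c, hc, rfl, rfl⟩
  obtain ⟨h1, h2, -⟩ | ⟨-, -, h3⟩ := pair_cases 1 c
  · rw [h1, h2] at h
    simpa using h
  · omega

/-- No value of a left column lies between the two values of a pair, since the rows in between are
positive. Column 0 must be excluded: in a mixed pair the value 0 does lie in between. -/
theorem partner_lt_of_pos (hw : w ∈ B N) (hk : k % 2 = N % 2)
    (hU : IsU N (Right N k 1 w) (PairRows N k 1 w)) {a b : ℤ} (h1 : -(k : ℤ) ≤ a) (h2 : a ≤ k)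
    (h0 : a ≠ 0) (hb : k < b) (hbN : b ≤ N) : w (partner N k b) < w a ↔ w b < w a := by
  obtain ⟨c, hc, h⟩ := exists_partner hk hb hbN
  have hp := isU_one_pair hU hc
  have h3 := B_ne_zero hw h0
  have h4 : w a ≠ w c := fun e => by
    have := w.injective e
    have := hc.1
    omega
  have h5 : w a ≠ w (c + 1) := fun e => by
    have := w.injective e
    have := hc.1
    omega
  have key : w c < w a ↔ w (c + 1) < w a := by
    rcases hp with ⟨-, -, h6 | ⟨h6, h7, h8, h9⟩⟩
    · omega
    · have h10 : ¬ (w c < w a ∧ w a < w (c + 1)) := by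
        intro h11
        have h12 := (h9 (-w a) (by omega) (by omega) (by omega)).2.2
        rw [one_mul, ← B_neg hw] at h12
        rw [show w⁻¹ (w (-a)) = -a by simp] at h12
        omega
      omega
  rcases h with ⟨rfl, h⟩ | ⟨rfl, h⟩ <;> rw [h]
  · exact key.symm
  · exact key

theorem partner_lt_iff (hw : w ∈ B N) (hk : k % 2 = N % 2)
    (hU : IsU N (Right N k 1 w) (PairRows N k 1 w)) {a b : ℤ} (h1 : -(k : ℤ) ≤ a) (h2 : a ≤ k)
    (h0 : a ≠ 0) (hb : k < b ∨ b < -k) (hbN : b ≤ N) (hbN' : -(N : ℤ) ≤ b) :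
    (w (partner N k b) < w a ↔ w b < w a) ∧ (w a < w (partner N k b) ↔ w a < w b) := by
  have hne : ∀ d : ℤ, (k < d ∨ d < -k) → w a ≠ w d := fun d hd e => by
    have := w.injective e
    omega
  have hr := partner_range hk hbN' hbN
  have h3 := hne _ hb
  have h4 := hne (partner N k b) (by omega)
  rcases hb with hb | hb
  · have := partner_lt_of_pos hw hk hU h1 h2 h0 hb hbN
    omega
  · have := partner_lt_of_pos hw hk hU (a := -a) (b := -b) (by omega) (by omega) (by omega)
      (by omega) (by omega)
    rw [partner_neg, B_neg hw, B_neg hw, B_neg hw] at this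
    omega

/-- Columns renumbered so as to skip `± (k + 1)`. -/
def skip (k : ℕ) (a : ℤ) : ℤ := if (k : ℤ) < a then a + 1 else if a < -k then a - 1 else a

/-- The exceptional inversions are those with column 0 that are lost on passing to the partner. The
values of the pair must have different signs, so they are (0, c) and (-c, 0) for the first column c
of the mixed pair. -/
theorem card_filter_zero (hw : w ∈ B N) (hk : k % 2 = N % 2)
    (hU : IsU N (Right N k 1 w) (PairRows N k 1 w)) [Decidable (HasTop N k 1 w)] :
    ((invSet N w fun a b => a % 2 ≠ b % 2).filter fun p =>
      (p.1 = 0 ∧ 0 < w (partner N k p.2)) ∨ (p.2 = 0 ∧ w (partner N k p.1) < 0)).card =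
      if HasTop N k 1 w then 2 else 0 := by
  have h0 := B_zero hw
  have key : ∀ b : ℤ, 0 < b → b ≤ N → w b < 0 → b % 2 ≠ 0 → 0 < w (partner N k b) →
      ∃ c, IsPairCol N k c ∧ b = c ∧ w c < 0 ∧ w (c + 1) = 1 := by
    intro b hb hbN hwb hb2 hp
    have hkb : k < b := by
      by_contra h
      rw [partner_of_left (by omega) (by omega)] at hp
      omega
    obtain ⟨c, hc, h⟩ := exists_partner hk hkb hbN
    have h1 := isU_one_pair hU hc
    rcases h with ⟨rfl, h⟩ | ⟨rfl, h⟩ <;> rw [h] at hp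
    · exact ⟨c, hc, rfl, by omega, by omega⟩
    · omega
  have htop : ∀ c, IsPairCol N k c → w c < 0 → w (c + 1) = 1 → HasTop N k 1 w := by
    intro c hc h1 h2
    refine ⟨w c, ⟨c, hc, ?_⟩, h1⟩
    rcases pair_cases 1 c with ⟨h3, h4, -⟩ | ⟨-, -, h5⟩
    · rw [h3, h4]
      simpa using h2
    · omega
  split_ifs with hT
  · obtain ⟨a, ⟨c, hc, h1, h2⟩, ha⟩ := hT
    obtain ⟨h3, h4, -⟩ | ⟨-, -, h5⟩ := pair_cases 1 c
    swap
    · omega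
    rw [h3, one_mul] at h1
    rw [h4, one_mul] at h2
    push_cast at h2
    obtain ⟨h5, h6, h7⟩ := hc
    have hpc : partner N k c = c + 1 := by
      rw [partner, if_pos (by omega), if_pos (by omega)]
    have hp := isU_one_pair hU ⟨h5, h6, h7⟩
    rw [Finset.card_eq_two]
    refine ⟨(0, (c : ℤ)), (-(c : ℤ), 0), fun e => ?_, ?_⟩
    · have := congrArg Prod.snd e
      dsimp only at this
      omega
    · ext ⟨x, y⟩
      rw [Finset.mem_filter, mem_invSet, Finset.mem_insert, Finset.mem_singleton, Prod.mk.injEq,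
        Prod.mk.injEq]
      constructor
      · rintro ⟨⟨hx, hy, hxy, hwxy, hpar⟩, ⟨h8, h9⟩ | ⟨h8, h9⟩⟩ <;> dsimp only at h8 h9 <;>
          subst h8
        · obtain ⟨c', hc', h10, h11, h12⟩ := key y hxy hy (by omega) (by omega) h9
          have := w.injective (h12.trans h2.symm)
          omega
        · obtain ⟨c', hc', h10, h11, h12⟩ := key (-x) (by omega) (by omega)
            (by rw [B_neg hw]; omega) (by omega) (by rw [partner_neg, B_neg hw]; omega)
          have := w.injective (h12.trans h2.symm)
          omega
      · rintro (⟨rfl, rfl⟩ | ⟨rfl, rfl⟩)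
        · refine ⟨⟨by omega, by omega, by omega, by omega, by omega⟩, Or.inl ⟨rfl, ?_⟩⟩
          dsimp only
          rw [hpc]
          omega
        · refine ⟨⟨by omega, by omega, by omega, by rw [B_neg hw]; omega, by omega⟩,
            Or.inr ⟨rfl, ?_⟩⟩
          dsimp only
          rw [partner_neg, B_neg hw, hpc]
          omega
  · rw [Finset.card_eq_zero, Finset.filter_eq_empty_iff]
    rintro ⟨x, y⟩ hxy hE
    rw [mem_invSet] at hxy
    obtain ⟨hx, hy, hxy, hwxy, hpar⟩ := hxy
    rcases hE with ⟨h8, h9⟩ | ⟨h8, h9⟩ <;> dsimp only at h8 h9 <;> subst h8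
    · obtain ⟨c', hc', h10, h11, h12⟩ := key y hxy hy (by omega) (by omega) h9
      exact hT (htop c' hc' h11 h12)
    · obtain ⟨c', hc', h10, h11, h12⟩ := key (-x) (by omega) (by omega)
        (by rw [B_neg hw]; omega) (by omega) (by rw [partner_neg, B_neg hw]; omega)
      exact hT (htop c' hc' h11 h12)

/-- Exchanging partners in the pairs of columns of which only one is right of `k`. -/
def exchange (N k : ℕ) (p : ℤ × ℤ) : ℤ × ℤ :=
  (if -(k : ℤ) ≤ p.2 ∧ p.2 ≤ k then partner N k p.1 else p.1,
    if -(k : ℤ) ≤ p.1 ∧ p.1 ≤ k then partner N k p.2 else p.2)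

theorem exchange_exchange (hk : k % 2 = N % 2) {a b : ℤ} (ha : -(N : ℤ) ≤ a) (ha' : a ≤ N)
    (hb : -(N : ℤ) ≤ b) (hb' : b ≤ N) : exchange N k (exchange N k (a, b)) = (a, b) := by
  have h1 := partner_range hk ha ha'
  have h2 := partner_range hk hb hb'
  simp only [exchange]
  split_ifs <;> (rw [Prod.mk.injEq]; omega)

theorem partner_zero_sign (hw : w ∈ B N) (hk : k % 2 = N % 2)
    (hU : IsU N (Right N k 1 w) (PairRows N k 1 w)) {b : ℤ} (hb : k < b) (hbN : b ≤ N)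
    (hb2 : b % 2 = 0) (hwb : w b < 0) : w (partner N k b) < 0 := by
  obtain ⟨c, hc, h⟩ := exists_partner hk hb hbN
  have h1 := isU_one_pair hU hc
  have h2 := hc.2.2
  have h3 := B_ne_zero hw (x := c + 1) (by omega)
  have h4 := B_ne_zero hw (x := c) (by have := hc.1; omega)
  rcases h with ⟨rfl, h⟩ | ⟨rfl, h⟩ <;> rw [h] <;> omega

/-- Renumbering the columns reverses the comparison of parities exactly when one of the two columns
has absolute value at most k and the other does not. In that case passing to the partner reverses it
again. -/
theorem exchange_cases (hk : k % 2 = N % 2) {a b : ℤ} (ha : -(N : ℤ) ≤ a) (hb : b ≤ N)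
    (hab : a < b) :
    (exchange N k (a, b) = (a, b) ∧ (skip k a % 2 ≠ skip k b % 2 ↔ a % 2 ≠ b % 2) ∧
      ((-(k : ℤ) ≤ a ∧ b ≤ k) ∨ (a < -k ∨ k < a) ∧ (b < -k ∨ k < b))) ∨
    (exchange N k (a, b) = (a, partner N k b) ∧ -(k : ℤ) ≤ a ∧ a ≤ k ∧ k < b ∧
      (skip k a % 2 ≠ skip k b % 2 ↔ a % 2 ≠ partner N k b % 2) ∧
      (a % 2 ≠ b % 2 ↔ skip k a % 2 ≠ skip k (partner N k b) % 2) ∧ skip k a = a ∧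
      skip k b = b + 1) ∨
    (exchange N k (a, b) = (partner N k a, b) ∧ -(k : ℤ) ≤ b ∧ b ≤ k ∧ a < -k ∧
      (skip k a % 2 ≠ skip k b % 2 ↔ partner N k a % 2 ≠ b % 2) ∧
      (a % 2 ≠ b % 2 ↔ skip k (partner N k a) % 2 ≠ skip k b % 2) ∧ skip k b = b ∧
      skip k a = a - 1) := by
  have h1 := partner_range hk ha (by omega)
  have h2 := partner_range hk (a := b) (by omega) hb
  have h3 : ∀ x, -(k : ℤ) ≤ x → x ≤ k → partner N k x = x := fun x => partner_of_left
  by_cases ha' : -(k : ℤ) ≤ a ∧ a ≤ k <;> by_cases hb' : -(k : ℤ) ≤ b ∧ b ≤ k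
  · left
    rw [exchange, if_pos ha', if_pos hb', h3 a ha'.1 ha'.2, h3 b hb'.1 hb'.2]
    simp only [skip]
    refine ⟨trivial, ?_, ?_⟩
    · split_ifs <;> omega
    · omega
  · right; left
    rw [exchange, if_pos ha', if_neg hb']
    simp only [skip]
    refine ⟨trivial, ha'.1, ha'.2, by omega, ?_⟩
    split_ifs <;> omega
  · right; right
    rw [exchange, if_neg ha', if_pos hb']
    simp only [skip]
    refine ⟨trivial, hb'.1, hb'.2, by omega, ?_⟩
    split_ifs <;> omega
  · left
    rw [exchange, if_neg ha', if_neg hb']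
    simp only [skip]
    refine ⟨trivial, ?_, ?_⟩
    · split_ifs <;> omega
    · omega

/-- `exchange` is an involution that turns renumbered parities into ordinary ones and keeps
inversions, by `partner_lt_iff`. With column 0, partners keep negative values negative on even
columns b > k, which covers one direction; in the other direction the exceptional inversions have to
be removed. -/
theorem card_exchange (hw : w ∈ B N) (hk : k % 2 = N % 2)
    (hU : IsU N (Right N k 1 w) (PairRows N k 1 w)) :
    (invSet N w fun a b => skip k a % 2 ≠ skip k b % 2).card =
    ((invSet N w fun a b => a % 2 ≠ b % 2).filter fun p =>
      ¬ ((p.1 = 0 ∧ 0 < w (partner N k p.2)) ∨ (p.2 = 0 ∧ w (partner N k p.1) < 0))).card := by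
  have h0 := B_zero hw
  refine Finset.card_nbij' (exchange N k) (exchange N k) ?_ ?_ ?_ ?_
  · rintro ⟨a, b⟩ hab
    rw [Finset.mem_coe, mem_invSet] at hab
    obtain ⟨h1, h2, h3, h4, h5⟩ := hab
    have h0' : ∀ x, x ≠ 0 → w x ≠ 0 := fun x => B_ne_zero hw
    have ha := partner_range hk (a := a) (by omega) (by omega)
    have hb := partner_range hk (a := b) (by omega) (by omega)
    rw [Finset.mem_coe, Finset.mem_filter]
    rcases exchange_cases hk h1 h2 h3 with ⟨e, h6, h7⟩ | ⟨e, h6, h7, h8, h9, -, h10, h11⟩ |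
      ⟨e, h6, h7, h8, h9, -, h10, h11⟩
    · rw [e, mem_invSet]
      refine ⟨⟨h1, h2, h3, h4, h6.1 h5⟩, ?_⟩
      rintro (⟨rfl, h8⟩ | ⟨rfl, h8⟩) <;> dsimp only at h8 h7 <;>
        rw [partner_of_left (by omega) (by omega)] at h8 <;> omega
    · rw [e, mem_invSet]
      have h12 : w (partner N k b) < w a := by
        by_cases ha0 : a = 0
        · subst ha0
          rw [h0] at h4 ⊢
          exact partner_zero_sign hw hk hU h8 h2 (by omega) h4
        · exact (partner_lt_iff hw hk hU h6 h7 ha0 (Or.inl h8) h2 (by omega)).1.2 h4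
      refine ⟨⟨h1, hb.2.1, by omega, h12, h9.1 h5⟩, ?_⟩
      dsimp only
      rw [hb.2.2.1]
      rintro (⟨rfl, h13⟩ | ⟨h13, -⟩) <;> omega
    · rw [e, mem_invSet]
      have h12 : w b < w (partner N k a) := by
        by_cases hb0 : b = 0
        · subst hb0
          rw [h0] at h4 ⊢
          have := partner_zero_sign hw hk hU (b := -a) (by omega) (by omega) (by omega)
            (by rw [B_neg hw]; omega)
          rw [partner_neg, B_neg hw] at this
          omega
        · exact (partner_lt_iff hw hk hU h6 h7 hb0 (Or.inr h8) (by omega) h1).2.2 h4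
      refine ⟨⟨ha.1, h2, by omega, h12, h9.1 h5⟩, ?_⟩
      dsimp only
      rw [ha.2.2.1]
      rintro (⟨h13, -⟩ | ⟨rfl, h13⟩) <;> omega
  · rintro ⟨a, b⟩ hab
    rw [Finset.mem_coe, Finset.mem_filter, mem_invSet] at hab
    obtain ⟨⟨h1, h2, h3, h4, h5⟩, hE⟩ := hab
    dsimp only at hE
    have h0' : ∀ x, x ≠ 0 → w x ≠ 0 := fun x => B_ne_zero hw
    have ha := partner_range hk (a := a) (by omega) (by omega)
    have hb := partner_range hk (a := b) (by omega) (by omega)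
    rw [Finset.mem_coe]
    rcases exchange_cases hk h1 h2 h3 with ⟨e, h6, -⟩ | ⟨e, h6, h7, h8, -, h9, -⟩ |
      ⟨e, h6, h7, h8, -, h9, -⟩
    · rw [e, mem_invSet]
      exact ⟨h1, h2, h3, h4, h6.2 h5⟩
    · rw [e, mem_invSet]
      have h12 : w (partner N k b) < w a := by
        by_cases ha0 : a = 0
        · subst ha0
          have := h0' (partner N k b) (by omega)
          omega
        · exact (partner_lt_iff hw hk hU h6 h7 ha0 (Or.inl h8) h2 (by omega)).1.2 h4
      exact ⟨h1, hb.2.1, by omega, h12, h9.1 h5⟩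
    · rw [e, mem_invSet]
      have h12 : w b < w (partner N k a) := by
        by_cases hb0 : b = 0
        · subst hb0
          have := h0' (partner N k a) (by omega)
          omega
        · exact (partner_lt_iff hw hk hU h6 h7 hb0 (Or.inr h8) (by omega) h1).2.2 h4
      exact ⟨ha.1, h2, by omega, h12, h9.1 h5⟩
  · rintro ⟨a, b⟩ hab
    rw [Finset.mem_coe, mem_invSet] at hab
    exact exchange_exchange hk (by omega) (by omega) (by omega) (by omega)
  · rintro ⟨a, b⟩ hab
    rw [Finset.mem_coe, Finset.mem_filter, mem_invSet] at hab
    exact exchange_exchange hk (by omega) (by omega) (by omega) (by omega)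

theorem skip_lt_iff {a b : ℤ} : skip k a < skip k b ↔ a < b := by
  rw [skip, skip]
  split_ifs <;> omega

theorem mul_ascProd_apply {n j : ℕ} (hj : 1 ≤ j) (hjn : j ≤ n) {a : ℤ}
    (ha : -(n : ℤ) < a) (ha' : a < n) : (w * ascProd j (n - 1)) a = w (skip (j - 1) a) := by
  rw [Equiv.Perm.mul_apply, ascProd_apply hj (by omega), skip]
  congr 1
  split_ifs <;> omega

/-- The value n in column j is the largest, so it forms inversions exactly with the columns right of
j. Half of these n-j columns have the opposite parity, and the mirror images double the number. -/
theorem card_filter_column {n j : ℕ} (hw : w ∈ B n) (hj : 1 ≤ j) (hjn : j ≤ n)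
    (hjn' : j % 2 = n % 2) (hwj : w j = n) :
    (((invSet n w fun a b => a % 2 ≠ b % 2).filter fun p =>
      p.1 = (j : ℤ) ∨ p.1 = -(j : ℤ) ∨ p.2 = (j : ℤ) ∨ p.2 = -(j : ℤ)).card) = n - j := by
  have hne : ∀ x : ℤ, -(n : ℤ) ≤ x → x ≤ n → x ≠ j → w x < n := by
    intro x h1 h2 h3
    have h4 := B_range hw h1 h2
    have h5 : w x ≠ n := fun e => h3 (w.injective (e.trans hwj.symm))
    omega
  have hwj' : w (-j) = -n := by rw [B_neg hw, hwj]
  have hne' : ∀ x : ℤ, -(n : ℤ) ≤ x → x ≤ n → x ≠ -j → -(n : ℤ) < w x := by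
    intro x h1 h2 h3
    have h4 := hne (-x) (by omega) (by omega) (by omega)
    rw [B_neg hw] at h4
    omega
  have h : ((invSet n w fun a b => a % 2 ≠ b % 2).filter fun p =>
      p.1 = (j : ℤ) ∨ p.1 = -(j : ℤ) ∨ p.2 = (j : ℤ) ∨ p.2 = -(j : ℤ)) =
      (pairCols n j).image (fun c : ℕ => ((j : ℤ), (c : ℤ))) ∪
      (pairCols n j).image (fun c : ℕ => (-(c : ℤ), -(j : ℤ))) := by
    ext ⟨a, b⟩
    rw [Finset.mem_filter, mem_invSet, Finset.mem_union, Finset.mem_image, Finset.mem_image]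
    constructor
    · rintro ⟨⟨h1, h2, h3, h4, h5⟩, h6⟩
      dsimp only at h6
      by_cases ha : a = j
      · subst ha
        refine Or.inl ⟨b.toNat, ?_, by rw [Prod.mk.injEq]; omega⟩
        rw [mem_pairCols, IsPairCol]
        omega
      · have h7 := hne a h1 (by omega) ha
        by_cases hb : b = -j
        · subst hb
          refine Or.inr ⟨(-a).toNat, ?_, by rw [Prod.mk.injEq]; omega⟩
          rw [mem_pairCols, IsPairCol]
          omega
        · have h8 := hne' b (by omega) h2 hb
          rcases h6 with h6 | h6 | h6 | h6
          · omega
          · rw [h6] at h4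
            omega
          · rw [h6] at h4
            omega
          · omega
    · rintro (⟨c, hc, h⟩ | ⟨c, hc, h⟩) <;> rw [Prod.mk.injEq] at h <;> obtain ⟨rfl, rfl⟩ := h <;>
        rw [mem_pairCols, IsPairCol] at hc
      · have := hne c (by omega) (by omega) (by omega)
        exact ⟨⟨by omega, by omega, by omega, by omega, by omega⟩, Or.inl rfl⟩
      · have := hne' (-c) (by omega) (by omega) (by omega)
        exact ⟨⟨by omega, by omega, by omega, by omega, by omega⟩, Or.inr (Or.inr (Or.inr rfl))⟩
  rw [h, Finset.card_union_of_disjoint, Finset.card_image_of_injective,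
    Finset.card_image_of_injective]
  · have := card_pairCols hjn' hjn
    omega
  · intro c c' e
    have := congrArg Prod.fst e
    dsimp only at this
    omega
  · intro c c' e
    have := congrArg Prod.snd e
    dsimp only at this
    omega
  · rw [Finset.disjoint_left]
    rintro ⟨a, b⟩ h1 h2
    rw [Finset.mem_image] at h1 h2
    obtain ⟨c, -, h3⟩ := h1
    obtain ⟨c', -, h4⟩ := h2
    rw [Prod.mk.injEq] at h3 h4
    omega

theorem card_filter_column_compl {n j : ℕ} (hj : 1 ≤ j) (hjn : j ≤ n) :
    (((invSet n w fun a b => a % 2 ≠ b % 2).filter fun p =>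
      ¬ (p.1 = (j : ℤ) ∨ p.1 = -(j : ℤ) ∨ p.2 = (j : ℤ) ∨ p.2 = -(j : ℤ))).card) =
    (invSet (n - 1) (w * ascProd j (n - 1)) fun a b =>
      skip (j - 1) a % 2 ≠ skip (j - 1) b % 2).card := by
  have hsk : ∀ a : ℤ, -(n : ℤ) < a → a < n → -(n : ℤ) ≤ skip (j - 1) a ∧ skip (j - 1) a ≤ n ∧
      skip (j - 1) a ≠ j ∧ skip (j - 1) a ≠ -j := by
    intro a h1 h2
    rw [skip]
    split_ifs <;> omega
  have hsk' : ∀ c : ℤ, -(n : ℤ) ≤ c → c ≤ n → c ≠ j → c ≠ -j →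
      ∃ a, -(n : ℤ) < a ∧ a < n ∧ skip (j - 1) a = c := by
    intro c h1 h2 h3 h4
    refine ⟨if (j : ℤ) < c then c - 1 else if c < -j then c + 1 else c, ?_⟩
    rw [skip]
    split_ifs <;> omega
  symm
  refine Finset.card_bij (fun p _ => (skip (j - 1) p.1, skip (j - 1) p.2)) ?_ ?_ ?_
  · rintro ⟨a, b⟩ h
    rw [mem_invSet] at h
    obtain ⟨h1, h2, h3, h4, h5⟩ := h
    rw [mul_ascProd_apply hj hjn (by omega) (by omega),
      mul_ascProd_apply hj hjn (by omega) (by omega)] at h4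
    have h6 := hsk a (by omega) (by omega)
    have h7 := hsk b (by omega) (by omega)
    rw [Finset.mem_filter, mem_invSet]
    dsimp only
    exact ⟨⟨by omega, by omega, skip_lt_iff.2 h3, h4, h5⟩, by omega⟩
  · rintro ⟨a, b⟩ - ⟨a', b'⟩ - h
    rw [Prod.mk.injEq] at h ⊢
    dsimp only at h
    have h1 := @skip_lt_iff (j - 1) a a'
    have h2 := @skip_lt_iff (j - 1) a' a
    have h3 := @skip_lt_iff (j - 1) b b'
    have h4 := @skip_lt_iff (j - 1) b' b
    omega
  · rintro ⟨a, b⟩ h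
    rw [Finset.mem_filter, mem_invSet] at h
    obtain ⟨⟨h1, h2, h3, h4, h5⟩, h6⟩ := h
    dsimp only at h6
    obtain ⟨a, ha1, ha2, rfl⟩ := hsk' a (by omega) (by omega) (by omega) (by omega)
    obtain ⟨b, hb1, hb2, rfl⟩ := hsk' b (by omega) (by omega) (by omega) (by omega)
    refine ⟨(a, b), ?_, rfl⟩
    rw [mem_invSet, mul_ascProd_apply hj hjn ha1 ha2, mul_ascProd_apply hj hjn hb1 hb2]
    exact ⟨by omega, by omega, skip_lt_iff.1 h3, h4, h5⟩

open Classical in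
/-- The effect on `L` of deleting the last row and its column. -/
theorem twiceL_eq_column {n j : ℕ} (hw : w ∈ B n) (hj : 1 ≤ j) (hjn : j ≤ n)
    (hjn' : j % 2 = n % 2) (hwj : w j = n) (hw' : w * ascProd j (n - 1) ∈ B (n - 1))
    (hU : IsU (n - 1 : ℕ) (Right (n - 1) (j - 1) 1 (w * ascProd j (n - 1)))
      (PairRows (n - 1) (j - 1) 1 (w * ascProd j (n - 1)))) :
    twiceL n w = n - j + twiceL (n - 1) (w * ascProd j (n - 1)) -
      if HasTop (n - 1) (j - 1) 1 (w * ascProd j (n - 1)) then 2 else 0 := by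
  have hk : (j - 1) % 2 = (n - 1) % 2 := by omega
  have h1 := card_filter_column hw hj hjn hjn' hwj
  have h2 := card_filter_column_compl (w := w) hj hjn
  have h3 := card_exchange hw' hk hU
  have h4 := card_filter_zero hw' hk hU
  have h5 := Finset.card_filter_add_card_filter_not (s := invSet n w fun a b => a % 2 ≠ b % 2)
    (fun p => p.1 = (j : ℤ) ∨ p.1 = -(j : ℤ) ∨ p.2 = (j : ℤ) ∨ p.2 = -(j : ℤ))
  have h6 := Finset.card_filter_add_card_filter_not
    (s := invSet (n - 1) (w * ascProd j (n - 1)) fun a b => a % 2 ≠ b % 2)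
    (fun p => (p.1 = 0 ∧ 0 < (w * ascProd j (n - 1)) (partner (n - 1) (j - 1) p.2)) ∨
      (p.2 = 0 ∧ (w * ascProd j (n - 1)) (partner (n - 1) (j - 1) p.1) < 0))
  rw [twiceL, twiceL]
  split_ifs at h4 ⊢ <;> omega

end SignedPerm

/-! ### Transfer through the normal form -/

namespace SignedPerm

variable {N k : ℕ} {ε δ : ℤ} {w : Equiv.Perm ℤ}

theorem posPairs_drop (hε : ε = 1 ∨ ε = -1) (hw : w ∈ B N) (hk : k % 2 = N % 2)
    (hU : IsU N (Right N k ε w) (PairRows N k ε w)) :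
    posPairs N k ε (drop N k ε w) = posPairs N k ε w := by
  rw [posPairs, posPairs]
  congr 1
  refine Finset.filter_congr fun c hc => ?_
  have := drop_apply_pair hε hw hk hU (mem_pairCols.1 hc)
  omega

/-- In the normal form both values of a pair have the same sign, so each pair is counted for exactly
one of the two signs. -/
theorem posPairs_add_posPairs_neg (hw : w ∈ B N) (hk : k % 2 = N % 2) (hkN : k ≤ N)
    (hW : IsW N (PairRows N k 1 w)) :
    2 * (posPairs N k 1 w + posPairs N k (-1) w) = N - k := by
  rw [← card_pairCols hk hkN, posPairs, posPairs,
    ← Finset.card_filter_add_card_filter_not (s := pairCols N k)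
      (fun c => 0 < 1 * w (pairHi 1 c))]
  congr 3
  refine Finset.filter_congr fun c hc => ?_
  rw [mem_pairCols] at hc
  have h1 := hW _ _ ⟨c, hc, rfl, rfl⟩
  obtain ⟨h2, h3, h4⟩ := hc
  have h5 := B_ne_zero hw (x := c) (by omega)
  have h6 := B_ne_zero hw (x := c + 1) (by omega)
  simp only [pairLo, pairHi] at h1 ⊢
  norm_num at h1 ⊢
  omega

/-- The common form of the lowering map after the deletion of a column (`ε = 1`) and of the raising
map before the insertion of a column (`ε = -1`). -/
def transfer (N k : ℕ) (ε : ℤ) (w : Equiv.Perm ℤ) : Equiv.Perm ℤ :=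
  moveUp N k (-ε) (drop N k ε w)

section transfer

variable (hε : ε = 1 ∨ ε = -1) (hw : w ∈ B N) (hk : k % 2 = N % 2)
  (hU : IsU N (Right N k ε w) (PairRows N k ε w))

include hε hw hk hU

theorem isW_neg_drop : IsW N (PairRows N k (-ε) (drop N k ε w)) :=
  (isW_neg hε (drop_mem hε hw (uncanceled_bottom hε hw hk hU))).2 (isW_drop hε hw hk hU)

theorem drop_transfer : drop N k (-ε) (transfer N k ε w) = drop N k ε w :=
  drop_moveUp (by omega) (drop_mem hε hw (uncanceled_bottom hε hw hk hU)) hk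
    (isW_neg_drop hε hw hk hU)

theorem transfer_mem : transfer N k ε w ∈ B N :=
  moveUp_mem (drop_mem hε hw (uncanceled_bottom hε hw hk hU))

theorem isU_transfer : IsU N (Right N k (-ε) (transfer N k ε w))
    (PairRows N k (-ε) (transfer N k ε w)) :=
  isU_moveUp (by omega) (drop_mem hε hw (uncanceled_bottom hε hw hk hU)) hk
    (isW_neg_drop hε hw hk hU)

/-- The image under `drop` with -ε is the same normal form that w has under `drop` with ε, so the
second transfer only has to undo the latter. -/
theorem transfer_transfer : transfer N k (-ε) (transfer N k ε w) = w := by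
  rw [transfer, drop_transfer hε hw hk hU, neg_neg]
  exact moveUp_drop hε hw (uncanceled_bottom hε hw hk hU)

theorem transfer_parity_left (hkN : k ≤ N) {c : ℤ} (hc : 1 ≤ c) (hck : c ≤ k) :
    transfer N k ε w c % 2 = w c % 2 := by
  rw [transfer, moveUp_parity_left (by omega)
    (drop_mem hε hw (uncanceled_bottom hε hw hk hU)) hk hkN (isW_neg_drop hε hw hk hU) hc hck]
  exact drop_parity_left hε hw hk hkN hU hc hck

/-- Both elements have the same normal form, and each `drop` preserves the order of these columns.
The proofs for the right columns and for the sign follow the same pattern. -/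
theorem transfer_lt_iff_left (hkN : k ≤ N) {c c' : ℤ} (hc : 0 ≤ c) (hck : c ≤ k) (hc' : 0 ≤ c')
    (hck' : c' ≤ k) : transfer N k ε w c < transfer N k ε w c' ↔ w c < w c' := by
  have hT := transfer_mem hε hw hk hU
  have hTN := uncanceled_bottom (ε := -ε) (by omega) hT hk (isU_transfer hε hw hk hU)
  rw [← drop_lt_iff_left hε hw (uncanceled_bottom hε hw hk hU) hkN hc hck hc' hck',
    ← drop_transfer hε hw hk hU]
  exact (drop_lt_iff_left (by omega) hT hTN hkN hc hck hc' hck').symm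

theorem transfer_lt_iff_right {c c' : ℤ} (hc : k < c) (hcN : c ≤ N) (hc' : k < c') (hcN' : c' ≤ N) :
    transfer N k ε w c < transfer N k ε w c' ↔ w c < w c' := by
  have hT := transfer_mem hε hw hk hU
  have hTN := uncanceled_bottom (ε := -ε) (by omega) hT hk (isU_transfer hε hw hk hU)
  rw [← drop_lt_iff_right hε hw (uncanceled_bottom hε hw hk hU) hc hcN hc' hcN',
    ← drop_transfer hε hw hk hU]
  exact (drop_lt_iff_right (by omega) hT hTN hc hcN hc' hcN').symm

theorem sgn_transfer : sgn N (transfer N k ε w) = sgn N w := by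
  rw [← sgn_drop (ε := -ε) (by omega) (transfer_mem hε hw hk hU) hk (isU_transfer hε hw hk hU),
    drop_transfer hε hw hk hU, sgn_drop hε hw hk hU]

end transfer

-- Comparing both elements with the common normal form, the numbers of positive pairs for the two
-- signs add up to (N-k)/2. The extra 2 for a mixed pair arises only on the side ε = 1.
open Classical in
theorem twiceL_transfer (hw : w ∈ B N) (hk : k % 2 = N % 2) (hkN : k ≤ N)
    (hU : IsU N (Right N k 1 w) (PairRows N k 1 w)) :
    twiceL N (transfer N k 1 w) = twiceL N w - (N - k) - if HasTop N k 1 w then 2 else 0 := by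
  have hε : (1 : ℤ) = 1 ∨ (1 : ℤ) = -1 := Or.inl rfl
  have hT := transfer_mem hε hw hk hU
  have hTU := isU_transfer hε hw hk hU
  have h1 := twiceL_drop hε hw hk hU
  have h2 := twiceL_drop (Or.inr rfl) hT hk hTU
  have h3 := posPairs_drop hε hw hk hU
  have h4 := posPairs_drop (Or.inr rfl) hT hk hTU
  have h5 := posPairs_add_posPairs_neg (drop_mem hε hw (uncanceled_bottom hε hw hk hU)) hk hkN
    (isW_drop hε hw hk hU)
  rw [drop_transfer hε hw hk hU] at h2 h4
  norm_num at h1 h2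
  split_ifs at h1 ⊢ <;> omega

end SignedPerm

/-! ### Translation between the seven matrix conditions and `Uncanceled` -/

namespace SignedPerm

variable {N k m : ℕ} {ε δ : ℤ} {w : Equiv.Perm ℤ}

/-- The common form of the conditions on initially (`ε = 1`, `N = m - 1`) and finally (`ε = -1`,
`N = m`) uncanceled matrices. -/
structure UncanceledMatrix (m k N : ℕ) (ε : ℤ) (w : Equiv.Perm ℤ) : Prop where
  prop1 : col w N ≤ k ∨ rowSign w N = -ε
  prop2 : ∀ r t, IsBlock m k w r t → ¬ OddRows r t
  prop3 : ∀ t ∈ Finset.Icc 1 m, rowSign w t = ε → k < col w t →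
    (∃ r q, IsSignBlock m k ε w r q ∧ EvenRows r q ∧ r ≤ t ∧ t ≤ q) ∨
      ∀ p, 1 ≤ p → p < t → k < col w p ∧ rowSign w p = ε
  prop4 : ∀ t, IsPair m k (-1) 1 w t → row w (pairHi ε t) = 1 ∧
    ∀ p, 1 ≤ p → p < row w (pairLo ε t) → rowSign w p = ε ∧ k < col w p
  prop5 : ∀ t, IsPair m k (-ε) (-ε) w t → ∀ x, RowBetween x (row w t) (row w (t + 1)) →
    rowSign w x = ε ∧ k < col w x
  prop6 : ∀ r t p q, IsBlock m k w r t → IsSignBlock m k (-ε) w p q → r ≤ p → q ≤ t →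
    (p, q) ≠ (r, t) → (OddRows p q ↔ p = r ∨ q = t)
  prop7 : ∀ r t, IsBlock m k w r t → EvenRows r t →
    (∀ q, IsSignBlock m k ε w r q → EvenRows r q → q = t) ∧
      ∀ p, IsSignBlock m k ε w p t → EvenRows p t → p = r

theorem colSign_eq_iff (hw : w ∈ B m) (hδ : δ = 1 ∨ δ = -1) {t : ℕ} (ht : 1 ≤ t) :
    colSign w t = δ ↔ 0 < δ * w t := by
  have h0 := B_ne_zero hw (x := t) (by omega)
  rw [colSign, entry, row, Int.natCast_natAbs]
  rcases abs_cases (w t) with h | h <;> rw [h.1] <;> rcases hδ with rfl | rfl <;>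
    split_ifs <;> (norm_num; omega)

theorem isPair_iff (hw : w ∈ B m) {α β : ℤ} (hα : α = 1 ∨ α = -1) (hβ : β = 1 ∨ β = -1) {t : ℕ} :
    IsPair m k α β w t ↔ IsPairCol m k t ∧ 0 < α * w t ∧ 0 < β * w (t + 1) := by
  have h : ¬ t ≡ m [MOD 2] ↔ t % 2 ≠ m % 2 := Iff.rfl
  rw [IsPair, IsPairCol, h]
  constructor
  · rintro ⟨h1, h2, h3, h4, h5⟩
    rw [colSign_eq_iff hw hα (by omega)] at h4
    rw [colSign_eq_iff hw hβ (by omega)] at h5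
    exact ⟨⟨h1, h2, h3⟩, h4, by exact_mod_cast h5⟩
  · rintro ⟨⟨h1, h2, h3⟩, h4, h5⟩
    rw [colSign_eq_iff hw hα (by omega), colSign_eq_iff hw hβ (by omega)]
    exact ⟨h1, h2, h3, h4, by exact_mod_cast h5⟩

theorem evenRows_iff {r t : ℕ} : EvenRows r t ↔ (r : ℤ) % 2 ≠ (t : ℤ) % 2 := by
  have h : EvenRows r t ↔ r % 2 ≠ t % 2 := Iff.rfl
  rw [h]
  omega

theorem oddRows_iff {r t : ℕ} : OddRows r t ↔ (r : ℤ) % 2 = (t : ℤ) % 2 := by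
  have h : OddRows r t ↔ r % 2 = t % 2 := Iff.rfl
  rw [h]
  omega

theorem UncanceledMatrix.uncanceled (hε : ε = 1 ∨ ε = -1) (hw : w ∈ B m) (hN : N ≤ m)
    (hT : ∀ a b, PairRows m k ε w a b → a < b) (h : UncanceledMatrix m k N ε w) :
    Uncanceled N (Right m k ε w) (Right m k (-ε) w) (PairRows m k ε w) := by
  have hε' : -ε = 1 ∨ -ε = -1 := by omega
  have hrun : ∀ δ : ℤ, ∀ r t, IsRun (Right m k δ w) r t → 1 ≤ r ∧ 1 ≤ t := fun δ r t h =>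
    ⟨(h.2.1 r le_rfl h.1).1, (h.2.1 t h.1 le_rfl).1⟩
  have hrun' : ∀ r t, IsRun (fun x => Right m k ε w x ∨ Right m k (-ε) w x) r t →
      1 ≤ r ∧ 1 ≤ t := fun r t h =>
    ⟨(h.2.1 r le_rfl h.1).elim And.left And.left, (h.2.1 t h.1 le_rfl).elim And.left And.left⟩
  have hin : ∀ t a b, IsPairCol m k t → a = ε * w (pairLo ε t) → b = ε * w (pairHi ε t) →
      -(m : ℤ) ≤ a ∧ a ≤ m ∧ -(m : ℤ) ≤ b ∧ b ≤ m := by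
    rintro t a b ht rfl rfl
    have h1 := pairCol_range ht ε
    have h2 := mul_range hε hw (c := pairLo ε t) (by omega) (by omega)
    have h3 := mul_range hε hw (c := pairHi ε t) (by omega) (by omega)
    omega
  refine ⟨?_, ?_, ?_, ?_, ?_, ?_, ?_⟩
  · intro hP
    exact (not_right_iff hε hw (by exact_mod_cast hP.1) hN).2 h.prop1 hP
  · intro r t hrt
    have := hrun' r t hrt
    lift r to ℕ using by omega
    lift t to ℕ using by omega
    exact fun e => h.prop2 r t ((isBlock_iff hε hw).2 hrt) (oddRows_iff.2 e)
  · intro t ht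
    have := ht.1
    have := ht.2.1
    lift t to ℕ using by omega
    have h1 := (right_iff hε hw (by omega) (by omega)).1 ht
    rcases h.prop3 t (Finset.mem_Icc.2 ⟨by omega, by omega⟩) h1.2 h1.1 with
      ⟨r, q, h2, h3, h4, h5⟩ | h2
    · exact Or.inl ⟨r, q, (isSignBlock_iff hε hw).1 h2, evenRows_iff.1 h3, by omega, by omega⟩
    · refine Or.inr fun p hp hpt => ?_
      lift p to ℕ using by omega
      exact (right_iff hε hw (by omega) (by omega)).2 (h2 p (by omega) (by omega))
  · rintro a b ⟨t, ht, ha, hb⟩ ha0 hb0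
    have h0 := hin t a b ht ha.symm hb.symm
    have h1 : IsPair m k (-1) 1 w t := by
      rw [isPair_iff hw (Or.inr rfl) (Or.inl rfl)]
      refine ⟨ht, ?_⟩
      obtain ⟨h2, h3, h4⟩ | ⟨h2, h3, h4⟩ := pair_cases ε t
      · rw [h2] at ha; rw [h3] at hb; push_cast at hb; subst h4
        omega
      · rw [h2] at ha; rw [h3] at hb; push_cast at ha
        obtain rfl : ε = -1 := by omega
        omega
    obtain ⟨h2, h3⟩ := h.prop4 t h1
    rw [row] at h2 h3
    constructor
    · rcases hε with rfl | rfl <;> omega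
    · intro p hp hpa
      lift p to ℕ using by omega
      have h4 := h3 p (by omega) (by rcases hε with rfl | rfl <;> omega)
      exact (right_iff hε hw (by omega) (by omega)).2 ⟨h4.2, h4.1⟩
  · rintro a b ⟨t, ht, ha, hb⟩ ha0 hb0 x hx1 hx2
    have h0 := hin t a b ht ha.symm hb.symm
    lift x to ℕ using by omega
    have h1 : IsPair m k (-ε) (-ε) w t ∧ RowBetween x (row w t) (row w (t + 1)) := by
      rw [isPair_iff hw hε' hε', RowBetween, row, row]
      obtain ⟨h2, h3, h4⟩ | ⟨h2, h3, h4⟩ := pair_cases ε t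
      · rw [h2] at ha; rw [h3] at hb; push_cast at hb ⊢; subst h4
        exact ⟨⟨ht, by omega⟩, by omega⟩
      · rw [h2] at ha; rw [h3] at hb; push_cast at ha ⊢
        obtain rfl : ε = -1 := by omega
        exact ⟨⟨ht, by omega⟩, by omega⟩
    have h4 := h.prop5 t h1.1 x h1.2
    exact (right_iff hε hw (by omega) (by omega)).2 ⟨h4.2, h4.1⟩
  · intro r t p q hrt hpq hrp hqt hne
    have := hrun' r t hrt
    have := hrun _ p q hpq
    lift r to ℕ using by omega
    lift t to ℕ using by omega
    lift p to ℕ using by omega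
    lift q to ℕ using by omega
    have h1 := h.prop6 r t p q ((isBlock_iff hε hw).2 hrt) ((isSignBlock_iff hε' hw).2 hpq)
      (by omega) (by omega) (by rw [Ne, Prod.mk.injEq]; omega)
    rw [oddRows_iff] at h1
    omega
  · intro r t hrt hev
    have := hrun' r t hrt
    lift r to ℕ using by omega
    lift t to ℕ using by omega
    have h1 := h.prop7 r t ((isBlock_iff hε hw).2 hrt) (evenRows_iff.2 hev)
    constructor
    · intro q hq hev'
      have := hrun _ _ q hq
      lift q to ℕ using by omega
      exact_mod_cast h1.1 q ((isSignBlock_iff hε hw).2 hq) (evenRows_iff.2 hev')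
    · intro p hp hev'
      have := hrun _ p _ hp
      lift p to ℕ using by omega
      exact_mod_cast h1.2 p ((isSignBlock_iff hε hw).2 hp) (evenRows_iff.2 hev')

theorem Uncanceled.uncanceledMatrix (hε : ε = 1 ∨ ε = -1) (hw : w ∈ B m) (hN : N ≤ m)
    (hT : ∀ a b, PairRows m k ε w a b → a < b)
    (h : Uncanceled N (Right m k ε w) (Right m k (-ε) w) (PairRows m k ε w)) :
    UncanceledMatrix m k N ε w := by
  have hε' : -ε = 1 ∨ -ε = -1 := by omega
  have hpair : ∀ t, IsPairCol m k t → PairRows m k ε w (ε * w (pairLo ε t)) (ε * w (pairHi ε t)) :=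
    fun t ht => ⟨t, ht, rfl, rfl⟩
  have hin : ∀ t, IsPairCol m k t → (w t).natAbs ≤ m ∧ (w (t + 1)).natAbs ≤ m := by
    rintro t ⟨h1, h2, h3⟩
    have h4 := B_range hw (x := t) (by omega) (by omega)
    have h5 := B_range hw (x := t + 1) (by omega) (by omega)
    omega
  refine ⟨?_, ?_, ?_, ?_, ?_, ?_, ?_⟩
  · rcases Nat.eq_zero_or_pos N with rfl | hN0
    · left
      rw [col, Nat.cast_zero, B_zero (inv_mem hw)]
      simp
    · exact (not_right_iff hε hw hN0 hN).1 h.prop1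
  · intro r t hrt e
    exact h.prop2 r t ((isBlock_iff hε hw).1 hrt) (oddRows_iff.1 e)
  · intro t ht h1 h2
    rw [Finset.mem_Icc] at ht
    rcases h.prop3 t ((right_iff hε hw ht.1 ht.2).2 ⟨h2, h1⟩) with ⟨r, q, h3, h4, h5, h6⟩ | h3
    · left
      have h7 := (h3.2.1 r le_rfl h3.1).1
      lift r to ℕ using by omega
      lift q to ℕ using by omega
      exact ⟨r, q, (isSignBlock_iff hε hw).2 h3, evenRows_iff.2 h4, by omega, by omega⟩
    · refine Or.inr fun p hp hpt => ?_
      exact (right_iff hε hw (by omega) (by omega)).1 (h3 p (by omega) (by omega))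
  · intro t ht
    rw [isPair_iff hw (Or.inr rfl) (Or.inl rfl)] at ht
    have h0 := hin t ht.1
    have h1 := h.prop4 _ _ (hpair t ht.1)
    rw [row, row]
    obtain ⟨h2, h3, h4⟩ | ⟨h2, h3, h4⟩ := pair_cases ε t
    · rw [h2, h3] at h1 ⊢
      push_cast at h1 ⊢
      subst h4
      obtain ⟨h5, h6⟩ := h1 (by omega) (by omega)
      refine ⟨by omega, fun p hp hpt => ?_⟩
      exact ((right_iff hε hw (by omega) (by omega)).1 (h6 p (by omega) (by omega))).symm
    · rw [h2, h3] at h1 ⊢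
      push_cast at h1 ⊢
      obtain rfl : ε = -1 := by omega
      obtain ⟨h5, h6⟩ := h1 (by omega) (by omega)
      refine ⟨by omega, fun p hp hpt => ?_⟩
      exact ((right_iff hε hw (by omega) (by omega)).1 (h6 p (by omega) (by omega))).symm
  · intro t ht x hx
    rw [isPair_iff hw hε' hε'] at ht
    have h0 := hin t ht.1
    have h1 := h.prop5 _ _ (hpair t ht.1)
    -- The order a < b < 0 decides which of the two rows is the minimum and which the maximum in
    -- `RowBetween`.
    have hlt := hT _ _ (hpair t ht.1)
    rw [RowBetween, row, row] at hx
    obtain ⟨h2, h3, h4⟩ | ⟨h2, h3, h4⟩ := pair_cases ε t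
    · rw [h2, h3] at h1 hlt
      push_cast at h1 hx hlt
      subst h4
      exact ((right_iff hε hw (by omega) (by omega)).1
        (h1 (by omega) (by omega) x (by omega) (by omega))).symm
    · rw [h2, h3] at h1 hlt
      push_cast at h1 hx hlt
      obtain rfl : ε = -1 := by omega
      exact ((right_iff hε hw (by omega) (by omega)).1
        (h1 (by omega) (by omega) x (by omega) (by omega))).symm
  · intro r t p q hrt hpq hrp hqt hne
    rw [Ne, Prod.mk.injEq] at hne
    have h1 := h.prop6 r t p q ((isBlock_iff hε hw).1 hrt) ((isSignBlock_iff hε' hw).1 hpq)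
      (by omega) (by omega) (by omega)
    rw [oddRows_iff]
    omega
  · intro r t hrt hev
    have h1 := h.prop7 r t ((isBlock_iff hε hw).1 hrt) (evenRows_iff.1 hev)
    constructor
    · intro q hq hev'
      exact_mod_cast h1.1 q ((isSignBlock_iff hε hw).1 hq) (evenRows_iff.1 hev')
    · intro p hp hev'
      exact_mod_cast h1.2 p ((isSignBlock_iff hε hw).1 hp) (evenRows_iff.1 hev')

theorem InitiallyUncanceled.uncanceledMatrix {n j : ℕ} (h : InitiallyUncanceled n j w) :
    UncanceledMatrix n j (n - 1) 1 w where
  prop1 := h.prop1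
  prop2 := h.prop2
  prop3 := h.prop3
  prop4 t ht := by
    rcases Nat.even_or_odd n with hn | hn
    · exact absurd ht (h.prop4_even hn t)
    · exact (h.prop4_odd hn).2 t ht
  prop5 := h.prop5
  prop6 := h.prop6
  prop7 := h.prop7

theorem FinallyUncanceled.uncanceledMatrix (h : FinallyUncanceled N k w) :
    UncanceledMatrix N k N (-1) w where
  prop1 := h.prop1
  prop2 := h.prop2
  prop3 := h.prop3
  prop4 t ht := by
    rcases Nat.even_or_odd N with hn | hn
    · exact (h.prop4_even hn).2 t ht
    · exact absurd ht (h.prop4_odd hn t)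
  prop5 := h.prop5
  prop6 := h.prop6
  prop7 := h.prop7

/-- Each such pair has its upper entry in row 1, with the same sign, so the columns agree. -/
theorem isPair_unique (hw : w ∈ B m)
    (h : ∀ t, IsPair m k (-1) 1 w t → row w (pairHi ε t) = 1) {t t' : ℕ}
    (ht : IsPair m k (-1) 1 w t) (ht' : IsPair m k (-1) 1 w t') : t = t' := by
  have h1 := h t ht
  have h2 := h t' ht'
  rw [isPair_iff hw (Or.inr rfl) (Or.inl rfl)] at ht ht'
  rw [row] at h1 h2
  have h5 := pair_cases ε t
  have h6 := pair_cases ε t'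
  have key : w (pairHi ε t) = w (pairHi ε t') := by
    obtain ⟨-, h3, h4⟩ | ⟨-, h3, h4⟩ := h5 <;> obtain ⟨-, h3', h4'⟩ | ⟨-, h3', h4'⟩ := h6 <;>
      rw [h3] at h1 ⊢ <;> rw [h3'] at h2 ⊢ <;> push_cast at h1 h2 ⊢ <;> omega
  have := w.injective key
  omega

/-- The case distinction in condition 4 comes from b ≢ n-1: a (-1, 1) pair has b = 1, which is
impossible for even n. In the final case the requirement is b ≢ N, which excludes odd N. -/
theorem UncanceledMatrix.initiallyUncanceled {n j : ℕ} (hw : w ∈ B n) (hn : 1 ≤ n)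
    (hU : ∀ a b, PairRows n j 1 w a b → b % 2 ≠ (n - 1 : ℕ) % 2)
    (h : UncanceledMatrix n j (n - 1) 1 w) : InitiallyUncanceled n j w where
  prop1 := h.prop1
  prop2 := h.prop2
  prop3 := h.prop3
  prop4_even hn' t ht := by
    have h1 := (h.prop4 t ht).1
    rw [isPair_iff hw (Or.inr rfl) (Or.inl rfl)] at ht
    have h2 := hU _ _ ⟨t, ht.1, rfl, rfl⟩
    rw [Nat.even_iff] at hn'
    rw [row] at h1
    omega
  prop4_odd _ := ⟨fun _ _ => isPair_unique hw fun t ht => (h.prop4 t ht).1, h.prop4⟩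
  prop5 := h.prop5
  prop6 := h.prop6
  prop7 := h.prop7

theorem UncanceledMatrix.finallyUncanceled (hw : w ∈ B N)
    (hU : ∀ a b, PairRows N k (-1) w a b → b % 2 ≠ N % 2)
    (h : UncanceledMatrix N k N (-1) w) : FinallyUncanceled N k w where
  prop1 := h.prop1
  prop2 := h.prop2
  prop3 := h.prop3
  prop4_even _ := ⟨fun _ _ => isPair_unique hw fun t ht => (h.prop4 t ht).1, h.prop4⟩
  prop4_odd hn' t ht := by
    have h1 := (h.prop4 t ht).1
    rw [isPair_iff hw (Or.inr rfl) (Or.inl rfl)] at ht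
    have h2 := hU _ _ ⟨t, ht.1, rfl, rfl⟩
    rw [Nat.odd_iff] at hn'
    rw [row] at h1
    omega
  prop5 := h.prop5
  prop6 := h.prop6
  prop7 := h.prop7

end SignedPerm

/-! ### Uncanceled elements as reduced data; insertion of the last row and its column -/

namespace SignedPerm

variable {N k n j : ℕ} {ε δ : ℤ} {w : Equiv.Perm ℤ} {I : Finset ℕ}

theorem mem_chessboard_iff : w ∈ chessboard n ↔
    w ∈ B n ∧ ∀ c : ℕ, 1 ≤ c → c ≤ n → w c % 2 = (c : ℤ) % 2 := by
  refine and_congr_right fun hw => ?_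
  constructor
  · intro h c hc hcn
    have h1 := B_range hw (x := c) (by omega) (by omega)
    have h2 := B_ne_zero hw (x := c) (by omega)
    have h3 := h (w c).natAbs (by rw [Finset.mem_Icc]; omega) c (by rw [Finset.mem_Icc]; omega) (by
      rw [entry, Int.natCast_natAbs]
      rcases abs_cases (w c) with h | h <;> rw [h.1] <;> split_ifs <;> norm_num <;> omega)
    rw [Nat.even_iff] at h3
    omega
  · intro h i hi c hc hne
    rw [Finset.mem_Icc] at hi hc
    have h1 := h c hc.1 hc.2
    rw [entry] at hne
    rw [Nat.even_iff]
    split_ifs at hne with h2 h3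
    · omega
    · omega
    · exact absurd rfl hne

/-- The data that the uncanceled elements of both kinds have in common, once the column of the last
row is deleted from those of the first kind. -/
structure IsReduced (N k : ℕ) (I : Finset ℕ) (ε : ℤ) (w : Equiv.Perm ℤ) : Prop where
  mem : w ∈ B N
  parity : ∀ c : ℕ, 1 ≤ c → c ≤ k → w c % 2 = (c : ℤ) % 2
  isU : IsU N (Right N k ε w) (PairRows N k ε w)
  left : ∀ i : ℕ, i < k → i ∉ I → w i < w (i + 1)
  right : ∀ i : ℕ, k < i → i < N → i + 1 ∉ I → w i < w (i + 1)

theorem IsReduced.transfer (hε : ε = 1 ∨ ε = -1) (hk : k % 2 = N % 2) (hkN : k ≤ N)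
    (h : IsReduced N k I ε w) : IsReduced N k I (-ε) (transfer N k ε w) where
  mem := transfer_mem hε h.mem hk h.isU
  parity c hc hck := by
    rw [transfer_parity_left hε h.mem hk h.isU hkN (by omega) (by omega)]
    exact h.parity c hc hck
  isU := isU_transfer hε h.mem hk h.isU
  left i hi hiI := (transfer_lt_iff_left hε h.mem hk h.isU hkN (by omega) (by omega) (by omega)
    (by omega)).2 (h.left i hi hiI)
  right i hki hi hiI := (transfer_lt_iff_right hε h.mem hk h.isU (by omega) (by omega) (by omega)
    (by omega)).2 (h.right i hki hi hiI)

/-- For ε = 1 the deletion has renumbered the columns right of k by one, which reverses the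
chessboard parity there. -/
theorem IsReduced.parity_right (hε : ε = 1 ∨ ε = -1) (hk : k % 2 = N % 2)
    (h : IsReduced N k I ε w) {c : ℕ} (hc : k < c) (hcN : c ≤ N) :
    w c % 2 = if ε = 1 then ((c : ℤ) + 1) % 2 else (c : ℤ) % 2 := by
  obtain ⟨d, hd, h1⟩ := exists_pairCol hk (d := c) (by omega) (by omega) ε
  have h2 := h.isU _ _ ⟨d, hd, rfl, rfl⟩
  have h3 := pair_cases ε d
  obtain ⟨h4, h5, h6⟩ := hd
  rcases h1 with h1 | h1 <;> rw [← h1] at h2 <;> rcases hε with rfl | rfl <;> norm_num <;> omega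

theorem isU_of_pair_lt (hε : ε = 1 ∨ ε = -1) (hw : w ∈ B N) (hk : k % 2 = N % 2)
    (hpar : ∀ c : ℕ, k < c → c ≤ N → w c % 2 = if ε = 1 then ((c : ℤ) + 1) % 2 else (c : ℤ) % 2)
    (hlt : ∀ c, IsPairCol N k c → w c < w (c + 1))
    (h : Uncanceled N (Right N k ε w) (Right N k (-ε) w) (PairRows N k ε w)) :
    IsU N (Right N k ε w) (PairRows N k ε w) := by
  refine (pattern_of_mem hε hw hk).isU_of_uncanceled h ?_
  rintro a b ⟨c, hc, rfl, rfl⟩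
  have h1 := hlt c hc
  obtain ⟨h2, h3, h4⟩ := hc
  have h5 := hpar c h2 (by omega)
  have h6 := hpar (c + 1) (by omega) h3
  push_cast at h6
  obtain ⟨h7, h8, h9⟩ | ⟨h7, h8, h9⟩ := pair_cases ε c
  · subst h9
    rw [h7, h8]
    norm_num at h5 h6 ⊢
    omega
  · obtain rfl : ε = -1 := by omega
    rw [h7, h8]
    norm_num at h5 h6 ⊢
    omega

theorem pairRows_lt_of_lt (hε : ε = 1 ∨ ε = -1) (hlt : ∀ c, IsPairCol N k c → w c < w (c + 1)) :
    ∀ a b, PairRows N k ε w a b → a < b := by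
  rintro a b ⟨c, hc, rfl, rfl⟩
  have h1 := hlt c hc
  obtain ⟨h7, h8, h9⟩ | ⟨h7, h8, h9⟩ := pair_cases ε c
  · rw [h7, h8, h9]
    push_cast
    omega
  · obtain rfl : ε = -1 := by omega
    rw [h7, h8]
    push_cast
    omega

/-- A descent at k is permitted, or k = N and there is no such position, so the ascent conditions
separate into those left and those right of column k. By the parity of I, no descent is allowed
between the two columns of a pair; this gives the ascents required for `IsU`. -/
theorem mem_V_iff (hk : k % 2 = N % 2) (hkN : k ≤ N) (hkI : k = N ∨ k + 1 ∈ I)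
    (hpar : ∀ i ∈ I, k < i → i % 2 ≠ N % 2) :
    w ∈ V N (Finset.range N \ shiftDown I (k + 1)) k ↔ IsReduced N k I (-1) w := by
  have hJ : ∀ i, i ∈ shiftDown I (k + 1) ↔ (i < k + 1 ∧ i ∈ I) ∨ (k ≤ i ∧ i + 1 ∈ I) := by
    intro i
    rw [shiftDown, Finset.mem_union, Finset.mem_filter, Finset.mem_image]
    refine or_congr and_comm ⟨?_, ?_⟩
    · rintro ⟨x, hx, rfl⟩
      rw [Finset.mem_filter] at hx
      rw [Nat.sub_add_cancel (by omega)]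
      exact ⟨by omega, hx.1⟩
    · rintro ⟨h1, h2⟩
      exact ⟨i + 1, Finset.mem_filter.2 ⟨h2, by omega⟩, by omega⟩
  rw [V, Set.mem_ofPred_eq, chessQuotient, Set.mem_inter_iff, mem_chessboard_iff, mem_quotient_iff]
  constructor
  · rintro ⟨⟨⟨hw, hc⟩, -, hasc⟩, hF⟩
    have hright : ∀ i : ℕ, k < i → i < N → i + 1 ∉ I → w i < w (i + 1) := by
      intro i hi hiN hiI
      refine hasc i hiN ?_
      rw [hJ]
      rintro (h | h)
      · omega
      · exact hiI h.2
    have hlt : ∀ c, IsPairCol N k c → w c < w (c + 1) := by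
      rintro c ⟨h1, h2, h3⟩
      exact hright c h1 (by omega) fun h => by have := hpar _ h (by omega); omega
    refine ⟨hw, fun c h1 h2 => hc c h1 (by omega), ?_, ?_, hright⟩
    · refine isU_of_pair_lt (Or.inr rfl) hw hk (fun c h1 h2 => ?_) hlt ?_
      · simpa using hc c (by omega) h2
      · exact hF.uncanceledMatrix.uncanceled (Or.inr rfl) hw le_rfl
          (pairRows_lt_of_lt (Or.inr rfl) hlt)
    · intro i hi hiI
      refine hasc i (by omega) ?_
      rw [hJ]
      rintro (h | h)
      · exact hiI h.2
      · omega
  · intro h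
    refine ⟨⟨⟨h.mem, fun c h1 h2 => ?_⟩, h.mem, fun i hi hiJ => ?_⟩, ?_⟩
    · by_cases hc : c ≤ k
      · exact h.parity c h1 hc
      · simpa using h.parity_right (Or.inr rfl) hk (by omega) h2
    · rw [hJ] at hiJ
      rcases lt_trichotomy i k with h1 | h1 | h1
      · exact h.left i h1 fun h2 => hiJ (Or.inl ⟨by omega, h2⟩)
      · subst h1
        exact absurd hkI (by
          rintro (h2 | h2)
          · omega
          · exact hiJ (Or.inr ⟨le_rfl, h2⟩))
      · exact h.right i h1 hi fun h2 => hiJ (Or.inr ⟨h1.le, h2⟩)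
    · refine UncanceledMatrix.finallyUncanceled h.mem (fun a b hab => (h.isU a b hab).2.1) ?_
      refine Uncanceled.uncanceledMatrix (Or.inr rfl) h.mem le_rfl
        (fun a b hab => by have := h.isU a b hab; omega) ?_
      exact (pattern_of_mem (Or.inr rfl) h.mem hk).uncanceled_of_isU h.isU

section column

variable {u : Equiv.Perm ℤ}

/-- The insertion of a column with entry `1` in a new last row. -/
theorem insert_apply (hu : u ∈ B N) (hkN : k ≤ N) (x : ℤ) :
    (u * descProd (k + 1) N) x = if (k : ℤ) + 1 < x ∧ x ≤ N + 1 then u (x - 1) else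
      if x = k + 1 then (N : ℤ) + 1 else if (k : ℤ) + 1 < -x ∧ -x ≤ N + 1 then u (x + 1) else
      if x = -(k + 1) then -((N : ℤ) + 1) else u x := by
  rw [Equiv.Perm.mul_apply, descProd_apply (by omega) (by omega)]
  push_cast
  split_ifs
  · rfl
  · exact B_fix hu (by omega)
  · rfl
  · rw [B_neg hu, B_fix hu (by omega)]
  · rfl

theorem insert_mem (hu : u ∈ B N) : u * descProd (k + 1) N ∈ B (N + 1) :=
  mul_mem (B_mono (by omega) hu) (descProd_mem_B (by omega))

theorem right_insert (hu : u ∈ B N) (hkN : k ≤ N) (hε : ε = 1 ∨ ε = -1) :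
    Right (N + 1) (k + 1) ε (u * descProd (k + 1) N) = Right N k ε u := by
  ext x
  rw [Right, Right, mul_inv_rev, descProd_eq_inv, inv_inv, Equiv.Perm.mul_apply,
    ascProd_apply (by omega) (by omega)]
  have hu' := inv_mem hu
  by_cases hx : 1 ≤ x ∧ x ≤ N
  · have h1 := B_range hu' (x := ε * x) (by rcases hε with rfl | rfl <;> omega)
      (by rcases hε with rfl | rfl <;> omega)
    push_cast
    split_ifs <;> omega
  · by_cases hx' : x = N + 1
    · rcases hε with rfl | rfl
      · rw [one_mul, B_fix hu' (by omega)]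
        push_cast
        split_ifs <;> omega
      · rw [neg_one_mul, B_neg hu', B_fix hu' (by omega)]
        push_cast
        split_ifs <;> omega
    · push_cast
      omega

theorem pairRows_insert (hu : u ∈ B N) (hkN : k ≤ N) :
    PairRows (N + 1) (k + 1) ε (u * descProd (k + 1) N) = PairRows N k ε u := by
  have h : ∀ c : ℕ, k < c → c ≤ N → (u * descProd (k + 1) N) (c + 1 : ℕ) = u c := by
    intro c h1 h2
    rw [insert_apply hu hkN, if_pos (by push_cast; omega)]
    push_cast
    rw [add_sub_cancel_right]
  have h' : ∀ c, IsPairCol N k c →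
      (u * descProd (k + 1) N) (pairLo ε (c + 1)) = u (pairLo ε c) ∧
      (u * descProd (k + 1) N) (pairHi ε (c + 1)) = u (pairHi ε c) := by
    intro c hc
    have h1 := pair_cases ε c
    have h2 := pair_cases ε (c + 1)
    have h3 := pairCol_range hc ε
    have e1 : pairLo ε (c + 1) = pairLo ε c + 1 := by omega
    have e2 : pairHi ε (c + 1) = pairHi ε c + 1 := by omega
    rw [e1, e2]
    exact ⟨h _ (by omega) (by omega), h _ (by omega) (by omega)⟩
  ext a b
  constructor
  · rintro ⟨c, ⟨h1, h2, h3⟩, rfl, rfl⟩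
    obtain ⟨d, rfl⟩ : ∃ d, c = d + 1 := ⟨c - 1, by omega⟩
    have hd : IsPairCol N k d := ⟨by omega, by omega, by omega⟩
    exact ⟨d, hd, by rw [(h' d hd).1], by rw [(h' d hd).2]⟩
  · rintro ⟨d, hd, rfl, rfl⟩
    refine ⟨d + 1, ?_, by rw [(h' d hd).1], by rw [(h' d hd).2]⟩
    obtain ⟨h1, h2, h3⟩ := hd
    exact ⟨by omega, by omega, by omega⟩

/-- The inserted value N+1 is the largest, so position k is an ascent. Position k+1 either lies in I
or, for k = N, does not exist. All remaining conditions are those on u with the columns right of k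
renumbered. -/
theorem insert_mem_U_iff (hu : u ∈ B N) (hk : k % 2 = N % 2) (hkN : k ≤ N)
    (hkI : k = N ∨ k + 1 ∈ I) (hpar : ∀ i ∈ I, k < i → i % 2 ≠ N % 2) :
    u * descProd (k + 1) N ∈ U (N + 1) (Finset.range (N + 1) \ I) (k + 1) ↔
      IsReduced N k I 1 u := by
  have hw := insert_mem (k := k) hu
  have hap := insert_apply (k := k) hu hkN
  have hP := right_insert (k := k) (ε := 1) hu hkN (Or.inl rfl)
  have hM := right_insert (k := k) (ε := -1) hu hkN (Or.inr rfl)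
  have hT := pairRows_insert (k := k) (ε := 1) hu hkN
  generalize u * descProd (k + 1) N = w at *
  have hl : ∀ c : ℤ, 0 ≤ c → c ≤ k → w c = u c := by
    intro c h1 h2
    rw [hap, if_neg (by omega), if_neg (by omega), if_neg (by omega), if_neg (by omega)]
  have hm : w (k + 1) = N + 1 := by
    rw [hap, if_neg (by omega), if_pos rfl]
  have hr : ∀ c : ℤ, k < c → c ≤ N → w (c + 1) = u c := by
    intro c h1 h2
    rw [hap, if_pos (by omega), add_sub_cancel_right]
  rw [U, Set.mem_ofPred_eq, chessQuotientAt, Set.mem_ofPred_eq, chessQuotient, Set.mem_inter_iff,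
    mem_chessboard_iff, mem_quotient_iff]
  constructor
  · rintro ⟨⟨⟨⟨-, hc⟩, -, hasc⟩, -⟩, hF⟩
    have hright : ∀ i : ℕ, k < i → i < N → i + 1 ∉ I → u i < u (i + 1) := by
      intro i hi hiN hiI
      have := hasc (i + 1) (by omega) hiI
      rw [← hr i (by omega) (by omega), ← hr (i + 1) (by omega) (by omega)]
      exact_mod_cast this
    have hlt : ∀ c, IsPairCol N k c → u c < u (c + 1) := by
      rintro c ⟨h1, h2, h3⟩
      exact hright c h1 (by omega) fun h => by have := hpar _ h (by omega); omega
    refine ⟨hu, fun c h1 h2 => ?_, ?_, fun i hi hiI => ?_, hright⟩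
    · rw [← hl c (by omega) (by omega)]
      exact hc c h1 (by omega)
    · refine isU_of_pair_lt (Or.inl rfl) hu hk (fun c h1 h2 => ?_) hlt ?_
      · have := hc (c + 1) (by omega) (by omega)
        push_cast at this
        rw [hr c (by omega) (by omega)] at this
        simpa using this
      · have h1 := hF.uncanceledMatrix.uncanceled (Or.inl rfl) hw (by omega) (by
          rw [hT]
          exact pairRows_lt_of_lt (Or.inl rfl) hlt)
        rwa [hP, hM, hT] at h1
    · rw [← hl i (by omega) (by omega), ← hl (i + 1) (by omega) (by omega)]
      exact hasc i (by omega) hiI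
  · intro h
    refine ⟨⟨⟨⟨hw, fun c h1 h2 => ?_⟩, hw, fun i hi hiI => ?_⟩, Or.inl (by exact_mod_cast hm)⟩, ?_⟩
    · rcases lt_trichotomy c (k + 1) with h3 | h3 | h3
      · rw [hl c (by omega) (by omega)]
        exact h.parity c h1 (by omega)
      · subst h3
        push_cast
        rw [hm]
        omega
      · have h4 := h.parity_right (c := c - 1) (Or.inl rfl) hk (by omega) (by omega)
        rw [if_pos rfl, ← hr _ (by omega) (by omega)] at h4
        rwa [show (((c - 1 : ℕ) : ℤ) + 1) = c by omega] at h4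
    · rcases lt_trichotomy i k with h1 | h1 | h1
      · rw [hl i (by omega) (by omega), hl (i + 1) (by omega) (by omega)]
        exact h.left i h1 hiI
      · subst h1
        rw [hm, hl i (by omega) le_rfl]
        have := B_range hu (x := i) (by omega) (by omega)
        omega
      · rcases eq_or_lt_of_le (Nat.succ_le_of_lt h1) with h2 | h2
        · subst h2
          rcases hkI with h3 | h3
          · omega
          · exact absurd h3 hiI
        · obtain ⟨i, rfl⟩ : ∃ i', i = i' + 1 := ⟨i - 1, by omega⟩
          push_cast
          rw [hr i (by omega) (by omega), hr (i + 1) (by omega) (by omega)]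
          exact h.right i (by omega) (by omega) hiI
    · refine UncanceledMatrix.initiallyUncanceled hw (by omega) (fun a b hab => ?_) ?_
      · rw [hT] at hab
        exact (h.isU a b hab).2.1
      · refine Uncanceled.uncanceledMatrix (Or.inl rfl) hw (by omega) (fun a b hab => ?_) ?_
        · rw [hT] at hab
          have := h.isU a b hab
          omega
        · rw [hP, hM, hT]
          exact (pattern_of_mem (Or.inl rfl) hu hk).uncanceled_of_isU h.isU

/-- The alternative w(j+1) = -n is excluded by the chessboard condition, as j+1 ≢ n; for j = n
column j+1 is fixed. So w(j) = n, and the deletion leads into B_N. -/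
theorem mul_ascProd_mem_of_mem_U (hk : k % 2 = N % 2) (hkN : k ≤ N)
    (hw : w ∈ U (N + 1) (Finset.range (N + 1) \ I) (k + 1)) :
    w ∈ B (N + 1) ∧ w (k + 1) = N + 1 ∧ w * ascProd (k + 1) N ∈ B N := by
  rw [U, Set.mem_ofPred_eq, chessQuotientAt, Set.mem_ofPred_eq, chessQuotient, Set.mem_inter_iff,
    mem_chessboard_iff] at hw
  obtain ⟨⟨⟨⟨hwB, hc⟩, -⟩, hj⟩, -⟩ := hw
  have h1 : w (k + 1) = N + 1 := by
    rcases hj with h | h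
    · exact_mod_cast h
    · push_cast at h
      by_cases h2 : k = N
      · rw [B_fix hwB (by push_cast; omega)] at h
        omega
      · have h3 := hc (k + 2) (by omega) (by omega)
        push_cast at h3
        rw [add_assoc] at h
        norm_num at h
        rw [h] at h3
        omega
  refine ⟨hwB, h1, mem_B_of_fix (mul_mem hwB (ascProd_mem_B (by omega))) ?_⟩
  rw [Equiv.Perm.mul_apply, ascProd_apply (by omega) (by omega), if_neg (by omega), if_pos rfl]
  exact_mod_cast h1

theorem mul_ascProd_mul_descProd (a b : ℕ) (w : Equiv.Perm ℤ) :
    w * ascProd a b * descProd a b = w := by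
  rw [descProd_eq_inv, mul_inv_cancel_right]

theorem mul_descProd_mul_ascProd (a b : ℕ) (w : Equiv.Perm ℤ) :
    w * descProd a b * ascProd a b = w := by
  rw [descProd_eq_inv, inv_mul_cancel_right]

end column

end SignedPerm

/-! ### Assembly of the bijection and of the formulas for sign and `L` -/

theorem mainTheorem7 (n : ℕ) (I J : Finset ℕ) (j : ℕ)
    (hI : I ⊆ Finset.range n)
    (hj : 1 ≤ j) (hjI : j ∈ insert n I)
    (hpar : ∀ i ∈ insert n I, j ≤ i → i ≡ n [MOD 2])
    (hJ : J = SignedPerm.shiftDown I j) :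
    Set.MapsTo (SignedPerm.lowering n j)
        (SignedPerm.U n (Finset.range n \ I) j)
        (SignedPerm.V (n - 1) (Finset.range (n - 1) \ J) (j - 1)) ∧
      Set.MapsTo (SignedPerm.raising n j)
        (SignedPerm.V (n - 1) (Finset.range (n - 1) \ J) (j - 1))
        (SignedPerm.U n (Finset.range n \ I) j) ∧
      Set.InvOn (SignedPerm.raising n j) (SignedPerm.lowering n j)
        (SignedPerm.U n (Finset.range n \ I) j)
        (SignedPerm.V (n - 1) (Finset.range (n - 1) \ J) (j - 1)) ∧
      Set.BijOn (SignedPerm.lowering n j)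
        (SignedPerm.U n (Finset.range n \ I) j)
        (SignedPerm.V (n - 1) (Finset.range (n - 1) \ J) (j - 1)) ∧
      ∀ w ∈ SignedPerm.U n (Finset.range n \ I) j,
        SignedPerm.sgn (n - 1) (SignedPerm.lowering n j w) = SignedPerm.sgn n w ∧
          SignedPerm.L (n - 1) (SignedPerm.lowering n j w) =
            SignedPerm.L n w - ((n : ℚ) - (j : ℚ)) := by
  open SignedPerm in
  subst hJ
  have hjn : j ≤ n := by
    rw [Finset.mem_insert] at hjI
    rcases hjI with h | h
    · exact h.le
    · exact (Finset.mem_range.1 (hI h)).le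
  have hjn' : j % 2 = n % 2 := hpar j hjI le_rfl
  obtain ⟨k, rfl⟩ : ∃ k, j = k + 1 := ⟨j - 1, by omega⟩
  obtain ⟨N, rfl⟩ : ∃ N, n = N + 1 := ⟨n - 1, by omega⟩
  rw [Nat.add_sub_cancel, Nat.add_sub_cancel]
  have hk : k % 2 = N % 2 := by omega
  have hkN : k ≤ N := by omega
  have hkI : k = N ∨ k + 1 ∈ I := by
    rw [Finset.mem_insert] at hjI
    exact hjI.imp_left (by omega)
  have hpar' : ∀ i ∈ I, k < i → i % 2 ≠ N % 2 := by
    intro i hi hki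
    have h : i % 2 = (N + 1) % 2 := hpar i (Finset.mem_insert_of_mem hi) hki
    omega
  -- By definition both maps are transfers, apart from the deletion before H and the insertion after
  -- R.
  have hlow : ∀ w, lowering (N + 1) (k + 1) w = transfer N k 1 (w * ascProd (k + 1) N) :=
    fun w => rfl
  have hraise : ∀ v, raising (N + 1) (k + 1) v = transfer N k (-1) v * descProd (k + 1) N :=
    fun v => rfl
  have hred : ∀ w ∈ U (N + 1) (Finset.range (N + 1) \ I) (k + 1),
      IsReduced N k I 1 (w * ascProd (k + 1) N) := by
    intro w hw
    have h1 := (mul_ascProd_mem_of_mem_U hk hkN hw).2.2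
    rw [← insert_mem_U_iff h1 hk hkN hkI hpar', mul_ascProd_mul_descProd]
    exact hw
  have hε : (1 : ℤ) = 1 ∨ (1 : ℤ) = -1 := Or.inl rfl
  have hε' : (-1 : ℤ) = 1 ∨ (-1 : ℤ) = -1 := Or.inr rfl
  have hmapsL : Set.MapsTo (lowering (N + 1) (k + 1))
      (U (N + 1) (Finset.range (N + 1) \ I) (k + 1))
      (V N (Finset.range N \ shiftDown I (k + 1)) k) := by
    intro w hw
    rw [mem_V_iff hk hkN hkI hpar', hlow]
    exact (hred w hw).transfer hε hk hkN
  have hmapsR : Set.MapsTo (raising (N + 1) (k + 1))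
      (V N (Finset.range N \ shiftDown I (k + 1)) k)
      (U (N + 1) (Finset.range (N + 1) \ I) (k + 1)) := by
    intro v hv
    rw [mem_V_iff hk hkN hkI hpar'] at hv
    have h1 : IsReduced N k I 1 (transfer N k (-1) v) := hv.transfer hε' hk hkN
    rw [hraise, insert_mem_U_iff h1.mem hk hkN hkI hpar']
    exact h1
  have hinv : Set.InvOn (raising (N + 1) (k + 1)) (lowering (N + 1) (k + 1))
      (U (N + 1) (Finset.range (N + 1) \ I) (k + 1))
      (V N (Finset.range N \ shiftDown I (k + 1)) k) := by
    constructor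
    · intro w hw
      have h := hred w hw
      rw [hraise, hlow, transfer_transfer hε h.mem hk h.isU, mul_ascProd_mul_descProd]
    · intro v hv
      rw [mem_V_iff hk hkN hkI hpar'] at hv
      rw [hlow, hraise, mul_descProd_mul_ascProd]
      exact transfer_transfer hε' hv.mem hk hv.isU
  refine ⟨hmapsL, hmapsR, hinv, hinv.bijOn hmapsL hmapsR, fun w hw => ?_⟩
  have h := hred w hw
  obtain ⟨hwB, hwj, -⟩ := mul_ascProd_mem_of_mem_U hk hkN hw
  constructor
  -- The deletion uses N-k generators, an even number.
  · rw [hlow, sgn_transfer hε h.mem hk h.isU, ← sgn_of_le (Nat.le_succ N) h.mem,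
      sgn_mul hwB (ascProd_mem_B (by omega)), sgn_ascProd (by omega),
      Even.neg_one_pow (Nat.even_iff.2 (by omega)), mul_one]
  · have h1 := twiceL_transfer h.mem hk hkN h.isU
    have h2 := twiceL_eq_column (n := N + 1) (j := k + 1) hwB hj hjn hjn' (by exact_mod_cast hwj)
      h.mem h.isU
    rw [Nat.add_sub_cancel, Nat.add_sub_cancel] at h2
    -- The corrections for a mixed pair in `h1` and `h2` cancel; each of the two steps contributes
    -- N-k.
    have h3 : twiceL N (transfer N k 1 (w * ascProd (k + 1) N)) =
        twiceL (N + 1) w - 2 * (N - k) := by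
      push_cast at h2
      split_ifs at h1 h2 <;> omega
    rw [hlow, L_eq, L_eq, h3]
    push_cast
    ring
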